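/- Let $n\ge 1$, let $q\in[2,\infty]$ with $q>8/n$, and write $\langle a\rangle=1+|a|$ and, for $k=(k_1,\dots,k_n)\in\mathbb Z^n$, $k_{\max}=\max_{1\le l\le n}|k_l|$. Let $Q_k=\{\xi\in\mathbb R^n:\ -1/2\le \xi_j-k_j<1/2,\ j=1,\dots,n\}$, and let $(\sigma_k)_{k\in\mathbb Z^n}$ be a family of smooth functions $\sigma_k:\mathbb R^n\to\mathbb R$ such that: there is $c>0$ with $\sigma_k\ge c$ on $Q_k$ for all $k$; $\operatorname{supp}\sigma_k\subset\{\xi:|\xi-k|\le\sqrt n\}$ for all $k$; $\sum_{k}\sigma_k(\xi)=1$ for all $\xi\in\mathbb R^n$; and for every $m\in\mathbb N$ all derivatives of order at most $m$ of the $\sigma_k$ are bounded on $\mathbb R^n$ by a constant $C_m$ independent of $k$. With $\mathscr F f(\xi)=\int e^{-\mathrm i x\cdot\xi}f(x)\,dx$ (extended to $L^2(\mathbb R^n)$), put $$\Box_k=\mathscr F^{-1}\sigma_k\mathscr F,\qquad S(t)=\mathscr F^{-1}e^{\mathrm i t(|\xi|^4+\varepsilon|\xi|^2)}\mathscr F,\qquad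 \varepsilon\in\{0,1\}.$$ Then there is a constant $C$, depending only on $n$, $q$ and the family $(\sigma_k)$, such that for both values of $\varepsilon$, all $i\in\{1,\dots,n\}$, all $k\in\mathbb Z^n$ and all $u_0\in L^2(\mathbb R^n)$, $$\|\Box_k S(t)u_0\|_{L^q_{x_i}L^\infty_{(x_j)_{j\ne i}}L^\infty_t(\mathbb R^{1+n})}\le C\,\langle k_{\max}\rangle^{3/q}\,\|\Box_k u_0\|_{L^2(\mathbb R^n)},$$ where $3/q=0$ if $q=\infty$, and the norm on the left is the $L^q$ norm in $x_i\in\mathbb R$ of the $L^\infty$ norm in the remaining variables $((x_j)_{j\ne i},t)\in\mathbb R^{n-1}\times\mathbb R$. -/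

import Mathlib

open MeasureTheory FourierTransform
open scoped ENNReal NNReal ContDiff

noncomputable section

namespace FourthOrderNLS

/-- Euclidean space `ℝⁿ`. -/
abbrev Eucl (n : ℕ) : Type := EuclideanSpace ℝ (Fin n)

/-- A lattice point `k ∈ ℤⁿ` viewed as a point of `ℝⁿ`. -/
def latticePt {n : ℕ} (k : Fin n → ℤ) : Eucl n := WithLp.toLp 2 (fun j => (k j : ℝ))

/-- The unit cube `Q_k = {ξ : -1/2 ≤ ξ_j - k_j < 1/2, j = 1, …, n}`. -/
def unitCube {n : ℕ} (k : Fin n → ℤ) : Set (Eucl n) :=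
  {ξ | ∀ j, -(1 / 2 : ℝ) ≤ ξ j - (k j : ℝ) ∧ ξ j - (k j : ℝ) < 1 / 2}

/-- The class `Υ` of frequency-uniform partitions of unity `(σ_k)_{k ∈ ℤⁿ}`: all the bounds are
uniform in `k`. -/
structure IsUniformPartition {n : ℕ} (σ : (Fin n → ℤ) → Eucl n → ℝ) : Prop where
  smooth : ∀ k, ContDiff ℝ ∞ (σ k)
  lower : ∃ c : ℝ, 0 < c ∧ ∀ k, ∀ ξ ∈ unitCube k, c ≤ σ k ξ
  support : ∀ k, tsupport (σ k) ⊆ {ξ | ‖ξ - latticePt k‖ ≤ √(n : ℝ)}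
  sum_one : ∀ ξ, HasSum (fun k => σ k ξ) 1
  deriv_bound : ∀ m : ℕ, ∃ C : ℝ, ∀ k ξ, ‖iteratedFDeriv ℝ m (σ k) ξ‖ ≤ C

/-- The symbol `|ξ|⁴ + ε|ξ|²` of `Δ² - εΔ`. -/
def symbol {n : ℕ} (ε : ℝ) (ξ : Eucl n) : ℝ := ‖ξ‖ ^ 4 + ε * ‖ξ‖ ^ 2

/-- The unimodular multiplier `e^{it(|ξ|⁴ + ε|ξ|²)}`. -/
def phase {n : ℕ} (ε t : ℝ) (ξ : Eucl n) : ℂ := Complex.exp (((t * symbol ε ξ : ℝ) : ℂ) * Complex.I)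

lemma memLp_phase_mul {n : ℕ} (ε t : ℝ) (g : Lp (α := Eucl n) ℂ 2 volume) :
    MemLp (fun ξ : Eucl n => phase ε t ((2 * Real.pi) • ξ) * g ξ) 2 volume := by
  refine (Lp.memLp g).of_le_mul (c := 1) ?_ (Filter.Eventually.of_forall fun ξ => ?_)
  · refine AEStronglyMeasurable.mul (Continuous.aestronglyMeasurable ?_) (Lp.aestronglyMeasurable g)
    unfold phase symbol
    fun_prop
  · rw [norm_mul, phase, Complex.norm_exp_ofReal_mul_I]

/-- The group `S(t) = 𝓕⁻¹ e^{it(|ξ|⁴ + ε|ξ|²)} 𝓕` on `L²(ℝⁿ)`. Mathlib's Fourier transform has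
the kernel `e^{-2πi x·ξ}`, so the multiplier with symbol `m` for the kernel `e^{-i x·ξ}` is
multiplication by `m(2πξ)` here. -/
def propagator {n : ℕ} (ε t : ℝ) (f : Lp (α := Eucl n) ℂ 2 volume) :
    Lp (α := Eucl n) ℂ 2 volume :=
  𝓕⁻ ((memLp_phase_mul ε t (𝓕 f)).toLp _)

/-- `𝓕⁻¹ m 𝓕 f` for `f ∈ L²(ℝⁿ)` and a bounded, compactly supported `m`: since `m 𝓕 f` is then
integrable, this is given by the absolutely convergent inverse Fourier integral, at every point `x`.
The operator `□_k` is `box (σ k)`. -/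
def box {n : ℕ} (m : Eucl n → ℝ) (f : Lp (α := Eucl n) ℂ 2 volume) : Eucl n → ℂ :=
  𝓕⁻ (fun ξ : Eucl n =>
    (m ((2 * Real.pi) • ξ) : ℂ) * (𝓕 f : Lp (α := Eucl n) ℂ 2 volume) ξ)

/-- The point of `ℝⁿ` with `i`-th coordinate `s` and remaining coordinates `y`. -/
def insertCoord {n : ℕ} (i : Fin n) (s : ℝ) (y : {j : Fin n // j ≠ i} → ℝ) : Eucl n :=
  WithLp.toLp 2 (fun j => if h : j = i then s else y ⟨j, h⟩)

/-- The anisotropic norm of `L^{p₁}_{x_i} L^{p₂}_{(x_j)_{j ≠ i}} L^{p₂}_t(ℝ^{1+n})`. -/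
def anisoNorm {n : ℕ} (i : Fin n) (p₁ p₂ : ℝ≥0∞) (F : ℝ → Eucl n → ℂ) : ℝ≥0∞ :=
  eLpNorm (fun s : ℝ =>
    eLpNorm (fun z : ℝ × ({j : Fin n // j ≠ i} → ℝ) => F z.1 (insertCoord i s z.2)) p₂ volume)
    p₁ volume

/-- `k_max = max_l |k_l|`. -/
def kMax {n : ℕ} (k : Fin n → ℤ) : ℕ := Finset.univ.sup (fun l => (k l).natAbs)

/-- The bracket `⟨a⟩ = 1 + |a|`. -/
def bracket (a : ℝ) : ℝ := 1 + |a|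

end FourthOrderNLS

end

namespace FourthOrderNLS

/-! By Fourier inversion, `□_k S(t)u₀` superposes plane waves with an amplitude `g = σ_k(2πξ) û₀(ξ)`
supported in a ball of fixed radius about `c = k/2π`, and Plancherel gives `‖g‖₂ = ‖□_k u₀‖₂`. For
`q = ∞`, Cauchy–Schwarz on that ball is enough.

For `q < ∞` the argument is `TT*` in the variable `s = x_i`. The supremum over time and the other
coordinates is linearised by letting them be measurable functions of `s`. By duality and Young's
inequality it then suffices to dominate the kernel `oscInt`, uniformly in this choice, by some `κ(s
- s')` with `κ ∈ L^{q/2}`; the square of the operator norm is at most `‖κ‖_{q/2}`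
(`lintegral_iSup_enorm_integral_rpow_le`).

With `N` comparable to `⟨k_max⟩`, the kernel at displacement `x` is `O((1 + |x|/N³)^{-β})` for some
`β > 2/q` (`exists_norm_oscInt_le_one_add_norm_rpow`). As `|x| ≥ |s - s'|`, the `L^{q/2}` norm is
`O(N^{6/q})`, and its square root is the asserted `N^{3/q}`. Group velocities are `O(N³)`, so for
short times the phase is nonstationary and repeated integration by parts wins; for long times one
uses dispersive decay `|τ|^{-α}` with `α > β`, uniform in the centre `c`.

The Hessian of `|ξ|⁴` degenerates at the origin, so uniform decay is available only up to about
`|τ|^{-n/4}`; the condition `q > 8/n` says `2/q < n/4`. In dimension one the decay is van der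
Corput's. In dimension two it is van der Corput on parallel lines, integrated over the lines. In
dimension at least three, completing the square and a Gaussian integral subordinate the quartic flow
to the Schrödinger flow, whose decay is explicit. -/

/-! ### The inverse Fourier integral on `L¹ ∩ L²`. -/

theorem integral_fourierInv_mul_eq {V : Type*} [NormedAddCommGroup V] [InnerProductSpace ℝ V]
    [MeasurableSpace V] [BorelSpace V] [FiniteDimensional ℝ V] {f g : V → ℂ}
    (hf : Integrable f) (hg : Integrable g) :
    ∫ ξ, 𝓕⁻ f ξ * g ξ = ∫ x, f x * 𝓕⁻ g x := by
  have := VectorFourier.integral_fourierIntegral_smul_eq_flip (μ := (volume : Measure V))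
    (ν := (volume : Measure V)) (e := Real.fourierChar) (L := -(innerₗ V)) (f := f) (g := g)
    Real.continuous_fourierChar (continuous_inner (𝕜 := ℝ) (E := V)).neg hf hg
  have hflip : (-(innerₗ V)).flip = -(innerₗ V) := by
    ext x y
    simp [real_inner_comm]
  rw [hflip] at this
  simpa [Real.fourierInv_eq, VectorFourier.fourierIntegral] using this

/-- Both sides agree against smooth compactly supported test functions: these are Schwartz, the `L²`
transform is compatible with the one on tempered distributions, and the integral transform is
self-adjoint for the bilinear pairing. -/
theorem fourierInv_toLp_ae_eq {V : Type*} [NormedAddCommGroup V] [InnerProductSpace ℝ V]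
    [MeasurableSpace V] [BorelSpace V] [FiniteDimensional ℝ V] {g : V → ℂ}
    (hg : Integrable g) (hg2 : MemLp g 2) :
    ((𝓕⁻ (hg2.toLp g) : Lp (α := V) ℂ 2 volume) : V → ℂ) =ᵐ[volume] 𝓕⁻ g := by
  have hcont : Continuous (𝓕⁻ g) := by
    have := VectorFourier.fourierIntegral_continuous (μ := (volume : Measure V))
      (e := Real.fourierChar) (L := -(innerₗ V)) (f := g)
      Real.continuous_fourierChar (continuous_inner (𝕜 := ℝ) (E := V)).neg hg
    exact this
  refine ae_eq_of_integral_contDiff_smul_eq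
    ((Lp.memLp _).locallyIntegrable (by norm_num)) hcont.locallyIntegrable ?_
  intro φ hφ hφc
  have hφ₁ : HasCompactSupport (Complex.ofRealCLM ∘ φ) := hφc.comp_left rfl
  have hφ₂ : ContDiff ℝ ∞ (Complex.ofRealCLM ∘ φ) := by fun_prop
  set Φ : SchwartzMap V ℂ := hφ₁.toSchwartzMap hφ₂ with hΦ
  have hΦφ : ∀ x, Φ x = (φ x : ℂ) := fun x => rfl
  have key := congrArg (fun T => T Φ)
    (Lp.fourierInv_toTemperedDistribution_eq (hg2.toLp g))
  simp only [TemperedDistribution.fourierInv_apply, Lp.toTemperedDistribution_apply,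
    smul_eq_mul] at key
  calc ∫ x, φ x • ((𝓕⁻ (hg2.toLp g) : Lp (α := V) ℂ 2 volume) : V → ℂ) x
      = ∫ x, Φ x * ((𝓕⁻ (hg2.toLp g) : Lp (α := V) ℂ 2 volume) : V → ℂ) x := by
        simp [hΦφ]
    _ = ∫ x, (𝓕⁻ Φ) x * (hg2.toLp g : V → ℂ) x := key.symm
    _ = ∫ x, 𝓕⁻ (Φ : V → ℂ) x * g x := by
        refine integral_congr_ae ?_
        filter_upwards [hg2.coeFn_toLp] with x hx
        rw [hx, SchwartzMap.fourierInv_coe]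
    _ = ∫ x, Φ x * 𝓕⁻ g x := integral_fourierInv_mul_eq Φ.integrable hg
    _ = ∫ x, φ x • 𝓕⁻ g x := by simp [hΦφ]

theorem eLpNorm_fourierInv_eq {V : Type*} [NormedAddCommGroup V] [InnerProductSpace ℝ V]
    [MeasurableSpace V] [BorelSpace V] [FiniteDimensional ℝ V] {g : V → ℂ}
    (hg : Integrable g) (hg2 : MemLp g 2) :
    eLpNorm (𝓕⁻ g) 2 volume = eLpNorm g 2 volume := by
  rw [← eLpNorm_congr_ae (fourierInv_toLp_ae_eq hg hg2), ← eLpNorm_congr_ae hg2.coeFn_toLp,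
    ← Lp.enorm_def, ← Lp.enorm_def]
  have h : ‖(𝓕⁻ (hg2.toLp g) : Lp (α := V) ℂ 2 volume)‖ = ‖hg2.toLp g‖ :=
    (Lp.fourierTransformₗᵢ V ℂ).symm.norm_map _
  rw [← ofReal_norm, ← ofReal_norm, h]

/-! ### Young's inequality and the `TT*` pairing. -/

/-- With `p = q/(q-1)`, the integrand factors as `F₀^{1-2/q} F₁^{1/q} F₂^{1/q}`, where `F₀ = W(s)^p
W(s')^p`, `F₁ = W(s)^p κ^{q/2}` and `F₂ = W(s')^p κ^{q/2}`. Hölder applies since these exponents add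
up to one, and each `Fᵢ` integrates to a product. -/
theorem lintegral_lintegral_mul_mul_comp_sub_le {W κ : ℝ → ℝ≥0∞} (hW : Measurable W)
    (hκ : Measurable κ) {q : ℝ} (hq : 2 ≤ q) :
    ∫⁻ s, ∫⁻ s', W s * W s' * κ (s - s') ≤
      (∫⁻ s, W s ^ (q / (q - 1))) ^ (2 * (1 - 1 / q)) * (∫⁻ s, κ s ^ (q / 2)) ^ (2 / q) := by
  have hq0 : 0 < q := by linarith
  have hq1 : 0 < q - 1 := by linarith
  set p := q / (q - 1) with hp
  have hp0 : 0 ≤ p := by positivity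
  set A := ∫⁻ s, W s ^ p with hA
  set k := ∫⁻ s, κ s ^ (q / 2) with hk
  have ha : 0 ≤ 1 - 2 / q := by
    rw [sub_nonneg, div_le_one hq0]; exact hq
  have hb : 0 ≤ 1 / q := by positivity
  let F₀ : ℝ × ℝ → ℝ≥0∞ := fun z => W z.1 ^ p * W z.2 ^ p
  let F₁ : ℝ × ℝ → ℝ≥0∞ := fun z => W z.1 ^ p * κ (z.1 - z.2) ^ (q / 2)
  let F₂ : ℝ × ℝ → ℝ≥0∞ := fun z => W z.2 ^ p * κ (z.1 - z.2) ^ (q / 2)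
  have hm₀ : Measurable F₀ := by fun_prop
  have hm₁ : Measurable F₁ := by fun_prop
  have hm₂ : Measurable F₂ := by fun_prop
  have hHolder := ENNReal.lintegral_prod_norm_pow_le (μ := (volume : Measure ℝ).prod volume)
    Finset.univ (f := ![F₀, F₁, F₂])
    (by intro i _; fin_cases i; exacts [hm₀.aemeasurable, hm₁.aemeasurable, hm₂.aemeasurable])
    (p := ![1 - 2 / q, 1 / q, 1 / q]) (by simp [Fin.sum_univ_three]; ring)
    (by intro i _; fin_cases i; exacts [ha, hb, hb])
  simp only [Fin.prod_univ_three, Matrix.cons_val_zero, Matrix.cons_val_one,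
    Matrix.cons_val] at hHolder
  have h0 : ∫⁻ z, F₀ z ∂((volume : Measure ℝ).prod volume) = A * A :=
    lintegral_prod_mul (f := fun s => W s ^ p) (g := fun s => W s ^ p) (by fun_prop) (by fun_prop)
  have h1 : ∫⁻ z, F₁ z ∂((volume : Measure ℝ).prod volume) = A * k := by
    rw [lintegral_prod _ hm₁.aemeasurable]
    have : ∀ s : ℝ, ∫⁻ s', W s ^ p * κ (s - s') ^ (q / 2) = W s ^ p * k := by
      intro s
      rw [lintegral_const_mul _ (by fun_prop),
        lintegral_sub_left_eq_self (fun u => κ u ^ (q / 2)) s]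
    simp only [F₁, this]
    rw [lintegral_mul_const _ (by fun_prop)]
  have h2 : ∫⁻ z, F₂ z ∂((volume : Measure ℝ).prod volume) = A * k := by
    rw [lintegral_prod_symm' _ hm₂]
    have : ∀ s : ℝ, ∫⁻ s', W s ^ p * κ (s' - s) ^ (q / 2) = W s ^ p * k := by
      intro s
      rw [lintegral_const_mul _ (by fun_prop),
        lintegral_sub_right_eq_self (fun u => κ u ^ (q / 2)) s]
    simp only [F₂, this]
    rw [lintegral_mul_const _ (by fun_prop)]
  have hpt : ∀ z : ℝ × ℝ, F₀ z ^ (1 - 2 / q) * F₁ z ^ (1 / q) * F₂ z ^ (1 / q) =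
      W z.1 * W z.2 * κ (z.1 - z.2) := by
    intro z
    simp only [F₀, F₁, F₂]
    rw [ENNReal.mul_rpow_of_nonneg _ _ ha, ENNReal.mul_rpow_of_nonneg _ _ hb,
      ENNReal.mul_rpow_of_nonneg _ _ hb]
    simp only [← ENNReal.rpow_mul]
    have e1 : p * (1 - 2 / q) + p * (1 / q) = 1 := by rw [hp]; field_simp; ring
    have e2 : q / 2 * (1 / q) + q / 2 * (1 / q) = 1 := by field_simp; ring
    have hx : ∀ x : ℝ≥0∞, x ^ (p * (1 - 2 / q)) * x ^ (p * (1 / q)) = x := by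
      intro x
      rw [← ENNReal.rpow_add_of_nonneg _ _ (by positivity) (by positivity), e1, ENNReal.rpow_one]
    have hy : ∀ x : ℝ≥0∞, x ^ (q / 2 * (1 / q)) * x ^ (q / 2 * (1 / q)) = x := by
      intro x
      rw [← ENNReal.rpow_add_of_nonneg _ _ (by positivity) (by positivity), e2, ENNReal.rpow_one]
    calc _ = (W z.1 ^ (p * (1 - 2 / q)) * W z.1 ^ (p * (1 / q))) *
          (W z.2 ^ (p * (1 - 2 / q)) * W z.2 ^ (p * (1 / q))) *
          (κ (z.1 - z.2) ^ (q / 2 * (1 / q)) * κ (z.1 - z.2) ^ (q / 2 * (1 / q))) := by ring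
      _ = _ := by rw [hx, hx, hy]
  rw [h0, h1, h2] at hHolder
  simp only [hpt] at hHolder
  rw [lintegral_prod _ (Measurable.aemeasurable (by fun_prop))] at hHolder
  refine hHolder.trans (le_of_eq ?_)
  rw [ENNReal.mul_rpow_of_nonneg _ _ ha, ENNReal.mul_rpow_of_nonneg _ _ hb]
  have e3 : 2 * (1 - 1 / q) = (1 - 2 / q) + (1 - 2 / q) + (1 / q + 1 / q) := by field_simp; ring
  have e4 : 2 / q = 1 / q + 1 / q := by ring
  have hAk : A ^ (2 * (1 - 1 / q)) * k ^ (2 / q) =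
      A ^ (1 - 2 / q) * A ^ (1 - 2 / q) * (A ^ (1 / q) * A ^ (1 / q)) *
        (k ^ (1 / q) * k ^ (1 / q)) := by
    rw [e3, ENNReal.rpow_add_of_nonneg _ _ (by positivity) (by positivity),
      ENNReal.rpow_add_of_nonneg _ _ ha ha, ENNReal.rpow_add_of_nonneg _ _ hb hb, e4,
      ENNReal.rpow_add_of_nonneg _ _ hb hb]
  rw [hAk]
  ring

section TTStar

variable {X : Type*} [MeasurableSpace X] {μ : Measure X} [SFinite μ]

/-- The dual half of `TT*`. Fubini moves `w` onto `B(ξ) = ∫ w(s) E(s, ξ) ds`; Cauchy–Schwarz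
separates `g` from `B`; expanding `∫ χ|B|²` as a double integral in `s, s'` brings out the kernel
that `κ` dominates. -/
theorem enorm_integral_mul_integral_sq_le {E : ℝ → X → ℂ}
    (hE : Measurable fun p : ℝ × X => E p.1 p.2) (hE1 : ∀ s ξ, ‖E s ξ‖ ≤ 1) {χ : X → ℝ}
    (hχ : Integrable χ μ) (hχ0 : ∀ ξ, 0 ≤ χ ξ) {g : X → ℂ} (hg : Integrable g μ)
    (hgχ : ∀ ξ, g ξ ≠ 0 → 1 ≤ χ ξ) {w : ℝ → ℂ} (hw : Integrable w) {κ : ℝ → ℝ≥0∞}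
    (hκ : ∀ s s', ‖∫ ξ, (χ ξ : ℂ) * (E s ξ * (starRingEnd ℂ) (E s' ξ)) ∂μ‖ₑ ≤ κ (s - s')) :
    ‖∫ s, w s * ∫ ξ, E s ξ * g ξ ∂μ‖ₑ ^ 2 ≤
      (∫⁻ ξ, ‖g ξ‖ₑ ^ 2 ∂μ) * ∫⁻ z : ℝ × ℝ, ‖w z.1‖ₑ * ‖w z.2‖ₑ * κ (z.1 - z.2) := by
  set B : X → ℂ := fun ξ => ∫ s, w s * E s ξ with hB
  have hswap : ∫ s, w s * ∫ ξ, E s ξ * g ξ ∂μ = ∫ ξ, g ξ * B ξ ∂μ := by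
    have hint : Integrable (fun p : ℝ × X => w p.1 * (E p.1 p.2 * g p.2)) (volume.prod μ) := by
      have h := (hw.mul_prod hg).bdd_mul (c := 1) hE.aestronglyMeasurable
        (Filter.Eventually.of_forall fun p => hE1 p.1 p.2)
      refine h.congr (Filter.Eventually.of_forall fun p => ?_)
      simp only
      ring
    calc ∫ s, w s * ∫ ξ, E s ξ * g ξ ∂μ = ∫ s, ∫ ξ, w s * (E s ξ * g ξ) ∂μ := by
          simp only [integral_const_mul]
      _ = ∫ ξ, (∫ s, w s * (E s ξ * g ξ)) ∂μ := integral_integral_swap hint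
      _ = ∫ ξ, g ξ * B ξ ∂μ := by
          refine integral_congr_ae (Filter.Eventually.of_forall fun ξ => ?_)
          simp only [hB]
          rw [← integral_const_mul]
          congr 1
          ext s
          ring
  have hBm : AEStronglyMeasurable B μ := by
    have h : AEStronglyMeasurable (fun p : X × ℝ => w p.2 * E p.2 p.1) (μ.prod volume) :=
      (hw.aestronglyMeasurable.comp_snd).mul
        (hE.comp measurable_swap).aestronglyMeasurable
    exact h.integral_prod_right'
  -- The weight `√χ` is at least one wherever `g ≠ 0`, so inserting it is free, and it localises
  -- `|B|²` to make the kernel integrable.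
  set b : X → ℝ≥0∞ := fun ξ => ENNReal.ofReal (χ ξ) ^ (1 / 2 : ℝ) * ‖B ξ‖ₑ with hb
  have hbm : AEMeasurable b μ := by
    refine AEMeasurable.mul ?_ hBm.enorm
    exact (hχ.aestronglyMeasurable.aemeasurable.ennreal_ofReal).pow_const _
  have hb2 : ∀ ξ, b ξ ^ (2 : ℝ) = ENNReal.ofReal (χ ξ) * ‖B ξ‖ₑ ^ 2 := by
    intro ξ
    rw [hb]
    simp only
    rw [ENNReal.mul_rpow_of_nonneg _ _ (by norm_num), ← ENNReal.rpow_mul]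
    norm_num
  have hCS : ‖∫ ξ, g ξ * B ξ ∂μ‖ₑ ≤
      (∫⁻ ξ, ‖g ξ‖ₑ ^ (2 : ℝ) ∂μ) ^ (1 / 2 : ℝ) * (∫⁻ ξ, b ξ ^ (2 : ℝ) ∂μ) ^ (1 / 2 : ℝ) := by
    refine (enorm_integral_le_lintegral_enorm _).trans ?_
    refine le_trans (lintegral_mono fun ξ => ?_) (ENNReal.lintegral_mul_le_Lp_mul_Lq μ
      Real.HolderConjugate.two_two hg.aestronglyMeasurable.enorm hbm)
    simp only [Pi.mul_apply, enorm_mul, hb]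
    by_cases h : g ξ = 0
    · simp [h]
    · have h1 : 1 ≤ ENNReal.ofReal (χ ξ) ^ (1 / 2 : ℝ) :=
        ENNReal.one_le_rpow (by simpa using hgχ ξ h) (by norm_num)
      gcongr
      exact le_mul_of_one_le_left' h1
  have hprod : ∀ ξ, (‖B ξ‖ ^ 2 : ℝ) = ((∫ z : ℝ × ℝ, (w z.1 * (starRingEnd ℂ) (w z.2)) *
      (E z.1 ξ * (starRingEnd ℂ) (E z.2 ξ)) : ℂ)) := by
    intro ξ
    have h1 : ((‖B ξ‖ ^ 2 : ℝ) : ℂ) = B ξ * (starRingEnd ℂ) (B ξ) := by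
      rw [Complex.mul_conj, Complex.normSq_eq_norm_sq]
    rw [h1, hB]
    simp only
    rw [← integral_conj, ← integral_prod_mul]
    refine integral_congr_ae (Filter.Eventually.of_forall fun z => ?_)
    simp only [map_mul]
    ring
  have hww : Integrable (fun z : ℝ × ℝ => w z.1 * (starRingEnd ℂ) (w z.2)) :=
    hw.mul_prod (Complex.conjLIE.toContinuousLinearEquiv.toContinuousLinearMap.integrable_comp hw)
  have hEE : Measurable (fun p : X × (ℝ × ℝ) => E p.2.1 p.1 * (starRingEnd ℂ) (E p.2.2 p.1)) := by
    have h1 : Measurable (fun p : X × (ℝ × ℝ) => E p.2.1 p.1) :=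
      hE.comp (measurable_snd.fst.prodMk measurable_fst)
    have h2 : Measurable (fun p : X × (ℝ × ℝ) => E p.2.2 p.1) :=
      hE.comp (measurable_snd.snd.prodMk measurable_fst)
    exact h1.mul (Complex.continuous_conj.measurable.comp h2)
  have hEE1 : ∀ p : X × (ℝ × ℝ), ‖E p.2.1 p.1 * (starRingEnd ℂ) (E p.2.2 p.1)‖ ≤ 1 := by
    intro p
    rw [norm_mul, RCLike.norm_conj]
    exact mul_le_one₀ (hE1 _ _) (norm_nonneg _) (hE1 _ _)
  have hint3 : Integrable (fun p : X × (ℝ × ℝ) => (χ p.1 : ℂ) *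
      ((w p.2.1 * (starRingEnd ℂ) (w p.2.2)) * (E p.2.1 p.1 * (starRingEnd ℂ) (E p.2.2 p.1))))
      (μ.prod volume) := by
    have h := (hχ.ofReal (𝕜 := ℂ)).mul_prod hww |>.bdd_mul (c := 1) hEE.aestronglyMeasurable
      (Filter.Eventually.of_forall hEE1)
    refine h.congr (Filter.Eventually.of_forall fun p => ?_)
    simp only [Complex.coe_algebraMap]
    ring_nf
  have hB2 : ∫⁻ ξ, b ξ ^ (2 : ℝ) ∂μ ≤
      ∫⁻ z : ℝ × ℝ, ‖w z.1‖ₑ * ‖w z.2‖ₑ * κ (z.1 - z.2) := by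
    have hχB : Integrable (fun ξ => χ ξ * ‖B ξ‖ ^ 2) μ := by
      have h := hint3.integral_prod_left
      have h' : Integrable (fun ξ => ((χ ξ * ‖B ξ‖ ^ 2 : ℝ) : ℂ)) μ := by
        refine h.congr (Filter.Eventually.of_forall fun ξ => ?_)
        simp only
        rw [integral_const_mul, ← hprod]
        push_cast
        rfl
      exact h'.re
    have h1 : ∫⁻ ξ, b ξ ^ (2 : ℝ) ∂μ = ENNReal.ofReal (∫ ξ, χ ξ * ‖B ξ‖ ^ 2 ∂μ) := by
      rw [ofReal_integral_eq_lintegral_ofReal hχB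
        (Filter.Eventually.of_forall fun ξ => mul_nonneg (hχ0 ξ) (sq_nonneg _))]
      refine lintegral_congr fun ξ => ?_
      rw [hb2, ENNReal.ofReal_mul (hχ0 ξ), ENNReal.ofReal_pow (norm_nonneg _), ofReal_norm]
    have h2 : ((∫ ξ, χ ξ * ‖B ξ‖ ^ 2 ∂μ : ℝ) : ℂ) = ∫ z : ℝ × ℝ,
        (w z.1 * (starRingEnd ℂ) (w z.2)) *
          ∫ ξ, (χ ξ : ℂ) * (E z.1 ξ * (starRingEnd ℂ) (E z.2 ξ)) ∂μ := by
      calc ((∫ ξ, χ ξ * ‖B ξ‖ ^ 2 ∂μ : ℝ) : ℂ)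
          = ∫ ξ, (∫ z : ℝ × ℝ, (χ ξ : ℂ) * ((w z.1 * (starRingEnd ℂ) (w z.2)) *
              (E z.1 ξ * (starRingEnd ℂ) (E z.2 ξ)))) ∂μ := by
            rw [← integral_complex_ofReal]
            refine integral_congr_ae (Filter.Eventually.of_forall fun ξ => ?_)
            simp only
            rw [integral_const_mul, ← hprod]
            push_cast
            rfl
        _ = _ := by
            rw [integral_integral_swap hint3]
            refine integral_congr_ae (Filter.Eventually.of_forall fun z => ?_)
            simp only
            rw [← integral_const_mul]
            congr 1
            ext ξ
            ring
    rw [h1, ← Real.enorm_of_nonneg (integral_nonneg fun ξ => mul_nonneg (hχ0 ξ) (sq_nonneg _)),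
      ← ofReal_norm, ← Complex.norm_real, ofReal_norm, h2]
    refine (enorm_integral_le_lintegral_enorm _).trans (lintegral_mono fun z => ?_)
    simp only [enorm_mul]
    rw [RCLike.enorm_conj]
    gcongr
    exact hκ _ _
  have hg2 : ∫⁻ ξ, ‖g ξ‖ₑ ^ (2 : ℝ) ∂μ = ∫⁻ ξ, ‖g ξ‖ₑ ^ 2 ∂μ := by simp
  have hsq : ∀ x : ℝ≥0∞, (x ^ (1 / 2 : ℝ)) ^ 2 = x := fun x => by
    rw [← ENNReal.rpow_natCast, ← ENNReal.rpow_mul]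
    norm_num
  rw [hswap]
  calc ‖∫ ξ, g ξ * B ξ ∂μ‖ₑ ^ 2 ≤ _ := pow_le_pow_left' hCS 2
    _ = (∫⁻ ξ, ‖g ξ‖ₑ ^ 2 ∂μ) * ∫⁻ ξ, b ξ ^ (2 : ℝ) ∂μ := by
        rw [mul_pow, hsq, hsq, hg2]
    _ ≤ _ := by gcongr

end TTStar

/-! ### From the pairing to `L^q` bounds and to the maximal function. -/

section TTStar

variable {X : Type*} [MeasurableSpace X] {μ : Measure X} [SFinite μ]

/-- The pairing bound is applied to the extremiser of `L^q` duality. Restriction to a set of finite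
measure keeps all quantities finite, so that a power of the left side can be cancelled. -/
theorem setLIntegral_enorm_integral_rpow_le {E : ℝ → X → ℂ}
    (hE : Measurable fun p : ℝ × X => E p.1 p.2) (hE1 : ∀ s ξ, ‖E s ξ‖ ≤ 1) {χ : X → ℝ}
    (hχ : Integrable χ μ) (hχ0 : ∀ ξ, 0 ≤ χ ξ) {g : X → ℂ} (hg : Integrable g μ)
    (hgχ : ∀ ξ, g ξ ≠ 0 → 1 ≤ χ ξ) {κ : ℝ → ℝ≥0∞} (hκm : Measurable κ)
    (hκ : ∀ s s', ‖∫ ξ, (χ ξ : ℂ) * (E s ξ * (starRingEnd ℂ) (E s' ξ)) ∂μ‖ₑ ≤ κ (s - s'))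
    {q : ℝ} (hq : 2 ≤ q) {S : Set ℝ} (hS : MeasurableSet S) (hSfin : volume S ≠ ⊤) :
    ∫⁻ s in S, ‖∫ ξ, E s ξ * g ξ ∂μ‖ₑ ^ q ≤
      (∫⁻ ξ, ‖g ξ‖ₑ ^ 2 ∂μ) ^ (q / 2) * ∫⁻ s, κ s ^ (q / 2) := by
  have hq0 : 0 < q := by linarith
  have hq1 : 0 < q - 1 := by linarith
  set F : ℝ → ℂ := fun s => ∫ ξ, E s ξ * g ξ ∂μ with hF
  have hFm : StronglyMeasurable F := by
    obtain ⟨g', hg', hgg'⟩ := hg.aestronglyMeasurable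
    have h1 : F = fun s => ∫ ξ, E s ξ * g' ξ ∂μ := by
      ext s
      refine integral_congr_ae ?_
      filter_upwards [hgg'] with ξ hξ
      rw [hξ]
    rw [h1]
    have h2 : StronglyMeasurable (fun p : ℝ × X => E p.1 p.2 * g' p.2) :=
      hE.stronglyMeasurable.mul (hg'.comp_measurable measurable_snd)
    exact h2.integral_prod_right'
  set M : ℝ := ∫ ξ, ‖g ξ‖ ∂μ with hM
  have hM0 : 0 ≤ M := integral_nonneg fun _ => norm_nonneg _
  have hFM : ∀ s, ‖F s‖ ≤ M := by
    intro s
    refine norm_integral_le_of_norm_le hg.norm (Filter.Eventually.of_forall fun ξ => ?_)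
    rw [norm_mul]
    exact mul_le_of_le_one_left (norm_nonneg _) (hE1 _ _)
  -- On `S`, `w F = |F|^q` and `|w|^{q/(q-1)} = |F|^q`, so the pairing and the dual norm are both
  -- expressed through `A`.
  set w : ℝ → ℂ := S.indicator fun s => (starRingEnd ℂ) (F s) * ((‖F s‖ ^ (q - 2) : ℝ) : ℂ) with hw
  have hnw : ∀ s, ‖w s‖ₑ = S.indicator (fun s => ‖F s‖ₑ ^ (q - 1)) s := by
    intro s
    by_cases hs : s ∈ S
    · rw [hw, Set.indicator_of_mem hs, Set.indicator_of_mem hs, enorm_mul, RCLike.enorm_conj,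
        ← ofReal_norm (((‖F s‖ ^ (q - 2) : ℝ) : ℂ)), Complex.norm_real,
        Real.norm_of_nonneg (by positivity), ← ENNReal.ofReal_rpow_of_nonneg (norm_nonneg _)
        (by linarith), ofReal_norm]
      nth_rw 1 [← ENNReal.rpow_one ‖F s‖ₑ]
      rw [← ENNReal.rpow_add_of_nonneg _ _ zero_le_one (by linarith)]
      congr 1
      ring
    · rw [hw, Set.indicator_of_notMem hs, Set.indicator_of_notMem hs, enorm_zero]
  have hwm : StronglyMeasurable w := by
    refine StronglyMeasurable.indicator ?_ hS
    refine (Complex.continuous_conj.comp_stronglyMeasurable hFm).mul ?_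
    exact Complex.continuous_ofReal.comp_stronglyMeasurable
      (hFm.norm.measurable.pow_const _).stronglyMeasurable
  set A : ℝ≥0∞ := ∫⁻ s in S, ‖F s‖ₑ ^ q with hA
  have hAtop : A ≠ ⊤ := by
    have h1 : A ≤ ∫⁻ s in S, ENNReal.ofReal M ^ q := by
      refine lintegral_mono fun s => ?_
      gcongr
      rw [← ofReal_norm]
      exact ENNReal.ofReal_le_ofReal (hFM s)
    refine ne_top_of_le_ne_top ?_ h1
    rw [setLIntegral_const]
    exact ENNReal.mul_ne_top (ENNReal.rpow_ne_top_of_nonneg hq0.le ENNReal.ofReal_ne_top) hSfin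
  have hwint : Integrable w := by
    refine ⟨hwm.aestronglyMeasurable, ?_⟩
    rw [hasFiniteIntegral_iff_enorm]
    simp only [hnw]
    rw [lintegral_indicator hS]
    have h1 : ∫⁻ s in S, ‖F s‖ₑ ^ (q - 1) ≤ ∫⁻ s in S, ENNReal.ofReal M ^ (q - 1) := by
      refine lintegral_mono fun s => ?_
      gcongr
      rw [← ofReal_norm]
      exact ENNReal.ofReal_le_ofReal (hFM s)
    refine lt_of_le_of_lt h1 ?_
    rw [setLIntegral_const]
    exact ENNReal.mul_lt_top (ENNReal.rpow_lt_top_of_nonneg hq1.le ENNReal.ofReal_ne_top)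
      hSfin.lt_top
  have hwF : ∀ s, w s * F s = ((S.indicator (fun s => ‖F s‖ ^ q) s : ℝ) : ℂ) := by
    intro s
    by_cases hs : s ∈ S
    · rw [hw, Set.indicator_of_mem hs, Set.indicator_of_mem hs]
      have h1 : (starRingEnd ℂ) (F s) * F s = ((‖F s‖ ^ (2 : ℝ) : ℝ) : ℂ) := by
        rw [mul_comm, Complex.mul_conj, Complex.normSq_eq_norm_sq, Real.rpow_two]
      have h2 : ‖F s‖ ^ q = ‖F s‖ ^ (2 : ℝ) * ‖F s‖ ^ (q - 2) := by
        rw [← Real.rpow_add_of_nonneg (norm_nonneg _) (by norm_num) (by linarith)]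
        congr 1
        ring
      rw [h2, Complex.ofReal_mul, ← h1]
      ring
    · rw [hw, Set.indicator_of_notMem hs, Set.indicator_of_notMem hs]
      simp
  have hAeq : ‖∫ s, w s * F s‖ₑ = A := by
    simp only [hwF]
    rw [integral_complex_ofReal, ← ofReal_norm, Complex.norm_real, ofReal_norm,
      Real.enorm_of_nonneg (integral_nonneg fun s => Set.indicator_nonneg
        (fun _ _ => by positivity) s),
      ofReal_integral_eq_lintegral_ofReal]
    · rw [hA, ← lintegral_indicator hS]
      refine lintegral_congr fun s => ?_
      by_cases hs : s ∈ S
      · rw [Set.indicator_of_mem hs, Set.indicator_of_mem hs,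
          ← ENNReal.ofReal_rpow_of_nonneg (norm_nonneg _) hq0.le, ofReal_norm]
      · rw [Set.indicator_of_notMem hs, Set.indicator_of_notMem hs, ENNReal.ofReal_zero]
    · have h1 : Integrable (fun s => w s * F s) :=
        hwint.mul_bdd (c := M) hFm.aestronglyMeasurable (Filter.Eventually.of_forall hFM)
      simp only [hwF] at h1
      exact h1.re
    · exact Filter.Eventually.of_forall fun s => Set.indicator_nonneg (fun _ _ => by positivity) s
  have hmain := enorm_integral_mul_integral_sq_le hE hE1 hχ hχ0 hg hgχ hwint hκ
  rw [show (∫ s, w s * ∫ ξ, E s ξ * g ξ ∂μ) = ∫ s, w s * F s from rfl, hAeq] at hmain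
  have hwem : Measurable fun s => ‖w s‖ₑ := hwm.enorm
  have hyoung := lintegral_lintegral_mul_mul_comp_sub_le hwem hκm hq
  have hWA : ∫⁻ s, ‖w s‖ₑ ^ (q / (q - 1)) = A := by
    rw [hA, ← lintegral_indicator hS]
    refine lintegral_congr fun s => ?_
    rw [hnw]
    by_cases hs : s ∈ S
    · rw [Set.indicator_of_mem hs, Set.indicator_of_mem hs, ← ENNReal.rpow_mul]
      congr 1
      field_simp
    · rw [Set.indicator_of_notMem hs, Set.indicator_of_notMem hs, ENNReal.zero_rpow_of_pos]
      positivity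
  rw [hWA] at hyoung
  set k := ∫⁻ s, κ s ^ (q / 2) with hk
  set G := ∫⁻ ξ, ‖g ξ‖ₑ ^ 2 ∂μ with hG
  have hineq : A ^ 2 ≤ G * (A ^ (2 * (1 - 1 / q)) * k ^ (2 / q)) := by
    refine hmain.trans ?_
    gcongr
    rw [Measure.volume_eq_prod, lintegral_prod _ (Measurable.aemeasurable (by fun_prop))]
    exact hyoung
  by_cases hA0 : A = 0
  · rw [hA0]; exact zero_le
  -- Cancels `A^{2(1-1/q)}`, which is neither zero nor infinite.
  have h1 : A ^ (2 / q) ≤ G * k ^ (2 / q) := by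
    have h2 : A ^ (2 * (1 - 1 / q)) * A ^ (2 / q) = A ^ 2 := by
      rw [← ENNReal.rpow_add _ _ hA0 hAtop, ← ENNReal.rpow_natCast]
      congr 1
      push_cast
      field_simp
      ring
    have h3 : A ^ (2 * (1 - 1 / q)) ≠ 0 := by
      intro h
      rcases ENNReal.rpow_eq_zero_iff.mp h with h | h
      · exact hA0 h.1
      · exact hAtop h.1
    have h4 : A ^ (2 * (1 - 1 / q)) ≠ ⊤ := ENNReal.rpow_ne_top_of_ne_zero hA0 hAtop
    rw [← h2] at hineq
    have h5 : A ^ (2 * (1 - 1 / q)) * A ^ (2 / q) ≤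
        A ^ (2 * (1 - 1 / q)) * (G * k ^ (2 / q)) := by
      refine hineq.trans (le_of_eq ?_)
      ring
    exact (ENNReal.mul_le_mul_iff_right h3 h4).mp h5
  have h2 : (A ^ (2 / q)) ^ (q / 2) ≤ (G * k ^ (2 / q)) ^ (q / 2) := by gcongr
  rw [ENNReal.mul_rpow_of_nonneg _ _ (by positivity), ← ENNReal.rpow_mul, ← ENNReal.rpow_mul] at h2
  have h3 : 2 / q * (q / 2) = 1 := by field_simp
  simpa [h3] using h2

theorem lintegral_enorm_integral_rpow_le {E : ℝ → X → ℂ}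
    (hE : Measurable fun p : ℝ × X => E p.1 p.2) (hE1 : ∀ s ξ, ‖E s ξ‖ ≤ 1) {χ : X → ℝ}
    (hχ : Integrable χ μ) (hχ0 : ∀ ξ, 0 ≤ χ ξ) {g : X → ℂ} (hg : Integrable g μ)
    (hgχ : ∀ ξ, g ξ ≠ 0 → 1 ≤ χ ξ) {κ : ℝ → ℝ≥0∞} (hκm : Measurable κ)
    (hκ : ∀ s s', ‖∫ ξ, (χ ξ : ℂ) * (E s ξ * (starRingEnd ℂ) (E s' ξ)) ∂μ‖ₑ ≤ κ (s - s'))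
    {q : ℝ} (hq : 2 ≤ q) :
    ∫⁻ s, ‖∫ ξ, E s ξ * g ξ ∂μ‖ₑ ^ q ≤
      (∫⁻ ξ, ‖g ξ‖ₑ ^ 2 ∂μ) ^ (q / 2) * ∫⁻ s, κ s ^ (q / 2) := by
  have hmono : Monotone fun n : ℕ => Set.Icc (-(n : ℝ)) n := by
    intro a b hab
    have : (a : ℝ) ≤ b := by exact_mod_cast hab
    exact Set.Icc_subset_Icc (by linarith) this
  have hU : (⋃ n : ℕ, Set.Icc (-(n : ℝ)) n) = Set.univ := by
    refine Set.eq_univ_of_forall fun s => Set.mem_iUnion.2 ?_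
    obtain ⟨n, hn⟩ := exists_nat_ge |s|
    exact ⟨n, abs_le.mp hn⟩
  rw [← setLIntegral_univ, ← hU, setLIntegral_iUnion_of_directed _ hmono.directed_le]
  exact iSup_le fun n => setLIntegral_enorm_integral_rpow_le hE hE1 hχ hχ0 hg hgχ hκm hκ hq
    measurableSet_Icc (by simp)

/-- An index among `0, …, n` at which `f j s` is largest. -/
noncomputable def argmaxUpTo {S : Type*} (f : ℕ → S → ℝ≥0∞) : ℕ → S → ℕ
  | 0, _ => 0
  | n + 1, s => open Classical in
    if f (argmaxUpTo f n s) s < f (n + 1) s then n + 1 else argmaxUpTo f n s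

theorem measurable_apply_nat {S : Type*} [MeasurableSpace S] {f : ℕ → S → ℝ≥0∞}
    (hf : ∀ n, Measurable (f n)) {J : S → ℕ} (hJ : Measurable J) :
    Measurable fun s => f (J s) s :=
  (measurable_from_prod_countable_right (f := fun p : ℕ × S => f p.1 p.2) hf).comp
    (hJ.prodMk measurable_id)

theorem measurable_argmaxUpTo {S : Type*} [MeasurableSpace S] {f : ℕ → S → ℝ≥0∞}
    (hf : ∀ n, Measurable (f n)) (n : ℕ) : Measurable (argmaxUpTo f n) := by
  induction n with
  | zero => exact measurable_const
  | succ n ih =>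
    change Measurable fun s => argmaxUpTo f (n + 1) s
    simp only [argmaxUpTo]
    exact Measurable.ite (measurableSet_lt (measurable_apply_nat hf ih) (hf _))
      measurable_const ih

theorem monotone_argmaxUpTo {S : Type*} (f : ℕ → S → ℝ≥0∞) (s : S) :
    Monotone fun n => f (argmaxUpTo f n s) s := by
  refine monotone_nat_of_le_succ fun n => ?_
  simp only [argmaxUpTo]
  split_ifs with h
  · exact h.le
  · exact le_rfl

theorem le_argmaxUpTo {S : Type*} (f : ℕ → S → ℝ≥0∞) (s : S) (n : ℕ) :
    f n s ≤ f (argmaxUpTo f n s) s := by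
  cases n with
  | zero => simp [argmaxUpTo]
  | succ n =>
    simp only [argmaxUpTo]
    split_ifs with h
    · exact le_rfl
    · exact not_lt.mp h

/-- Linearisation of the maximal function. At stage `n` the largest of the first `n + 1` terms is
attained at a measurable index `J n s`, and the single family `e (J n s) s` obeys the same kernel
bound because `κ` does not see the indices. Monotone convergence in `n` finishes. -/
theorem lintegral_iSup_enorm_integral_rpow_le {e : ℕ → ℝ → X → ℂ}
    (he : ∀ j, Measurable fun p : ℝ × X => e j p.1 p.2) (he1 : ∀ j s ξ, ‖e j s ξ‖ ≤ 1) {χ : X → ℝ}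
    (hχ : Integrable χ μ) (hχ0 : ∀ ξ, 0 ≤ χ ξ) {g : X → ℂ} (hg : Integrable g μ)
    (hgχ : ∀ ξ, g ξ ≠ 0 → 1 ≤ χ ξ) {κ : ℝ → ℝ≥0∞} (hκm : Measurable κ)
    (hκ : ∀ j j' s s',
      ‖∫ ξ, (χ ξ : ℂ) * (e j s ξ * (starRingEnd ℂ) (e j' s' ξ)) ∂μ‖ₑ ≤ κ (s - s'))
    {q : ℝ} (hq : 2 ≤ q) :
    ∫⁻ s, (⨆ j, ‖∫ ξ, e j s ξ * g ξ ∂μ‖ₑ) ^ q ≤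
      (∫⁻ ξ, ‖g ξ‖ₑ ^ 2 ∂μ) ^ (q / 2) * ∫⁻ s, κ s ^ (q / 2) := by
  have hq0 : 0 < q := by linarith
  set f : ℕ → ℝ → ℝ≥0∞ := fun j s => ‖∫ ξ, e j s ξ * g ξ ∂μ‖ₑ with hf
  have hfm : ∀ j, Measurable (f j) := by
    intro j
    obtain ⟨g', hg', hgg'⟩ := hg.aestronglyMeasurable
    have h1 : f j = fun s => ‖∫ ξ, e j s ξ * g' ξ ∂μ‖ₑ := by
      ext s
      simp only [hf]
      congr 1
      refine integral_congr_ae ?_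
      filter_upwards [hgg'] with ξ hξ
      rw [hξ]
    rw [h1]
    have h2 : StronglyMeasurable (fun p : ℝ × X => e j p.1 p.2 * g' p.2) :=
      (he j).stronglyMeasurable.mul (hg'.comp_measurable measurable_snd)
    exact h2.integral_prod_right'.enorm
  set J := argmaxUpTo f with hJ
  have hJm : ∀ n, Measurable (J n) := measurable_argmaxUpTo hfm
  have hsup : ∀ s, (⨆ j, f j s) ^ q ≤ ⨆ n, f (J n s) s ^ q := by
    intro s
    have h1 : (⨆ j, f j s) ≤ ⨆ n, f (J n s) s :=
      iSup_mono fun n => le_argmaxUpTo f s n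
    calc (⨆ j, f j s) ^ q ≤ (⨆ n, f (J n s) s) ^ q := by gcongr
      _ = ⨆ n, f (J n s) s ^ q := (ENNReal.orderIsoRpow q hq0).map_iSup _
  calc ∫⁻ s, (⨆ j, f j s) ^ q ≤ ∫⁻ s, ⨆ n, f (J n s) s ^ q := lintegral_mono hsup
    _ = ⨆ n, ∫⁻ s, f (J n s) s ^ q := by
        refine lintegral_iSup (fun n => (measurable_apply_nat hfm (hJm n)).pow_const _) ?_
        intro m n hmn s
        simp only
        gcongr
        exact monotone_argmaxUpTo f s hmn
    _ ≤ _ := by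
        refine iSup_le fun n => ?_
        refine lintegral_enorm_integral_rpow_le (E := fun s ξ => e (J n s) s ξ) ?_
          (fun s ξ => he1 _ s ξ) hχ hχ0 hg hgχ hκm (fun s s' => hκ _ _ s s') hq
        exact (measurable_from_prod_countable_right
          (f := fun p : ℕ × (ℝ × X) => e p.1 p.2.1 p.2.2) he).comp
          (((hJm n).comp measurable_fst).prodMk measurable_id)

end TTStar

/-! ### Van der Corput estimates for convex phases. -/

section VanDerCorput

/-- The integrand is the derivative of `arctan(ψ/√μ)/√μ`, and the range of `arctan` has length `π`.
-/
theorem integral_deriv_div_add_sq_le {ψ ψ' : ℝ → ℝ} (hψ : ∀ v, HasDerivAt ψ (ψ' v) v)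
    (hψ' : Continuous ψ') {μ : ℝ} (hμ : 0 < μ) (p q : ℝ) :
    ∫ v in p..q, ψ' v / (μ + ψ v ^ 2) ≤ Real.pi / √μ := by
  have hs : 0 < √μ := Real.sqrt_pos.2 hμ
  have hss : √μ ^ 2 = μ := Real.sq_sqrt hμ.le
  have hc : Continuous ψ := continuous_iff_continuousAt.2 fun v => (hψ v).continuousAt
  have hd : ∀ v ∈ Set.uIcc p q, HasDerivAt (fun v => Real.arctan (ψ v / √μ) / √μ)
      (ψ' v / (μ + ψ v ^ 2)) v := by
    intro v _
    have h := (((hψ v).div_const √μ).arctan).div_const √μ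
    refine h.congr_deriv ?_
    have h1 : 0 < μ + ψ v ^ 2 := by positivity
    have h2 : 1 + (ψ v / √μ) ^ 2 = (μ + ψ v ^ 2) / μ := by
      rw [div_pow, hss]
      field_simp
    rw [h2]
    field_simp
    rw [hss, mul_comm]
  rw [intervalIntegral.integral_eq_sub_of_hasDerivAt hd]
  · have h1 := (Real.arctan_lt_pi_div_two (ψ q / √μ)).le
    have h2 := (Real.neg_pi_div_two_lt_arctan (ψ p / √μ)).le
    rw [← sub_div]
    gcongr
    linarith
  · refine Continuous.intervalIntegrable (Continuous.div hψ' (by fun_prop) fun v => ?_) _ _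
    positivity

/-- Integration by parts with the regularised inverse `ψ/(μ + ψ²)` in place of `1/ψ`, so that
stationary points need not be cut out. The price is the last integral, which measures the region
where `|ψ|` is at most about `√μ`. -/
theorem norm_integral_mul_cexp_le {φ ψ ψ' a a' : ℝ → ℝ} (hφ : ∀ v, HasDerivAt φ (ψ v) v)
    (hψ : ∀ v, HasDerivAt ψ (ψ' v) v) (hψ' : Continuous ψ') (hψ0 : ∀ v, 0 ≤ ψ' v)
    (ha : ∀ v, HasDerivAt a (a' v) v) (ha' : Continuous a') {A : ℝ} (haA : ∀ v, |a v| ≤ A)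
    (haA' : ∀ v, |a' v| ≤ A) {p q : ℝ} (hpq : p ≤ q) (hap : a p = 0) (haq : a q = 0)
    {μ : ℝ} (hμ : 0 < μ) :
    ‖∫ v in p..q, (a v : ℂ) * Complex.exp ((φ v : ℂ) * Complex.I)‖ ≤
      A * ((q - p) / (2 * √μ) + Real.pi / √μ + ∫ v in p..q, μ / (μ + ψ v ^ 2)) := by
  have hA : 0 ≤ A := (abs_nonneg _).trans (haA 0)
  have hs : 0 < √μ := Real.sqrt_pos.2 hμ
  have hss : √μ ^ 2 = μ := Real.sq_sqrt hμ.le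
  have hcψ : Continuous ψ := continuous_iff_continuousAt.2 fun v => (hψ v).continuousAt
  have hcφ : Continuous φ := continuous_iff_continuousAt.2 fun v => (hφ v).continuousAt
  have hca : Continuous a := continuous_iff_continuousAt.2 fun v => (ha v).continuousAt
  have hpos : ∀ v, 0 < μ + ψ v ^ 2 := fun v => by positivity
  set h : ℝ → ℝ := fun v => a v * (ψ v / (μ + ψ v ^ 2)) with hh
  set h' : ℝ → ℝ := fun v => a' v * (ψ v / (μ + ψ v ^ 2)) +
    a v * (ψ' v * (μ - ψ v ^ 2) / (μ + ψ v ^ 2) ^ 2) with hh'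
  have hhd : ∀ v, HasDerivAt h (h' v) v := by
    intro v
    have h1 : HasDerivAt (fun v => μ + ψ v ^ 2) (2 * ψ v * ψ' v) v := by
      simpa using ((hψ v).pow 2).const_add μ
    have h2 := (ha v).mul ((hψ v).div h1 (hpos v).ne')
    refine h2.congr_deriv ?_
    simp only [hh']
    congr 2
    have := (hpos v).ne'
    field_simp
    ring
  have hch' : Continuous h' := by
    refine Continuous.add (ha'.mul (hcψ.div (by fun_prop) fun v => (hpos v).ne'))
      (hca.mul (Continuous.div (by fun_prop) (by fun_prop) fun v => ?_))
    have := (hpos v).ne'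
    positivity
  set e : ℝ → ℂ := fun v => Complex.exp ((φ v : ℂ) * Complex.I) with he
  have hed : ∀ v, HasDerivAt e (e v * ((ψ v : ℂ) * Complex.I)) v := fun v =>
    (((hφ v).ofReal_comp).mul_const Complex.I).cexp
  have hce : Continuous e := continuous_iff_continuousAt.2 fun v => (hed v).continuousAt
  have hne : ∀ v, ‖e v‖ = 1 := fun v => Complex.norm_exp_ofReal_mul_I _
  set D : ℝ → ℂ := fun v => (h' v : ℂ) * e v + (h v : ℂ) * (e v * ((ψ v : ℂ) * Complex.I)) with hD
  have hch : Continuous h := continuous_iff_continuousAt.2 fun v => (hhd v).continuousAt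
  have hcD : Continuous D := by fun_prop
  have hG : ∫ v in p..q, D v = 0 := by
    rw [intervalIntegral.integral_eq_sub_of_hasDerivAt (f := fun v => (h v : ℂ) * e v)
      (fun v _ => ((hhd v).ofReal_comp).mul (hed v)) (hcD.intervalIntegrable _ _)]
    simp [hh, hap, haq]
  -- Here `D = (h e)'` integrates to zero as `a` vanishes at both ends. Since `e' = iψe`, the sum
  -- equals `e · (i h' + a μ/(μ + ψ²))`.
  set rem : ℝ → ℂ := fun v => (a v : ℂ) * e v + Complex.I * D v with hrem
  have hI : ∫ v in p..q, (a v : ℂ) * e v = ∫ v in p..q, rem v := by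
    simp only [hrem]
    rw [intervalIntegral.integral_add (Continuous.intervalIntegrable (by fun_prop) _ _)
      (Continuous.intervalIntegrable (by fun_prop) _ _), intervalIntegral.integral_const_mul, hG]
    simp
  have hremb : ∀ v, ‖rem v‖ ≤ A * (1 / (2 * √μ)) + A * (ψ' v / (μ + ψ v ^ 2)) +
      A * (μ / (μ + ψ v ^ 2)) := by
    intro v
    have h0 := hpos v
    have hC : ((μ : ℂ) + (ψ v : ℂ) ^ 2) ≠ 0 := by
      have : ((μ + ψ v ^ 2 : ℝ) : ℂ) ≠ 0 := by exact_mod_cast h0.ne'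
      simpa using this
    have h1 : rem v = e v * (Complex.I * (h' v : ℂ) + ((a v * (μ / (μ + ψ v ^ 2)) : ℝ) : ℂ)) := by
      simp only [hrem, hD, hh]
      push_cast
      have hI2 : Complex.I * Complex.I = -1 := Complex.I_mul_I
      field_simp
      linear_combination (a v : ℂ) * (ψ v : ℂ) ^ 2 * e v * hI2
    rw [h1, norm_mul, hne, one_mul]
    refine (norm_add_le _ _).trans ?_
    rw [norm_mul, Complex.norm_I, one_mul, Complex.norm_real, Complex.norm_real]
    have h2 : |ψ v / (μ + ψ v ^ 2)| ≤ 1 / (2 * √μ) := by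
      rw [abs_div, abs_of_pos h0, div_le_div_iff₀ h0 (by positivity)]
      nlinarith [sq_nonneg (|ψ v| - √μ), sq_abs (ψ v)]
    have h3 : |ψ' v * (μ - ψ v ^ 2) / (μ + ψ v ^ 2) ^ 2| ≤ ψ' v / (μ + ψ v ^ 2) := by
      rw [abs_div, abs_mul, abs_of_nonneg (hψ0 v), abs_of_pos (pow_pos h0 2),
        div_le_div_iff₀ (pow_pos h0 2) h0]
      have h4 : |μ - ψ v ^ 2| ≤ μ + ψ v ^ 2 := by
        rw [abs_le]
        constructor <;> nlinarith [sq_nonneg (ψ v)]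
      calc ψ' v * |μ - ψ v ^ 2| * (μ + ψ v ^ 2) ≤ ψ' v * (μ + ψ v ^ 2) * (μ + ψ v ^ 2) := by
            have := hψ0 v
            gcongr
        _ = _ := by ring
    have h5 : ‖h' v‖ ≤ A * (1 / (2 * √μ)) + A * (ψ' v / (μ + ψ v ^ 2)) := by
      rw [Real.norm_eq_abs]
      refine (abs_add_le _ _).trans ?_
      rw [abs_mul, abs_mul]
      exact add_le_add (mul_le_mul (haA' v) h2 (abs_nonneg _) hA)
        (mul_le_mul (haA v) h3 (abs_nonneg _) hA)
    have h6 : ‖a v * (μ / (μ + ψ v ^ 2))‖ ≤ A * (μ / (μ + ψ v ^ 2)) := by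
      rw [Real.norm_eq_abs, abs_mul, abs_of_pos (div_pos hμ h0)]
      have := (div_pos hμ h0).le
      gcongr
      exact haA v
    linarith
  have hc1 : Continuous fun v => ψ' v / (μ + ψ v ^ 2) :=
    hψ'.div (by fun_prop) fun v => (hpos v).ne'
  have hc2 : Continuous fun v => μ / (μ + ψ v ^ 2) :=
    continuous_const.div (by fun_prop) fun v => (hpos v).ne'
  change ‖∫ v in p..q, (a v : ℂ) * e v‖ ≤ _
  rw [hI]
  refine (intervalIntegral.norm_integral_le_of_norm_le hpq
    (Filter.Eventually.of_forall fun v _ => hremb v)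
    (Continuous.intervalIntegrable (by fun_prop) _ _)).trans ?_
  rw [intervalIntegral.integral_add (Continuous.intervalIntegrable (by fun_prop) _ _)
      (Continuous.intervalIntegrable (by fun_prop) _ _),
    intervalIntegral.integral_add (Continuous.intervalIntegrable (by fun_prop) _ _)
      (Continuous.intervalIntegrable (by fun_prop) _ _),
    intervalIntegral.integral_const, intervalIntegral.integral_const_mul,
    intervalIntegral.integral_const_mul]
  have h7 := integral_deriv_div_add_sq_le hψ hψ' hμ p q
  have h8 : (q - p) • (A * (1 / (2 * √μ))) = A * ((q - p) / (2 * √μ)) := by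
    rw [smul_eq_mul]; ring
  rw [h8]
  nlinarith [mul_le_mul_of_nonneg_left h7 hA]

/-- On `|v| ≤ δ` the integrand is at most one; elsewhere `1 ≤ ψ'/l` reduces it to the arctangent
integral. -/
theorem integral_div_add_sq_le {ψ ψ' : ℝ → ℝ} (hψ : ∀ v, HasDerivAt ψ (ψ' v) v)
    (hψ' : Continuous ψ') (hψ0 : ∀ v, 0 ≤ ψ' v) {μ : ℝ} (hμ : 0 < μ) {p q : ℝ} (hpq : p ≤ q)
    {δ l : ℝ} (hδ : 0 ≤ δ) (hl : 0 < l) (hψl : ∀ v, δ ≤ |v| → l ≤ ψ' v) :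
    ∫ v in p..q, μ / (μ + ψ v ^ 2) ≤ 2 * δ + Real.pi * √μ / l := by
  have hs : 0 < √μ := Real.sqrt_pos.2 hμ
  have hss : √μ * √μ = μ := Real.mul_self_sqrt hμ.le
  have hcψ : Continuous ψ := continuous_iff_continuousAt.2 fun v => (hψ v).continuousAt
  have hpos : ∀ v, 0 < μ + ψ v ^ 2 := fun v => by positivity
  have hc1 : Continuous fun v => ψ' v / (μ + ψ v ^ 2) :=
    hψ'.div (by fun_prop) fun v => (hpos v).ne'
  have hc2 : Continuous fun v => μ / (μ + ψ v ^ 2) :=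
    continuous_const.div (by fun_prop) fun v => (hpos v).ne'
  have hind : IntervalIntegrable ((Set.Icc (-δ) δ).indicator fun _ => (1 : ℝ)) volume p q := by
    rw [intervalIntegrable_iff]
    exact (integrable_indicator_iff measurableSet_Icc).2 (by simp) |>.integrableOn
  have hpt : ∀ v, μ / (μ + ψ v ^ 2) ≤ (Set.Icc (-δ) δ).indicator (fun _ => (1 : ℝ)) v +
      μ / l * (ψ' v / (μ + ψ v ^ 2)) := by
    intro v
    have h0 := hpos v
    by_cases hv : v ∈ Set.Icc (-δ) δ
    · rw [Set.indicator_of_mem hv]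
      have h1 : μ / (μ + ψ v ^ 2) ≤ 1 := by
        rw [div_le_one h0]; nlinarith [sq_nonneg (ψ v)]
      have h2 : 0 ≤ μ / l * (ψ' v / (μ + ψ v ^ 2)) := by
        have := hψ0 v
        positivity
      linarith
    · rw [Set.indicator_of_notMem hv, zero_add]
      have h1 : δ ≤ |v| := by
        by_contra hcon
        exact hv (abs_le.mp (not_le.mp hcon).le)
      have h2 := hψl v h1
      rw [div_mul_div_comm, div_le_div_iff₀ h0 (by positivity)]
      have : 0 ≤ μ * (μ + ψ v ^ 2) := by positivity
      nlinarith
  have h1 : ∫ v in p..q, (Set.Icc (-δ) δ).indicator (fun _ => (1 : ℝ)) v ≤ 2 * δ := by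
    rw [intervalIntegral.integral_of_le hpq]
    calc ∫ v in Set.Ioc p q, (Set.Icc (-δ) δ).indicator (fun _ => (1 : ℝ)) v
        ≤ ∫ v, (Set.Icc (-δ) δ).indicator (fun _ => (1 : ℝ)) v := by
          refine setIntegral_le_integral ?_ (Filter.Eventually.of_forall fun v => ?_)
          · exact (integrable_indicator_iff measurableSet_Icc).2 (by simp)
          · exact Set.indicator_nonneg (fun _ _ => zero_le_one) v
      _ = 2 * δ := by
          rw [integral_indicator measurableSet_Icc]
          simp only [integral_const, MeasurableSet.univ, measureReal_restrict_apply,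
            Set.univ_inter, Real.volume_real_Icc, smul_eq_mul, mul_one]
          rw [max_eq_left (by linarith)]
          ring
  calc ∫ v in p..q, μ / (μ + ψ v ^ 2) ≤
        ∫ v in p..q, ((Set.Icc (-δ) δ).indicator (fun _ => (1 : ℝ)) v +
          μ / l * (ψ' v / (μ + ψ v ^ 2))) :=
        intervalIntegral.integral_mono_on hpq (hc2.intervalIntegrable _ _)
          (hind.add (Continuous.intervalIntegrable (by fun_prop) _ _)) fun v _ => hpt v
    _ ≤ 2 * δ + μ / l * (Real.pi / √μ) := by
        rw [intervalIntegral.integral_add hind (Continuous.intervalIntegrable (by fun_prop) _ _),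
          intervalIntegral.integral_const_mul]
        have := integral_deriv_div_add_sq_le hψ hψ' hμ p q
        gcongr
    _ = 2 * δ + Real.pi * √μ / l := by
        congr 1
        field_simp
        nlinarith

/-- A one-dimensional oscillatory integral with a quartic phase `x v + t (v⁴ + b v²) + θ`. -/
theorem norm_integral_quartic_le {a a' : ℝ → ℝ} (ha : ∀ v, HasDerivAt a (a' v) v)
    (ha' : Continuous a') {A : ℝ} (haA : ∀ v, |a v| ≤ A) (haA' : ∀ v, |a' v| ≤ A) {m R : ℝ}
    (hR : 0 ≤ R) (hsupp : ∀ v, R ≤ |v - m| → a v = 0) {t b : ℝ} (ht : 0 < t) (hb : 0 ≤ b)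
    (x θ : ℝ) {δ l : ℝ} (hδ : 0 ≤ δ) (hl : 0 < l)
    (hδl : ∀ v : ℝ, δ ≤ |v| → l ≤ t * (12 * v ^ 2 + 2 * b)) {μ : ℝ} (hμ : 0 < μ) :
    ‖∫ v : ℝ, (a v : ℂ) * Complex.exp (((x * v + t * (v ^ 4 + b * v ^ 2) + θ : ℝ) : ℂ) *
      Complex.I)‖ ≤ A * (R / √μ + Real.pi / √μ + (2 * δ + Real.pi * √μ / l)) := by
  have hA : 0 ≤ A := (abs_nonneg _).trans (haA 0)
  set φ : ℝ → ℝ := fun v => x * v + t * (v ^ 4 + b * v ^ 2) + θ with hφdef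
  set ψ : ℝ → ℝ := fun v => x + t * (4 * v ^ 3 + 2 * b * v) with hψdef
  set ψ' : ℝ → ℝ := fun v => t * (12 * v ^ 2 + 2 * b) with hψ'def
  have hφ : ∀ v, HasDerivAt φ (ψ v) v := by
    intro v
    have h := (((hasDerivAt_id v).const_mul x).add
      ((((hasDerivAt_id v).pow 4).add (((hasDerivAt_id v).pow 2).const_mul b)).const_mul t)).add_const θ
    refine h.congr_deriv ?_
    simp only [hψdef, id, Nat.reduceSub]
    push_cast
    ring
  have hψ : ∀ v, HasDerivAt ψ (ψ' v) v := by
    intro v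
    have h := (((((hasDerivAt_id v).pow 3).const_mul 4).add
      ((hasDerivAt_id v).const_mul (2 * b))).const_mul t).const_add x
    refine h.congr_deriv ?_
    simp only [hψ'def, id, Nat.reduceSub]
    push_cast
    ring
  have hψ0 : ∀ v, 0 ≤ ψ' v := fun v => by simp only [hψ'def]; positivity
  have hψ'c : Continuous ψ' := by fun_prop
  have hap : a (m - R) = 0 := hsupp _ (by
    rw [show m - R - m = -R by ring, abs_neg]; exact le_abs_self R)
  have haq : a (m + R) = 0 := hsupp _ (by
    rw [show m + R - m = R by ring]; exact le_abs_self R)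
  have hpq : m - R ≤ m + R := by linarith
  have hint : ∫ v : ℝ, (a v : ℂ) * Complex.exp ((φ v : ℂ) * Complex.I) =
      ∫ v in (m - R)..(m + R), (a v : ℂ) * Complex.exp ((φ v : ℂ) * Complex.I) := by
    rw [intervalIntegral.integral_of_le hpq]
    refine (setIntegral_eq_integral_of_forall_compl_eq_zero fun v hv => ?_).symm
    rw [hsupp v, Complex.ofReal_zero, zero_mul]
    by_contra hcon
    rw [not_le, abs_lt] at hcon
    exact hv ⟨by linarith, by linarith⟩
  rw [hint]
  refine (norm_integral_mul_cexp_le hφ hψ hψ'c hψ0 ha ha' haA haA' hpq hap haq hμ).trans ?_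
  have h1 := integral_div_add_sq_le hψ hψ'c hψ0 hμ hpq hδ hl hδl
  have h2 : (m + R - (m - R)) / (2 * √μ) = R / √μ := by
    have : 0 < √μ := Real.sqrt_pos.2 hμ
    field_simp
    ring
  rw [h2]
  gcongr

end VanDerCorput

/-! ### Schrödinger decay, and subordination of `e^{itr²}` to `e^{isr}`. -/

section Subordination

variable {V : Type*} [NormedAddCommGroup V] [InnerProductSpace ℝ V]
  [MeasurableSpace V] [BorelSpace V] [FiniteDimensional ℝ V]

theorem norm_cexp_neg_div_le_one {b : ℂ} (hb : 0 < b.re) {r : ℝ} (hr : 0 ≤ r) :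
    ‖Complex.exp (-(r : ℂ) / b)‖ ≤ 1 := by
  rw [Complex.norm_exp, Real.exp_le_one_iff, neg_div, Complex.neg_re, neg_nonpos, Complex.div_re]
  have : 0 < Complex.normSq b := Complex.normSq_pos.2 fun h => by simp [h] at hb
  simp only [Complex.ofReal_re, Complex.ofReal_im, zero_mul, zero_div, add_zero]
  positivity

/-- The transform is moved onto the Gaussian, whose own transform is bounded by `(π/|b|)^{d/2}`,
with `d` the dimension. -/
theorem norm_integral_fourierInv_mul_gaussian_le {h : V → ℂ} (hh : Integrable h) {b : ℂ}
    (hb : 0 < b.re) :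
    ‖∫ ξ, 𝓕⁻ h ξ * Complex.exp (-b * (‖ξ‖ : ℂ) ^ 2)‖ ≤
      (Real.pi / ‖b‖) ^ ((Module.finrank ℝ V : ℝ) / 2) * ∫ y, ‖h y‖ := by
  have hG : Integrable fun ξ : V => Complex.exp (-b * (‖ξ‖ : ℂ) ^ 2) := by
    simpa using GaussianFourier.integrable_cexp_neg_mul_sq_norm_add hb 0 (0 : V)
  rw [integral_fourierInv_mul_eq hh hG, ← integral_const_mul]
  refine norm_integral_le_of_norm_le (hh.norm.const_mul _) (Filter.Eventually.of_forall fun y => ?_)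
  rw [norm_mul, mul_comm]
  gcongr
  rw [Real.fourierInv_eq_fourier_neg, fourier_gaussian_innerProductSpace hb, norm_mul]
  have h1 : ‖((Real.pi : ℂ) / b) ^ ((Module.finrank ℝ V : ℂ) / 2)‖ =
      (Real.pi / ‖b‖) ^ ((Module.finrank ℝ V : ℝ) / 2) := by
    have := Complex.norm_cpow_real ((Real.pi : ℂ) / b) ((Module.finrank ℝ V : ℝ) / 2)
    rw [norm_div, Complex.norm_real, Real.norm_of_nonneg Real.pi_pos.le] at this
    rw [← this]
    push_cast
    rfl
  rw [h1]
  refine mul_le_of_le_one_right (by positivity) ?_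
  have h2 := norm_cexp_neg_div_le_one hb (r := Real.pi ^ 2 * ‖-y‖ ^ 2) (by positivity)
  have h3 : -(Real.pi : ℂ) ^ 2 * (‖-y‖ : ℂ) ^ 2 / b =
      -((Real.pi ^ 2 * ‖-y‖ ^ 2 : ℝ) : ℂ) / b := by
    push_cast
    ring
  rw [h3]
  exact h2

/-- The limit `δ → 0⁺` of the Gaussian bound at `b = δ - is`, where `|b| ≥ |s|`. -/
theorem norm_integral_fourierInv_mul_cexp_le {h : V → ℂ} (hh : Integrable h)
    (hh' : Integrable (𝓕⁻ h)) {s : ℝ} (hs : s ≠ 0) :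
    ‖∫ ξ, 𝓕⁻ h ξ * Complex.exp (Complex.I * (s * ‖ξ‖ ^ 2 : ℝ))‖ ≤
      (Real.pi / |s|) ^ ((Module.finrank ℝ V : ℝ) / 2) * ∫ y, ‖h y‖ := by
  set b : ℝ → ℂ := fun δ => (δ : ℂ) - Complex.I * s with hb
  have hbre : ∀ δ, (b δ).re = δ := fun δ => by simp [hb]
  have hbim : ∀ δ, (b δ).im = -s := fun δ => by simp [hb]
  have hbound : ∀ᶠ δ in nhdsWithin (0 : ℝ) (Set.Ioi 0),
      ‖∫ ξ, 𝓕⁻ h ξ * Complex.exp (-b δ * (‖ξ‖ : ℂ) ^ 2)‖ ≤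
        (Real.pi / |s|) ^ ((Module.finrank ℝ V : ℝ) / 2) * ∫ y, ‖h y‖ := by
    filter_upwards [self_mem_nhdsWithin] with δ hδ
    refine (norm_integral_fourierInv_mul_gaussian_le hh (b := b δ) (by rwa [hbre])).trans ?_
    have h1 : |s| ≤ ‖b δ‖ := by
      have := Complex.abs_im_le_norm (b δ)
      rwa [hbim, abs_neg] at this
    have h2 : 0 < |s| := abs_pos.2 hs
    gcongr
  refine le_of_tendsto (Filter.Tendsto.norm ?_) hbound
  refine tendsto_integral_filter_of_dominated_convergence (fun ξ => ‖𝓕⁻ h ξ‖) ?_ ?_ hh'.norm ?_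
  · refine Filter.Eventually.of_forall fun δ => hh'.aestronglyMeasurable.mul ?_
    exact Continuous.aestronglyMeasurable (by fun_prop)
  · filter_upwards [self_mem_nhdsWithin] with δ hδ
    refine Filter.Eventually.of_forall fun ξ => ?_
    rw [norm_mul]
    refine mul_le_of_le_one_right (norm_nonneg _) ?_
    rw [Complex.norm_exp, Real.exp_le_one_iff, ← Complex.ofReal_pow, Complex.re_mul_ofReal,
      Complex.neg_re, hbre]
    have : 0 < δ := hδ
    nlinarith [sq_nonneg ‖ξ‖]
  · refine Filter.Eventually.of_forall fun ξ => ?_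
    have hc : Continuous fun δ : ℝ => 𝓕⁻ h ξ * Complex.exp (-b δ * (‖ξ‖ : ℂ) ^ 2) := by
      simp only [hb]
      fun_prop
    have := (hc.tendsto 0).mono_left (nhdsWithin_le_nhds (s := Set.Ioi 0))
    convert this using 4
    simp only [hb]
    push_cast
    ring

/-- Fubini and the one-dimensional Gaussian integral in `s`. Formally, `b = i/(4t)` turns the right
side into the integral with phase `t r²`. -/
theorem integral_gaussian_mul_integral_eq {f : V → ℂ} (hf : Integrable f) {r : V → ℝ}
    (hr : Continuous r) {b : ℂ} (hb : 0 < b.re) :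
    ∫ s : ℝ, Complex.exp (-b * (s : ℂ) ^ 2) * ∫ ξ, f ξ * Complex.exp (Complex.I * (s * r ξ : ℝ)) =
      ((Real.pi : ℂ) / b) ^ (1 / 2 : ℂ) * ∫ ξ, f ξ * Complex.exp (-((r ξ ^ 2 / 4 : ℝ) : ℂ) / b) := by
  have hb0 : b ≠ 0 := fun h => by simp [h] at hb
  have hint : Integrable (fun p : ℝ × V => Complex.exp (-b * (p.1 : ℂ) ^ 2) *
      (f p.2 * Complex.exp (Complex.I * (p.1 * r p.2 : ℝ)))) (volume.prod volume) := by
    have h1 := (integrable_cexp_neg_mul_sq hb).mul_prod hf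
    have h2 : Continuous fun p : ℝ × V => Complex.exp (Complex.I * (p.1 * r p.2 : ℝ)) := by
      fun_prop
    have h3 := h1.mul_bdd (c := 1) h2.aestronglyMeasurable (Filter.Eventually.of_forall fun p => by
      rw [mul_comm, Complex.norm_exp_ofReal_mul_I])
    refine h3.congr (Filter.Eventually.of_forall fun p => ?_)
    simp only
    ring
  calc _ = ∫ s : ℝ, ∫ ξ, Complex.exp (-b * (s : ℂ) ^ 2) *
        (f ξ * Complex.exp (Complex.I * (s * r ξ : ℝ))) := by
        simp only [integral_const_mul]
    _ = ∫ ξ, (∫ s : ℝ, Complex.exp (-b * (s : ℂ) ^ 2) *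
        (f ξ * Complex.exp (Complex.I * (s * r ξ : ℝ)))) := integral_integral_swap hint
    _ = ∫ ξ, ((Real.pi : ℂ) / b) ^ (1 / 2 : ℂ) *
        (f ξ * Complex.exp (-((r ξ ^ 2 / 4 : ℝ) : ℂ) / b)) := by
        refine integral_congr_ae (Filter.Eventually.of_forall fun ξ => ?_)
        have h1 := integral_cexp_quadratic (b := -b) (by simpa using hb) (Complex.I * r ξ) 0
        simp only
        calc ∫ s : ℝ, Complex.exp (-b * (s : ℂ) ^ 2) *
              (f ξ * Complex.exp (Complex.I * (s * r ξ : ℝ)))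
            = ∫ s : ℝ, f ξ * Complex.exp (-b * (s : ℂ) ^ 2 + Complex.I * r ξ * s + 0) := by
              refine integral_congr_ae (Filter.Eventually.of_forall fun s => ?_)
              simp only
              rw [add_zero, Complex.exp_add]
              push_cast
              rw [show Complex.I * ((s : ℂ) * (r ξ : ℂ)) = Complex.I * r ξ * s by ring]
              ring
          _ = _ := by
              rw [integral_const_mul, h1, neg_neg]
              have : 0 - (Complex.I * (r ξ : ℂ)) ^ 2 / (4 * -b) =
                  -((r ξ ^ 2 / 4 : ℝ) : ℂ) / b := by
                rw [mul_pow, Complex.I_sq]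
                push_cast
                field_simp
                ring
              rw [this]
              ring
    _ = _ := integral_const_mul _ _

theorem norm_exp_I_mul_sub_one_le_rpow (y : ℝ) {θ : ℝ} (hθ0 : 0 ≤ θ) (hθ1 : θ ≤ 1) :
    ‖Complex.exp (Complex.I * y) - 1‖ ≤ 2 * |y| ^ θ := by
  rcases le_total |y| 1 with h | h
  · have h1 := Real.norm_exp_I_mul_ofReal_sub_one_le (x := y)
    have h2 : |y| ≤ |y| ^ θ := by
      rcases eq_or_lt_of_le (abs_nonneg y) with h0 | h0
      · rw [← h0]; positivity
      · calc |y| = |y| ^ (1 : ℝ) := (Real.rpow_one _).symm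
          _ ≤ |y| ^ θ := Real.rpow_le_rpow_of_exponent_ge h0 h hθ1
    rw [Real.norm_eq_abs] at h1
    have : 0 ≤ |y| ^ θ := by positivity
    linarith
  · have h1 : ‖Complex.exp (Complex.I * y) - 1‖ ≤ 2 := by
      refine (norm_sub_le _ _).trans ?_
      rw [mul_comm, Complex.norm_exp_ofReal_mul_I, norm_one]
      norm_num
    have h2 : 1 ≤ |y| ^ θ := Real.one_le_rpow h hθ0
    linarith

/-- Writing `H(s) = ∫ f e^{isr}`, the integral sought is `t^{-1/2} ∫ e^{-is²/4t} H(s) ds` up to a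
constant. The hypothesis `hvanish` plays the role of `∫ H = 0`, so `e^{-is²/4t}` may be replaced by
`e^{-is²/4t} - 1 = O((s²/t)^θ)`. This gains `t^{-θ}` and costs `|s|^{2θ}`, which the decay of `H`
absorbs when `β - 2θ > 1`. -/
theorem norm_integral_mul_cexp_sq_le {f : V → ℂ} (hf : Integrable f) {r : V → ℝ}
    (hr : Continuous r) {t : ℝ} (ht : 0 < t) {β θ B : ℝ} (hθ0 : 0 ≤ θ) (hθ1 : θ ≤ 1)
    (hβ : 1 + 2 * θ < β)
    (hB : ∀ s : ℝ, ‖∫ ξ, f ξ * Complex.exp (Complex.I * (s * r ξ : ℝ))‖ ≤ B * (1 + |s|) ^ (-β))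
    (hvanish : Filter.Tendsto (fun δ : ℝ => (Real.pi / δ) ^ (1 / 2 : ℝ) *
      ∫ ξ, ‖f ξ‖ * Real.exp (-(r ξ ^ 2 / 4) / δ)) (nhdsWithin 0 (Set.Ioi 0)) (nhds 0)) :
    ‖∫ ξ, f ξ * Complex.exp (Complex.I * (t * r ξ ^ 2 : ℝ))‖ ≤
      2 * B * (∫ s : ℝ, (1 + |s|) ^ (-(β - 2 * θ))) * t ^ (-(1 / 2 + θ)) := by
  set H : ℝ → ℂ := fun s => ∫ ξ, f ξ * Complex.exp (Complex.I * (s * r ξ : ℝ)) with hH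
  set I₀ : ℝ := ∫ s : ℝ, (1 + |s|) ^ (-(β - 2 * θ)) with hI₀
  have hI₀nn : 0 ≤ I₀ := integral_nonneg fun s => by positivity
  have hBnn : 0 ≤ B := by
    have := (norm_nonneg _).trans (hB 0)
    simpa using this
  have hint0 : Integrable fun s : ℝ => (1 + |s|) ^ (-(β - 2 * θ)) := by
    have := integrable_one_add_norm (E := ℝ) (μ := volume) (r := β - 2 * θ) (by simp; linarith)
    simpa using this
  have hHc : Continuous H := by
    refine continuous_of_dominated (bound := fun ξ => ‖f ξ‖) (fun s => ?_) (fun s => ?_) hf.norm ?_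
    · exact hf.aestronglyMeasurable.mul (Continuous.aestronglyMeasurable (by fun_prop))
    · refine Filter.Eventually.of_forall fun ξ => ?_
      rw [norm_mul, mul_comm Complex.I, Complex.norm_exp_ofReal_mul_I, mul_one]
    · exact Filter.Eventually.of_forall fun ξ => by fun_prop
  have hHM : ∀ s, ‖H s‖ ≤ ∫ ξ, ‖f ξ‖ := fun s => by
    refine norm_integral_le_of_norm_le hf.norm (Filter.Eventually.of_forall fun ξ => ?_)
    rw [norm_mul, mul_comm Complex.I, Complex.norm_exp_ofReal_mul_I, mul_one]
  set J : ℂ → ℂ := fun b => ∫ s : ℝ, Complex.exp (-b * (s : ℂ) ^ 2) * H s with hJ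
  have hJint : ∀ b : ℂ, 0 < b.re → Integrable fun s : ℝ => Complex.exp (-b * (s : ℂ) ^ 2) * H s :=
    fun b hb => (integrable_cexp_neg_mul_sq hb).mul_bdd hHc.aestronglyMeasurable
      (Filter.Eventually.of_forall hHM)
  have hJeq : ∀ b : ℂ, 0 < b.re → J b = ((Real.pi : ℂ) / b) ^ (1 / 2 : ℂ) *
      ∫ ξ, f ξ * Complex.exp (-((r ξ ^ 2 / 4 : ℝ) : ℂ) / b) :=
    fun b hb => integral_gaussian_mul_integral_eq hf hr hb
  have hJnorm : ∀ b : ℂ, 0 < b.re → ‖J b‖ = (Real.pi / ‖b‖) ^ (1 / 2 : ℝ) *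
      ‖∫ ξ, f ξ * Complex.exp (-((r ξ ^ 2 / 4 : ℝ) : ℂ) / b)‖ := by
    intro b hb
    rw [hJeq b hb, norm_mul]
    congr 1
    have := Complex.norm_cpow_real ((Real.pi : ℂ) / b) (1 / 2)
    rw [norm_div, Complex.norm_real, Real.norm_of_nonneg Real.pi_pos.le] at this
    rw [← this]
    push_cast
    rfl
  set b : ℝ → ℂ := fun δ => (δ : ℂ) + Complex.I * ((1 / (4 * t) : ℝ) : ℂ) with hb
  have hbre : ∀ δ, (b δ).re = δ := fun δ => by simp [hb]
  have hbim : ∀ δ, (b δ).im = 1 / (4 * t) := fun δ => by simp [hb]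
  -- Subtracting `J δ`, which tends to zero with `δ` by `hvanish`, produces the factor `e^{-is²/4t}
  -- - 1`; the bound is uniform in `δ`.
  have hdiff : ∀ δ : ℝ, 0 < δ → ‖J (b δ) - J δ‖ ≤ 2 * (1 / (4 * t)) ^ θ * B * I₀ := by
    intro δ hδ
    have hbδ : 0 < (b δ).re := by rwa [hbre]
    have hδ' : 0 < ((δ : ℝ) : ℂ).re := by simpa using hδ
    simp only [hJ]
    rw [← integral_sub (hJint _ hbδ) (hJint _ hδ'), ← integral_const_mul]
    refine norm_integral_le_of_norm_le (hint0.const_mul _) (Filter.Eventually.of_forall fun s => ?_)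
    have h1 : Complex.exp (-b δ * (s : ℂ) ^ 2) * H s - Complex.exp (-(δ : ℂ) * (s : ℂ) ^ 2) * H s =
        Complex.exp (-(δ : ℂ) * (s : ℂ) ^ 2) *
          (Complex.exp (Complex.I * ((-(1 / (4 * t) * s ^ 2) : ℝ) : ℂ)) - 1) * H s := by
      have : -b δ * (s : ℂ) ^ 2 = -(δ : ℂ) * (s : ℂ) ^ 2 +
          Complex.I * ((-(1 / (4 * t) * s ^ 2) : ℝ) : ℂ) := by
        simp only [hb]
        push_cast
        ring
      rw [this, Complex.exp_add]
      ring
    rw [h1, norm_mul, norm_mul]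
    have h2 : ‖Complex.exp (-(δ : ℂ) * (s : ℂ) ^ 2)‖ ≤ 1 := by
      rw [Complex.norm_exp, Real.exp_le_one_iff, ← Complex.ofReal_pow, Complex.re_mul_ofReal]
      simp only [Complex.neg_re, Complex.ofReal_re]
      nlinarith [sq_nonneg s]
    have h3 := norm_exp_I_mul_sub_one_le_rpow (-(1 / (4 * t) * s ^ 2)) hθ0 hθ1
    have h4 : |-(1 / (4 * t) * s ^ 2)| ^ θ ≤ (1 / (4 * t)) ^ θ * (1 + |s|) ^ (2 * θ) := by
      rw [abs_neg, abs_of_nonneg (by positivity), Real.mul_rpow (by positivity) (by positivity),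
        Real.rpow_mul (by positivity)]
      gcongr
      rw [Real.rpow_two, ← sq_abs]
      gcongr
      linarith
    calc ‖Complex.exp (-(δ : ℂ) * (s : ℂ) ^ 2)‖ *
          ‖Complex.exp (Complex.I * ((-(1 / (4 * t) * s ^ 2) : ℝ) : ℂ)) - 1‖ * ‖H s‖
        ≤ 1 * (2 * ((1 / (4 * t)) ^ θ * (1 + |s|) ^ (2 * θ))) * (B * (1 + |s|) ^ (-β)) := by
          gcongr
          · exact h3.trans (by gcongr)
          · exact hB s
      _ = 2 * (1 / (4 * t)) ^ θ * B * (1 + |s|) ^ (-(β - 2 * θ)) := by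
          rw [show -(β - 2 * θ) = 2 * θ + -β by ring, Real.rpow_add (by positivity)]
          ring
  have hineq : ∀ᶠ δ in nhdsWithin (0 : ℝ) (Set.Ioi 0), (Real.pi / ‖b δ‖) ^ (1 / 2 : ℝ) *
      ‖∫ ξ, f ξ * Complex.exp (-((r ξ ^ 2 / 4 : ℝ) : ℂ) / b δ)‖ ≤
      2 * (1 / (4 * t)) ^ θ * B * I₀ +
        (Real.pi / δ) ^ (1 / 2 : ℝ) * ∫ ξ, ‖f ξ‖ * Real.exp (-(r ξ ^ 2 / 4) / δ) := by
    filter_upwards [self_mem_nhdsWithin] with δ hδ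
    have hδ0 : 0 < δ := hδ
    have hbδ : 0 < (b δ).re := by rwa [hbre]
    have hδ' : 0 < ((δ : ℝ) : ℂ).re := by simpa using hδ0
    rw [← hJnorm _ hbδ]
    have h1 : ‖J δ‖ ≤ (Real.pi / δ) ^ (1 / 2 : ℝ) *
        ∫ ξ, ‖f ξ‖ * Real.exp (-(r ξ ^ 2 / 4) / δ) := by
      rw [hJnorm _ hδ', Complex.norm_real, Real.norm_of_nonneg hδ0.le]
      gcongr
      refine (norm_integral_le_integral_norm _).trans (le_of_eq ?_)
      refine integral_congr_ae (Filter.Eventually.of_forall fun ξ => ?_)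
      simp only
      rw [norm_mul, Complex.norm_exp]
      congr 3
      rw [← Complex.ofReal_neg, ← Complex.ofReal_div, Complex.ofReal_re]
    calc ‖J (b δ)‖ = ‖(J (b δ) - J δ) + J δ‖ := by rw [sub_add_cancel]
      _ ≤ _ := (norm_add_le _ _).trans (add_le_add (hdiff δ hδ0) h1)
  have hb0 : b 0 ≠ 0 := by
    intro h
    have := hbim 0
    rw [h] at this
    simp only [Complex.zero_im] at this
    have h2 : 0 < 1 / (4 * t) := by positivity
    linarith
  have hbc : Continuous b := by simp only [hb]; fun_prop
  have hbt : Filter.Tendsto b (nhdsWithin 0 (Set.Ioi 0)) (nhds (b 0)) :=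
    (hbc.tendsto 0).mono_left nhdsWithin_le_nhds
  have hnb0 : ‖b 0‖ = 1 / (4 * t) := by
    simp only [hb]
    rw [Complex.ofReal_zero, zero_add, norm_mul, Complex.norm_I, one_mul, Complex.norm_real,
      Real.norm_of_nonneg (by positivity)]
  have hlim : Filter.Tendsto (fun δ => (Real.pi / ‖b δ‖) ^ (1 / 2 : ℝ) *
      ‖∫ ξ, f ξ * Complex.exp (-((r ξ ^ 2 / 4 : ℝ) : ℂ) / b δ)‖) (nhdsWithin 0 (Set.Ioi 0))
      (nhds ((Real.pi / (1 / (4 * t))) ^ (1 / 2 : ℝ) *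
        ‖∫ ξ, f ξ * Complex.exp (Complex.I * (t * r ξ ^ 2 : ℝ))‖)) := by
    refine Filter.Tendsto.mul ?_ (Filter.Tendsto.norm ?_)
    · rw [← hnb0]
      exact (tendsto_const_nhds.div hbt.norm (norm_ne_zero_iff.2 hb0)).rpow_const
        (Or.inr (by norm_num))
    · refine tendsto_integral_filter_of_dominated_convergence (fun ξ => ‖f ξ‖) ?_ ?_ hf.norm ?_
      · refine Filter.Eventually.of_forall fun δ => hf.aestronglyMeasurable.mul ?_
        exact Continuous.aestronglyMeasurable (by fun_prop)
      · filter_upwards [self_mem_nhdsWithin] with δ hδ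
        refine Filter.Eventually.of_forall fun ξ => ?_
        rw [norm_mul]
        exact mul_le_of_le_one_right (norm_nonneg _)
          (norm_cexp_neg_div_le_one (by rwa [hbre]) (by positivity))
      · refine Filter.Eventually.of_forall fun ξ => ?_
        refine Filter.Tendsto.const_mul _ ?_
        have h1 : Complex.I * ((t * r ξ ^ 2 : ℝ) : ℂ) = -((r ξ ^ 2 / 4 : ℝ) : ℂ) / b 0 := by
          rw [eq_div_iff hb0]
          simp only [hb]
          push_cast
          have ht' : (t : ℂ) ≠ 0 := by exact_mod_cast ht.ne'
          field_simp
          linear_combination (r ξ : ℂ) ^ 2 * Complex.I_sq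
        rw [h1]
        exact (Complex.continuous_exp.tendsto _).comp (tendsto_const_nhds.div hbt hb0)
  have hfin := le_of_tendsto_of_tendsto hlim (tendsto_const_nhds.add hvanish) hineq
  rw [add_zero] at hfin
  set K := ‖∫ ξ, f ξ * Complex.exp (Complex.I * (t * r ξ ^ 2 : ℝ))‖ with hK
  have h1 : t ^ (1 / 2 : ℝ) ≤ (Real.pi / (1 / (4 * t))) ^ (1 / 2 : ℝ) := by
    refine Real.rpow_le_rpow ht.le ?_ (by norm_num)
    rw [div_div_eq_mul_div, div_one]
    nlinarith [Real.pi_gt_three]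
  have h2 : (1 / (4 * t)) ^ θ ≤ t ^ (-θ) := by
    rw [Real.rpow_neg ht.le, ← Real.inv_rpow ht.le]
    refine Real.rpow_le_rpow (by positivity) ?_ hθ0
    rw [one_div]
    exact inv_anti₀ ht (by linarith)
  have h3 : t ^ (1 / 2 : ℝ) * K ≤ 2 * t ^ (-θ) * B * I₀ :=
    (mul_le_mul_of_nonneg_right h1 (norm_nonneg _)).trans (hfin.trans (by gcongr))
  have h4 : K = t ^ (-(1 / 2) : ℝ) * (t ^ (1 / 2 : ℝ) * K) := by
    rw [← mul_assoc, ← Real.rpow_add ht]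
    norm_num
  calc K = t ^ (-(1 / 2) : ℝ) * (t ^ (1 / 2 : ℝ) * K) := h4
    _ ≤ t ^ (-(1 / 2) : ℝ) * (2 * t ^ (-θ) * B * I₀) := by gcongr
    _ = 2 * B * I₀ * t ^ (-(1 / 2 + θ)) := by
        rw [neg_add, Real.rpow_add ht]
        ring

end Subordination

/-! ### The oscillatory integral and its decay in dimension at least three. -/

section Modulated

variable {V : Type*} [NormedAddCommGroup V] [InnerProductSpace ℝ V]

/-- `χ (ξ - c) e^{2πi ξ·x}`. -/
noncomputable def modulated (χ : V → ℝ) (c x ξ : V) : ℂ :=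
  (χ (ξ - c) : ℂ) * Complex.exp (((2 * Real.pi * inner ℝ ξ x : ℝ) : ℂ) * Complex.I)

theorem norm_modulated (χ : V → ℝ) (c x ξ : V) : ‖modulated χ c x ξ‖ = |χ (ξ - c)| := by
  rw [modulated, norm_mul, Complex.norm_exp_ofReal_mul_I, mul_one, Complex.norm_real,
    Real.norm_eq_abs]

theorem continuous_modulated {χ : V → ℝ} (hχ : Continuous χ) (c x : V) :
    Continuous (modulated χ c x) := by
  unfold modulated
  fun_prop

end Modulated

section OscInt

variable {V : Type*} [NormedAddCommGroup V] [InnerProductSpace ℝ V]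
  [MeasurableSpace V] [BorelSpace V] [FiniteDimensional ℝ V]

/-- The oscillatory integral with phase `2π ξ·x + τ (|ξ|⁴ + ε |ξ|²)` and amplitude `χ (ξ - c)`. -/
noncomputable def oscInt (χ : V → ℝ) (c x : V) (ε τ : ℝ) : ℂ :=
  ∫ ξ, (χ (ξ - c) : ℂ) * Complex.exp
    (((2 * Real.pi * inner ℝ ξ x + τ * (‖ξ‖ ^ 4 + ε * ‖ξ‖ ^ 2) : ℝ) : ℂ) * Complex.I)

theorem oscInt_neg (χ : V → ℝ) (c x : V) (ε τ : ℝ) :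
    oscInt χ c (-x) ε (-τ) = (starRingEnd ℂ) (oscInt χ c x ε τ) := by
  unfold oscInt
  rw [← integral_conj]
  refine integral_congr_ae (Filter.Eventually.of_forall fun ξ => ?_)
  simp only [map_mul, Complex.conj_ofReal, ← Complex.exp_conj, Complex.conj_I, inner_neg_right]
  congr 2
  push_cast
  ring

theorem norm_oscInt_le (χ : V → ℝ) (hχ : Integrable χ) (c x : V) (ε τ : ℝ) :
    ‖oscInt χ c x ε τ‖ ≤ ∫ ξ, |χ ξ| := by
  rw [← integral_sub_right_eq_self (fun ξ => |χ ξ|) c]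
  refine norm_integral_le_of_norm_le ((hχ.comp_sub_right c).norm)
    (Filter.Eventually.of_forall fun ξ => ?_)
  rw [norm_mul, Complex.norm_exp_ofReal_mul_I, mul_one, Complex.norm_real, Real.norm_eq_abs]

/-- Complex conjugation exchanges `(x, τ)` with `(-x, -τ)`, and the hypothesis is uniform in `x`. -/
theorem norm_oscInt_le_of_pos {χ : V → ℝ} {C α : ℝ} {S : Set ℝ}
    (h : ∀ (c x : V), ∀ ε ∈ S, ∀ τ, 0 < τ → ‖oscInt χ c x ε τ‖ ≤ C * τ ^ (-α)) :
    ∀ (c x : V), ∀ ε ∈ S, ∀ τ, τ ≠ 0 → ‖oscInt χ c x ε τ‖ ≤ C * |τ| ^ (-α) := by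
  intro c x ε hε τ hτ
  rcases lt_or_gt_of_ne hτ with h0 | h0
  · have h1 := h c (-x) ε hε (-τ) (by linarith)
    rw [oscInt_neg, RCLike.norm_conj] at h1
    rwa [abs_of_neg h0]
  · rw [abs_of_pos h0]
    exact h c x ε hε τ h0

theorem integrable_modulated {χ : V → ℝ} (hχ : Continuous χ) (hχi : Integrable χ) (c x : V) :
    Integrable (modulated χ c x) := by
  refine (hχi.comp_sub_right c).mono (continuous_modulated hχ c x).aestronglyMeasurable
    (Filter.Eventually.of_forall fun ξ => ?_)
  rw [norm_modulated, Real.norm_eq_abs]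

theorem norm_fourier_modulated (χ : V → ℝ) (c x y : V) :
    ‖𝓕 (modulated χ c x) y‖ = ‖𝓕 (fun ξ => (χ ξ : ℂ)) (y - x)‖ := by
  have h : 𝓕 (modulated χ c x) y =
      Complex.exp (((-(2 * Real.pi * inner ℝ c (y - x)) : ℝ) : ℂ) * Complex.I) *
        𝓕 (fun ξ => (χ ξ : ℂ)) (y - x) := by
    rw [Real.fourier_eq', Real.fourier_eq', ← integral_const_mul,
      ← integral_sub_right_eq_self (fun ξ : V => Complex.exp
        (((-(2 * Real.pi * inner ℝ c (y - x)) : ℝ) : ℂ) * Complex.I) *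
          (Complex.exp (((-2 * Real.pi * inner ℝ ξ (y - x) : ℝ) : ℂ) * Complex.I) • (χ ξ : ℂ))) c]
    refine integral_congr_ae (Filter.Eventually.of_forall fun ξ => ?_)
    simp only [modulated, smul_eq_mul]
    have he : Complex.exp (((-2 * Real.pi * inner ℝ ξ y : ℝ) : ℂ) * Complex.I) *
        Complex.exp (((2 * Real.pi * inner ℝ ξ x : ℝ) : ℂ) * Complex.I) =
        Complex.exp (((-(2 * Real.pi * inner ℝ c (y - x)) : ℝ) : ℂ) * Complex.I) *
        Complex.exp (((-2 * Real.pi * inner ℝ (ξ - c) (y - x) : ℝ) : ℂ) * Complex.I) := by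
      rw [← Complex.exp_add, ← Complex.exp_add]
      congr 1
      simp only [inner_sub_left, inner_sub_right]
      push_cast
      ring
    linear_combination (χ (ξ - c) : ℂ) * he
  rw [h, norm_mul, Complex.norm_exp_ofReal_mul_I, one_mul]

theorem integrable_fourier_ofReal {χ : V → ℝ} (hχ : ContDiff ℝ ∞ χ) (hχc : HasCompactSupport χ) :
    Integrable (𝓕 (fun ξ => (χ ξ : ℂ))) := by
  have h₁ : HasCompactSupport (Complex.ofRealCLM ∘ χ) := hχc.comp_left rfl
  have h₂ : ContDiff ℝ ∞ (Complex.ofRealCLM ∘ χ) := by fun_prop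
  have h := (𝓕 (h₁.toSchwartzMap h₂)).integrable (μ := volume)
  rw [SchwartzMap.fourier_coe] at h
  exact h

/-- Translating and modulating the amplitude only multiplies its Fourier transform by phases and
shifts it. The `L¹` norm of the transform, which governs the Schrödinger decay, is therefore
independent of `c` and `x`. For `|s| ≤ 1` the trivial bound is used. -/
theorem exists_norm_integral_modulated_mul_cexp_le {χ : V → ℝ} (hχ : ContDiff ℝ ∞ χ)
    (hχc : HasCompactSupport χ) :
    ∃ B : ℝ, ∀ (c x : V) (s : ℝ),
      ‖∫ ξ, modulated χ c x ξ * Complex.exp (Complex.I * (s * ‖ξ‖ ^ 2 : ℝ))‖ ≤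
        B * (1 + |s|) ^ (-((Module.finrank ℝ V : ℝ) / 2)) := by
  set d := (Module.finrank ℝ V : ℝ) with hd
  have hd0 : 0 ≤ d := Nat.cast_nonneg _
  have hχi : Integrable χ := hχ.continuous.integrable_of_hasCompactSupport hχc
  set M₁ := ∫ ξ, |χ ξ| with hM₁
  set M₂ := ∫ ξ, ‖𝓕 (fun ξ => (χ ξ : ℂ)) ξ‖ with hM₂
  have hM₁0 : 0 ≤ M₁ := integral_nonneg fun _ => abs_nonneg _
  have hM₂0 : 0 ≤ M₂ := integral_nonneg fun _ => norm_nonneg _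
  have hFi := integrable_fourier_ofReal hχ hχc
  refine ⟨(2 * Real.pi) ^ (d / 2) * (M₁ + M₂), fun c x s => ?_⟩
  have hpi := Real.pi_gt_three
  have hfi := integrable_modulated hχ.continuous hχi c x
  rcases le_or_gt |s| 1 with hs | hs
  · have h1 : ‖∫ ξ, modulated χ c x ξ * Complex.exp (Complex.I * (s * ‖ξ‖ ^ 2 : ℝ))‖ ≤ M₁ := by
      rw [hM₁, ← integral_sub_right_eq_self (fun ξ => |χ ξ|) c]
      refine norm_integral_le_of_norm_le ((hχi.comp_sub_right c).norm)
        (Filter.Eventually.of_forall fun ξ => ?_)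
      rw [norm_mul, mul_comm Complex.I, Complex.norm_exp_ofReal_mul_I, mul_one, norm_modulated]
    have h2 : 1 ≤ (2 * Real.pi) ^ (d / 2) * (1 + |s|) ^ (-(d / 2)) := by
      rw [Real.rpow_neg (by positivity), ← div_eq_mul_inv,
        ← Real.div_rpow (by positivity) (by positivity)]
      refine Real.one_le_rpow ?_ (by positivity)
      rw [one_le_div (by positivity)]
      linarith
    nlinarith
  · have hs0 : s ≠ 0 := fun h => by rw [h, abs_zero] at hs; linarith
    set h := 𝓕 (modulated χ c x) with hh
    have hhi : Integrable h := by
      refine (hFi.comp_sub_right x).mono ?_ (Filter.Eventually.of_forall fun y => ?_)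
      · exact (VectorFourier.fourierIntegral_continuous (μ := (volume : Measure V))
          (e := Real.fourierChar) (L := innerₗ V) (f := modulated χ c x)
          Real.continuous_fourierChar continuous_inner hfi).aestronglyMeasurable
      · rw [hh, norm_fourier_modulated]
    have hinv : 𝓕⁻ h = modulated χ c x :=
      (continuous_modulated hχ.continuous c x).fourierInv_fourier_eq hfi hhi
    have h1 := norm_integral_fourierInv_mul_cexp_le hhi (by rwa [hinv]) hs0
    have hM : ∫ y, ‖h y‖ = M₂ := by
      rw [hM₂, ← integral_sub_right_eq_self (fun y => ‖𝓕 (fun ξ => (χ ξ : ℂ)) y‖) x]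
      simp only [hh, norm_fourier_modulated]
    rw [hinv, hM] at h1
    have h2 : (Real.pi / |s|) ^ (d / 2) ≤ (2 * Real.pi) ^ (d / 2) * (1 + |s|) ^ (-(d / 2)) := by
      rw [Real.rpow_neg (by positivity), ← div_eq_mul_inv,
        ← Real.div_rpow (by positivity) (by positivity)]
      refine Real.rpow_le_rpow (by positivity) ?_ (by positivity)
      rw [div_le_div_iff₀ (by linarith) (by positivity)]
      nlinarith
    have h3 : 0 ≤ (2 * Real.pi) ^ (d / 2) * (1 + |s|) ^ (-(d / 2)) := by positivity
    calc _ ≤ _ := h1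
      _ ≤ (2 * Real.pi) ^ (d / 2) * (1 + |s|) ^ (-(d / 2)) * M₂ := by gcongr
      _ ≤ _ := by nlinarith

/-- As `r² ≥ |ξ|⁴`, scaling by `δ^{1/4}` shows that the integral is `O(δ^{d/4})`; this beats the
prefactor `δ^{-1/2}` exactly when `d > 2`. -/
theorem tendsto_rpow_mul_integral_exp_neg_div {f : V → ℂ} {M : ℝ}
    (hfM : ∀ ξ, ‖f ξ‖ ≤ M) (hd : 2 < Module.finrank ℝ V) {r : V → ℝ}
    (hrn : ∀ ξ, ‖ξ‖ ^ 2 ≤ r ξ) :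
    Filter.Tendsto (fun δ : ℝ => (Real.pi / δ) ^ (1 / 2 : ℝ) *
      ∫ ξ, ‖f ξ‖ * Real.exp (-(r ξ ^ 2 / 4) / δ)) (nhdsWithin 0 (Set.Ioi 0)) (nhds 0) := by
  set d := Module.finrank ℝ V with hdef
  have hM : 0 ≤ M := (norm_nonneg _).trans (hfM 0)
  set I₀ := ∫ ξ : V, Real.exp (-(‖ξ‖ ^ 4 / 4)) with hI₀
  have hI0i : Integrable fun ξ : V => Real.exp (-(‖ξ‖ ^ 4 / 4)) := by
    have h1 : Integrable fun ξ : V => Real.exp (-(1 / 2 : ℝ) * ‖ξ‖ ^ 2) := by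
      have h2 : Integrable fun ξ : V => Complex.exp (-(1 / 2 : ℂ) * (‖ξ‖ : ℂ) ^ 2) := by
        simpa using GaussianFourier.integrable_cexp_neg_mul_sq_norm_add
          (b := (1 / 2 : ℂ)) (by norm_num) 0 (0 : V)
      refine h2.norm.congr (Filter.Eventually.of_forall fun ξ => ?_)
      simp only
      rw [Complex.norm_exp]
      congr 1
      rw [← Complex.ofReal_pow, Complex.re_mul_ofReal]
      norm_num
    refine (h1.const_mul (Real.exp (1 / 4))).mono
      (Continuous.aestronglyMeasurable (by fun_prop)) (Filter.Eventually.of_forall fun ξ => ?_)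
    rw [Real.norm_of_nonneg (by positivity), Real.norm_of_nonneg (by positivity), ← Real.exp_add,
      Real.exp_le_exp]
    nlinarith [sq_nonneg (‖ξ‖ ^ 2 - 1)]
  have hscale : ∀ δ : ℝ, 0 < δ →
      ∫ ξ : V, Real.exp (-(‖ξ‖ ^ 4 / 4) / δ) = (δ ^ (1 / 4 : ℝ)) ^ d * I₀ ∧
      Integrable fun ξ : V => Real.exp (-(‖ξ‖ ^ 4 / 4) / δ) := by
    intro δ hδ
    set ρ := δ ^ (1 / 4 : ℝ) with hρ
    have hρ0 : 0 < ρ := by positivity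
    have hρ4 : ρ ^ 4 = δ := by
      rw [hρ, ← Real.rpow_natCast, ← Real.rpow_mul hδ.le]
      norm_num
    have heq : (fun ξ : V => Real.exp (-(‖ξ‖ ^ 4 / 4) / δ)) =
        fun ξ : V => Real.exp (-(‖ρ⁻¹ • ξ‖ ^ 4 / 4)) := by
      ext ξ
      rw [norm_smul, norm_inv, Real.norm_of_nonneg hρ0.le, mul_pow, inv_pow, hρ4]
      congr 1
      field_simp
    refine ⟨?_, ?_⟩
    · rw [heq, Measure.integral_comp_smul volume (fun ξ : V => Real.exp (-(‖ξ‖ ^ 4 / 4))) ρ⁻¹,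
        smul_eq_mul, ← hI₀, inv_pow, inv_inv, abs_of_nonneg (by positivity)]
    · rw [heq]
      exact hI0i.comp_smul (by positivity)
  have hbd : ∀ δ : ℝ, 0 < δ → (Real.pi / δ) ^ (1 / 2 : ℝ) *
      ∫ ξ, ‖f ξ‖ * Real.exp (-(r ξ ^ 2 / 4) / δ) ≤
        Real.pi ^ (1 / 2 : ℝ) * M * I₀ * δ ^ ((d : ℝ) / 4 - 1 / 2) := by
    intro δ hδ
    obtain ⟨h1, h2⟩ := hscale δ hδ
    have h3 : ∫ ξ, ‖f ξ‖ * Real.exp (-(r ξ ^ 2 / 4) / δ) ≤ M * ((δ ^ (1 / 4 : ℝ)) ^ d * I₀) := by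
      rw [← h1, ← integral_const_mul]
      refine integral_mono_of_nonneg (Filter.Eventually.of_forall fun ξ => by positivity)
        (h2.const_mul M) (Filter.Eventually.of_forall fun ξ => ?_)
      simp only
      have h4 : ‖ξ‖ ^ 4 ≤ r ξ ^ 2 := by
        calc ‖ξ‖ ^ 4 = (‖ξ‖ ^ 2) ^ 2 := by ring
          _ ≤ _ := pow_le_pow_left₀ (by positivity) (hrn ξ) 2
      gcongr
      exact hfM ξ
    calc _ ≤ (Real.pi / δ) ^ (1 / 2 : ℝ) * (M * ((δ ^ (1 / 4 : ℝ)) ^ d * I₀)) := by gcongr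
      _ = _ := by
        rw [Real.div_rpow Real.pi_pos.le hδ.le, ← Real.rpow_natCast, ← Real.rpow_mul hδ.le,
          Real.rpow_sub hδ]
        rw [show (1 / 4 : ℝ) * (d : ℝ) = (d : ℝ) / 4 by ring]
        ring
  refine tendsto_of_tendsto_of_tendsto_of_le_of_le' tendsto_const_nhds
    (h := fun δ => Real.pi ^ (1 / 2 : ℝ) * M * I₀ * δ ^ ((d : ℝ) / 4 - 1 / 2)) ?_ ?_ ?_
  · have hp : 0 < (d : ℝ) / 4 - 1 / 2 := by
      have : (2 : ℝ) < d := by exact_mod_cast hd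
      linarith
    have h1 : Filter.Tendsto (fun δ : ℝ => δ ^ ((d : ℝ) / 4 - 1 / 2))
        (nhdsWithin 0 (Set.Ioi 0)) (nhds 0) := by
      have h2 := (Real.continuousAt_rpow_const 0 ((d : ℝ) / 4 - 1 / 2) (Or.inr hp.le)).tendsto
      rw [Real.zero_rpow hp.ne'] at h2
      exact h2.mono_left nhdsWithin_le_nhds
    simpa using h1.const_mul (Real.pi ^ (1 / 2 : ℝ) * M * I₀)
  · filter_upwards [self_mem_nhdsWithin] with δ hδ
    have : 0 < δ := hδ
    exact mul_nonneg (by positivity) (integral_nonneg fun ξ => by positivity)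
  · filter_upwards [self_mem_nhdsWithin] with δ hδ
    exact hbd δ hδ

/-- Since `|ξ|⁴ + ε|ξ|² = (|ξ|² + ε/2)² - ε²/4`, the phase is quadratic in `r = |ξ|² + ε/2` up to a
constant, and `e^{isr}` is the Schrödinger flow up to a constant phase. -/
theorem exists_norm_oscInt_le_of_two_lt_finrank {χ : V → ℝ} (hχ : ContDiff ℝ ∞ χ)
    (hχc : HasCompactSupport χ) (hd : 2 < Module.finrank ℝ V) {α : ℝ} (hα0 : 1 / 2 ≤ α)
    (hα1 : α ≤ 3 / 2) (hα : α < (Module.finrank ℝ V : ℝ) / 4) :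
    ∃ C : ℝ, ∀ (c x : V), ∀ ε ∈ Set.Ici (0 : ℝ), ∀ τ, τ ≠ 0 →
      ‖oscInt χ c x ε τ‖ ≤ C * |τ| ^ (-α) := by
  obtain ⟨B, hB⟩ := exists_norm_integral_modulated_mul_cexp_le hχ hχc
  obtain ⟨M, hM⟩ := hχ.continuous.bounded_above_of_compact_support hχc
  have hχi : Integrable χ := hχ.continuous.integrable_of_hasCompactSupport hχc
  set d := (Module.finrank ℝ V : ℝ) with hdd
  -- Subordination is used with decay `d/2` and gain `θ = α - 1/2`; its condition `1 + 2θ < d/2` is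
  -- `α < d/4`, and `θ ∈ [0, 1]` is `1/2 ≤ α ≤ 3/2`.
  refine ⟨_, norm_oscInt_le_of_pos (C := 2 * B *
    (∫ s : ℝ, (1 + |s|) ^ (-(d / 2 - 2 * (α - 1 / 2))))) (α := α) ?_⟩
  intro c x ε hε τ hτ
  have hε0 : 0 ≤ ε := hε
  have hfi := integrable_modulated hχ.continuous hχi c x
  have hrc : Continuous fun ξ : V => ‖ξ‖ ^ 2 + ε / 2 := by fun_prop
  have h := norm_integral_mul_cexp_sq_le hfi hrc hτ (β := d / 2) (θ := α - 1 / 2) (B := B)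
    (by linarith) (by linarith) (by linarith) ?_ ?_
  · rw [show 1 / 2 + (α - 1 / 2) = α by ring] at h
    refine le_trans (le_of_eq ?_) h
    have h1 : oscInt χ c x ε τ = Complex.exp (((-(τ * ε ^ 2 / 4) : ℝ) : ℂ) * Complex.I) *
        ∫ ξ, modulated χ c x ξ * Complex.exp (Complex.I * (τ * (‖ξ‖ ^ 2 + ε / 2) ^ 2 : ℝ)) := by
      rw [← integral_const_mul]
      refine integral_congr_ae (Filter.Eventually.of_forall fun ξ => ?_)
      simp only [modulated]
      have he : Complex.exp (((2 * Real.pi * inner ℝ ξ x + τ * (‖ξ‖ ^ 4 + ε * ‖ξ‖ ^ 2) : ℝ) : ℂ) *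
          Complex.I) = Complex.exp (((-(τ * ε ^ 2 / 4) : ℝ) : ℂ) * Complex.I) *
          (Complex.exp (((2 * Real.pi * inner ℝ ξ x : ℝ) : ℂ) * Complex.I) *
            Complex.exp (Complex.I * (τ * (‖ξ‖ ^ 2 + ε / 2) ^ 2 : ℝ))) := by
        rw [← Complex.exp_add, ← Complex.exp_add]
        congr 1
        push_cast
        ring
      linear_combination (χ (ξ - c) : ℂ) * he
    rw [h1, norm_mul, Complex.norm_exp_ofReal_mul_I, one_mul]
  · intro s
    refine le_trans (le_of_eq ?_) (hB c x s)
    have h1 : ∫ ξ, modulated χ c x ξ * Complex.exp (Complex.I * (s * (‖ξ‖ ^ 2 + ε / 2) : ℝ)) =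
        Complex.exp (((s * (ε / 2) : ℝ) : ℂ) * Complex.I) *
          ∫ ξ, modulated χ c x ξ * Complex.exp (Complex.I * (s * ‖ξ‖ ^ 2 : ℝ)) := by
      rw [← integral_const_mul]
      refine integral_congr_ae (Filter.Eventually.of_forall fun ξ => ?_)
      simp only
      rw [mul_left_comm, ← Complex.exp_add]
      congr 2
      push_cast
      ring
    rw [h1, norm_mul, Complex.norm_exp_ofReal_mul_I, one_mul]
  · refine tendsto_rpow_mul_integral_exp_neg_div (M := M) (fun ξ => ?_) hd fun ξ => ?_
    · rw [norm_modulated]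
      exact hM _
    · linarith

end OscInt

/-! ### Dispersive decay in dimensions one and two. -/

section LowDimension

/-- On a line `v u + w` with `u ⊥ w`, `|vu + w|² = v² + |w|²`, so the phase is `τ(v⁴ + b v²)` plus
an affine function of `v`, with `b = 2|w|² + ε ≥ 0`. It is convex in `v`, and the amplitude bounds
do not depend on the line. -/
theorem exists_norm_slice_integral_le {V : Type*} [NormedAddCommGroup V] [InnerProductSpace ℝ V]
    {χ : V → ℝ} (hχ : ContDiff ℝ ∞ χ) (hχc : HasCompactSupport χ) :
    ∃ A R : ℝ, 0 ≤ A ∧ 0 < R ∧ (∀ ξ, R ≤ ‖ξ‖ → χ ξ = 0) ∧ ∀ (c x u w : V), ‖u‖ = 1 →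
      inner ℝ u w = 0 →
      ∀ ε τ : ℝ, 0 ≤ ε → 0 < τ →
        ‖∫ v : ℝ, (χ (v • u + w - c) : ℂ) * Complex.exp (((2 * Real.pi * inner ℝ (v • u + w) x +
            τ * (‖v • u + w‖ ^ 4 + ε * ‖v • u + w‖ ^ 2) : ℝ) : ℂ) * Complex.I)‖ ≤ 2 * R * A ∧
        ∀ δ l μ : ℝ, 0 ≤ δ → 0 < l → 0 < μ →
        (∀ v : ℝ, δ ≤ |v| → l ≤ τ * (12 * v ^ 2 + 2 * (2 * ‖w‖ ^ 2 + ε))) →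
        ‖∫ v : ℝ, (χ (v • u + w - c) : ℂ) * Complex.exp (((2 * Real.pi * inner ℝ (v • u + w) x +
            τ * (‖v • u + w‖ ^ 4 + ε * ‖v • u + w‖ ^ 2) : ℝ) : ℂ) * Complex.I)‖ ≤
          A * (R / √μ + Real.pi / √μ + (2 * δ + Real.pi * √μ / l)) := by
  obtain ⟨A₁, hA₁⟩ := hχ.continuous.bounded_above_of_compact_support hχc
  have hcf : Continuous (fderiv ℝ χ) := hχ.continuous_fderiv (by simp)
  obtain ⟨A₂, hA₂⟩ := hcf.bounded_above_of_compact_support (hχc.fderiv (𝕜 := ℝ))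
  obtain ⟨R, hR0, hR⟩ := hχc.exists_pos_le_norm
  have hA₁0 : 0 ≤ A₁ := (norm_nonneg _).trans (hA₁ 0)
  refine ⟨max A₁ A₂, R, le_max_of_le_left hA₁0, hR0, hR, ?_⟩
  intro c x u w hu huw ε τ hε hτ
  set a : ℝ → ℝ := fun v => χ (v • u + w - c) with ha
  set a' : ℝ → ℝ := fun v => fderiv ℝ χ (v • u + w - c) u with ha'
  have had : ∀ v, HasDerivAt a (a' v) v := by
    intro v
    have h1 : HasDerivAt (fun v : ℝ => v • u + w - c) u v := by
      simpa using (((hasDerivAt_id v).smul_const u).add_const w).sub_const c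
    exact ((hχ.differentiable (by simp)) _).hasFDerivAt.comp_hasDerivAt v h1
  have hac' : Continuous a' := by
    simp only [ha']
    exact (hcf.comp (by fun_prop : Continuous fun v : ℝ => v • u + w - c)).clm_apply
      continuous_const
  have haA : ∀ v, |a v| ≤ max A₁ A₂ := fun v => (hA₁ _).trans (le_max_left _ _)
  have haA' : ∀ v, |a' v| ≤ max A₁ A₂ := by
    intro v
    have h1 := (fderiv ℝ χ (v • u + w - c)).le_opNorm u
    rw [hu, mul_one] at h1
    exact h1.trans ((hA₂ _).trans (le_max_right _ _))
  have huu : inner ℝ u u = (1 : ℝ) := by rw [real_inner_self_eq_norm_sq, hu]; norm_num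
  have hsupp : ∀ v, R ≤ |v - inner ℝ u c| → a v = 0 := by
    intro v hv
    refine hR _ (hv.trans ?_)
    have h1 := abs_real_inner_le_norm u (v • u + w - c)
    rw [hu, one_mul, inner_sub_right, inner_add_right, inner_smul_right, huu, huw] at h1
    simpa using h1
  have hnorm : ∀ v : ℝ, ‖v • u + w‖ ^ 2 = v ^ 2 + ‖w‖ ^ 2 := by
    intro v
    rw [norm_add_sq_real, inner_smul_left, huw, norm_smul, hu, Real.norm_eq_abs, mul_one, sq_abs]
    simp
  have hphase : ∀ v : ℝ, 2 * Real.pi * inner ℝ (v • u + w) x +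
      τ * (‖v • u + w‖ ^ 4 + ε * ‖v • u + w‖ ^ 2) =
      (2 * Real.pi * inner ℝ u x) * v + τ * (v ^ 4 + (2 * ‖w‖ ^ 2 + ε) * v ^ 2) +
        (2 * Real.pi * inner ℝ w x + τ * (‖w‖ ^ 4 + ε * ‖w‖ ^ 2)) := by
    intro v
    rw [show ‖v • u + w‖ ^ 4 = (‖v • u + w‖ ^ 2) ^ 2 by ring, hnorm, inner_add_left,
      inner_smul_left]
    simp only [conj_trivial]
    ring
  simp only [hphase]
  refine ⟨?_, fun δ l μ hδ hl hμ hδl => ?_⟩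
  · set m : ℝ := inner ℝ u c with hm
    have hind : Integrable ((Set.Icc (m - R) (m + R)).indicator fun _ => max A₁ A₂) :=
      (integrable_indicator_iff measurableSet_Icc).2 (by simp)
    refine (norm_integral_le_of_norm_le hind (Filter.Eventually.of_forall fun v => ?_)).trans ?_
    · rw [norm_mul, Complex.norm_exp_ofReal_mul_I, mul_one, Complex.norm_real]
      by_cases hv : v ∈ Set.Icc (m - R) (m + R)
      · rw [Set.indicator_of_mem hv]
        exact haA v
      · rw [Set.indicator_of_notMem hv]
        have h1 : a v = 0 := by
          refine hsupp v ?_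
          by_contra hcon
          rw [not_le, abs_lt] at hcon
          exact hv ⟨by linarith, by linarith⟩
        rw [show χ (v • u + w - c) = 0 from h1, norm_zero]
    · rw [integral_indicator measurableSet_Icc]
      simp only [integral_const, MeasurableSet.univ, measureReal_restrict_apply,
        Set.univ_inter, Real.volume_real_Icc, smul_eq_mul]
      rw [max_eq_left (by linarith)]
      exact le_of_eq (by ring)
  · exact norm_integral_quartic_le had hac' haA haA' hR0.le hsupp hτ (by positivity) _ _ hδ hl hδl hμ

theorem exists_norm_oscInt_le_one {χ : Eucl 1 → ℝ} (hχ : ContDiff ℝ ∞ χ)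
    (hχc : HasCompactSupport χ) :
    ∃ C : ℝ, ∀ (c x : Eucl 1), ∀ ε ∈ Set.Ici (0 : ℝ), ∀ τ, τ ≠ 0 →
      ‖oscInt χ c x ε τ‖ ≤ C * |τ| ^ (-(1 / 4) : ℝ) := by
  obtain ⟨A, R, hA, hR, -, h⟩ := exists_norm_slice_integral_le hχ hχc
  refine ⟨A * (R + Real.pi + (2 + Real.pi / 12)), norm_oscInt_le_of_pos ?_⟩
  intro c x ε hε τ hτ
  set u : Eucl 1 := EuclideanSpace.single 0 1 with hu
  have hmp : MeasurePreserving
      ((MeasurableEquiv.funUnique (Fin 1) ℝ).symm.trans (MeasurableEquiv.toLp 2 (Fin 1 → ℝ))) :=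
    ((volume_preserving_funUnique (Fin 1) ℝ).symm).trans (PiLp.volume_preserving_toLp (Fin 1))
  have hval : ∀ v : ℝ, ((MeasurableEquiv.funUnique (Fin 1) ℝ).symm.trans
      (MeasurableEquiv.toLp 2 (Fin 1 → ℝ))) v = v • u + 0 := by
    intro v
    ext j
    fin_cases j
    simp [hu]
  unfold oscInt
  rw [← hmp.integral_comp']
  simp only [hval]
  have hs : 0 < τ ^ (1 / 4 : ℝ) := by positivity
  have h4 : (τ ^ (1 / 4 : ℝ)) ^ 4 = τ := by
    rw [← Real.rpow_natCast, ← Real.rpow_mul hτ.le]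
    norm_num
  set ρ := τ ^ (1 / 4 : ℝ) with hρ
  -- With `ρ = τ^{1/4}`, the second derivative of the phase is at least `12ρ²` once `|v| ≥ 1/ρ`. The
  -- parameters `δ = 1/ρ`, `l = 12ρ²`, `μ = ρ²` make every term a multiple of `1/ρ`.
  have h1 := (h c x u 0 (by simp [hu]) (by simp) ε τ hε hτ).2 (1 / ρ) (12 * ρ ^ 2) (ρ ^ 2)
    (by positivity) (by positivity) (by positivity) ?_
  · refine h1.trans (le_of_eq ?_)
    rw [Real.sqrt_sq hs.le, Real.rpow_neg hτ.le, ← hρ]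
    field_simp
  · intro v hv
    have h2 : 1 / ρ ^ 2 ≤ v ^ 2 := by
      rw [← sq_abs v, ← one_div_pow]
      exact pow_le_pow_left₀ (by positivity) hv 2
    have h3 : τ * (1 / ρ ^ 2) = ρ ^ 2 := by
      rw [← h4]
      field_simp
    have hε0 : 0 ≤ ε := hε
    have h5 : τ * (1 / ρ ^ 2) ≤ τ * v ^ 2 := by gcongr
    have h6 : 0 ≤ τ * ε := by positivity
    simp only [norm_zero]
    nlinarith

theorem integrableOn_abs_rpow {r : ℝ} (hr : -1 < r) :
    IntegrableOn (fun w : ℝ => |w| ^ r) (Set.Icc (-1) 1) := by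
  have h1 : IntervalIntegrable (fun w : ℝ => |w| ^ r) volume 0 1 := by
    refine (intervalIntegral.intervalIntegrable_rpow' hr).congr fun w hw => ?_
    rw [Set.uIoc_of_le zero_le_one] at hw
    rw [abs_of_pos hw.1]
  have h2 : IntervalIntegrable (fun w : ℝ => |w| ^ r) volume (-1) 0 := by
    have := (IntervalIntegrable.iff_comp_neg (f := fun w : ℝ => |w| ^ r) (a := 0) (b := 1)).1 h1
    simpa using this.symm
  exact (intervalIntegrable_iff_integrableOn_Icc_of_le (by norm_num)).1 (h2.trans h1)

/-- On the line at height `w` the second derivative of the phase is at least `4τw²`, so the slice is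
`O((τw²)^{-1/2})`. Together with the trivial bound this gives `O((τw²)^{-α})`, and `|w|^{-2α}` is
locally integrable precisely because `α < 1/2`. -/
theorem exists_norm_oscInt_le_two {χ : Eucl 2 → ℝ} (hχ : ContDiff ℝ ∞ χ)
    (hχc : HasCompactSupport χ) {α : ℝ} (hα0 : 0 ≤ α) (hα : α < 1 / 2) :
    ∃ C : ℝ, ∀ (c x : Eucl 2), ∀ ε ∈ Set.Ici (0 : ℝ), ∀ τ, τ ≠ 0 →
      ‖oscInt χ c x ε τ‖ ≤ C * |τ| ^ (-α) := by
  obtain ⟨A, R, hA, hR, hsupp, h⟩ := exists_norm_slice_integral_le hχ hχc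
  set C₁ := A * (2 * R + 2 * Real.pi) with hC₁
  have hC₁0 : 0 ≤ C₁ := by positivity
  set I₁ := ∫ w in Set.Icc (-1 : ℝ) 1, |w| ^ (-(2 * α)) with hI₁
  have hI₁i := integrableOn_abs_rpow (r := -(2 * α)) (by linarith)
  refine ⟨C₁ * (I₁ + 2 * R), norm_oscInt_le_of_pos ?_⟩
  intro c x ε hε τ hτ
  set u : Eucl 2 := EuclideanSpace.single 0 1 with hu
  set u' : Eucl 2 := EuclideanSpace.single 1 1 with hu'
  have hmp : MeasurePreserving
      ((MeasurableEquiv.finTwoArrow (α := ℝ)).symm.trans (MeasurableEquiv.toLp 2 (Fin 2 → ℝ))) :=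
    ((volume_preserving_finTwoArrow ℝ).symm).trans (PiLp.volume_preserving_toLp (Fin 2))
  have hval : ∀ p : ℝ × ℝ, ((MeasurableEquiv.finTwoArrow (α := ℝ)).symm.trans
      (MeasurableEquiv.toLp 2 (Fin 2 → ℝ))) p = p.1 • u + p.2 • u' := by
    intro p
    ext j
    fin_cases j <;> simp [hu, hu', MeasurableEquiv.finTwoArrow, MeasurableEquiv.piFinTwo]
  have hint0 : Integrable (fun ξ : Eucl 2 => (χ (ξ - c) : ℂ) * Complex.exp
      (((2 * Real.pi * inner ℝ ξ x + τ * (‖ξ‖ ^ 4 + ε * ‖ξ‖ ^ 2) : ℝ) : ℂ) * Complex.I)) := by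
    have hχi : Integrable χ := hχ.continuous.integrable_of_hasCompactSupport hχc
    have hχcont := hχ.continuous
    refine (hχi.comp_sub_right c).mono (Continuous.aestronglyMeasurable (by fun_prop))
      (Filter.Eventually.of_forall fun ξ => ?_)
    rw [norm_mul, Complex.norm_exp_ofReal_mul_I, mul_one, Complex.norm_real]
  have hint := (hmp.integrable_comp_emb (MeasurableEquiv.measurableEmbedding _)).2 hint0
  unfold oscInt
  rw [← hmp.integral_comp']
  simp only [Function.comp_def, hval] at hint ⊢
  rw [Measure.volume_eq_prod] at hint ⊢
  rw [integral_prod_symm _ hint]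
  set m : ℝ := inner ℝ u' c with hm
  have hnu' : ‖u'‖ = 1 := by simp [hu']
  have huu'0 : inner ℝ u u' = (0 : ℝ) := by
    rw [hu, hu', EuclideanSpace.inner_single_left]
    simp
  have huu' : ∀ w : ℝ, inner ℝ u (w • u') = (0 : ℝ) := by
    intro w
    rw [inner_smul_right, huu'0, mul_zero]
  -- Dominates `|w|^{-2α}` on the interval of relevant heights, with an integral independent of the
  -- position `m` of that interval.
  set S : ℝ → ℝ := fun w => (Set.Icc (-1 : ℝ) 1).indicator (fun w => |w| ^ (-(2 * α))) w +
    (Set.Icc (m - R) (m + R)).indicator (fun _ => (1 : ℝ)) w with hS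
  have hSi1 : Integrable ((Set.Icc (-1 : ℝ) 1).indicator (fun w => |w| ^ (-(2 * α)))) :=
    (integrable_indicator_iff measurableSet_Icc).2 hI₁i
  have hSi2 : Integrable ((Set.Icc (m - R) (m + R)).indicator (fun _ => (1 : ℝ))) :=
    (integrable_indicator_iff measurableSet_Icc).2 (by simp)
  have hSint : ∫ w, S w = I₁ + 2 * R := by
    simp only [hS]
    rw [integral_add hSi1 hSi2, integral_indicator measurableSet_Icc,
      integral_indicator measurableSet_Icc]
    simp only [integral_const, MeasurableSet.univ, measureReal_restrict_apply,
        Set.univ_inter, Real.volume_real_Icc, smul_eq_mul, mul_one]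
    rw [max_eq_left (by linarith)]
    ring
  refine (norm_integral_le_of_norm_le ((hSi1.add hSi2).const_mul (C₁ * τ ^ (-α))) ?_).trans
    (le_of_eq ?_)
  swap
  · rw [integral_const_mul]
    rw [show (∫ a, ((Set.Icc (-1 : ℝ) 1).indicator (fun w => |w| ^ (-(2 * α))) +
      (Set.Icc (m - R) (m + R)).indicator (fun _ => (1 : ℝ))) a) = ∫ w, S w from rfl, hSint]
    ring
  have hne : ∀ᵐ w : ℝ, w ≠ 0 := by
    simp [ae_iff]
  filter_upwards [hne] with w hw
  change _ ≤ C₁ * τ ^ (-α) * S w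
  have hS1 : 0 ≤ (Set.Icc (-1 : ℝ) 1).indicator (fun w => |w| ^ (-(2 * α))) w :=
    Set.indicator_nonneg (fun _ _ => by positivity) w
  have hS2 : 0 ≤ (Set.Icc (m - R) (m + R)).indicator (fun _ => (1 : ℝ)) w :=
    Set.indicator_nonneg (fun _ _ => zero_le_one) w
  by_cases hwm : w ∈ Set.Icc (m - R) (m + R)
  · have hw0 : 0 < |w| := abs_pos.2 hw
    have hSw : |w| ^ (-(2 * α)) ≤ S w := by
      simp only [hS] at hS2 ⊢
      by_cases hw1 : w ∈ Set.Icc (-1 : ℝ) 1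
      · rw [Set.indicator_of_mem hw1]
        linarith
      · rw [Set.indicator_of_mem hwm]
        have h1 : 1 ≤ |w| := by
          by_contra hcon
          exact hw1 (abs_le.mp (not_le.mp hcon).le)
        have h2 : |w| ^ (-(2 * α)) ≤ 1 := Real.rpow_le_one_of_one_le_of_nonpos h1 (by linarith)
        linarith
    obtain ⟨hb1, hb2⟩ := h c x u (w • u') (by simp [hu]) (huu' w) ε τ hε hτ
    have hε0 : 0 ≤ ε := hε
    have hyw : (τ * w ^ 2) ^ (-α) = τ ^ (-α) * |w| ^ (-(2 * α)) := by
      rw [Real.mul_rpow hτ.le (by positivity), ← sq_abs, ← Real.rpow_two, ← Real.rpow_mul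
        (abs_nonneg w)]
      congr 2
      ring
    have hkey : ‖∫ v : ℝ, (χ (v • u + w • u' - c) : ℂ) * Complex.exp
        (((2 * Real.pi * inner ℝ (v • u + w • u') x +
            τ * (‖v • u + w • u'‖ ^ 4 + ε * ‖v • u + w • u'‖ ^ 2) : ℝ) : ℂ) * Complex.I)‖ ≤
        C₁ * (τ * w ^ 2) ^ (-α) := by
      have hy : 0 < τ * w ^ 2 := by positivity
      rcases le_total (τ * w ^ 2) 1 with hy1 | hy1
      · have h1 : 1 ≤ (τ * w ^ 2) ^ (-α) :=
          Real.one_le_rpow_of_pos_of_le_one_of_nonpos hy hy1 (by linarith)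
        have h2 : 2 * R * A ≤ C₁ := by
          rw [hC₁]
          nlinarith [Real.pi_pos, mul_nonneg hA Real.pi_pos.le]
        nlinarith
      · have hμ : 0 < 4 * (τ * w ^ 2) := by positivity
        -- The lower bound `4τw²` holds for all `v`, so `δ = 0` is allowed; `μ = l` makes all terms
        -- multiples of `μ^{-1/2}`.
        refine (hb2 0 (4 * (τ * w ^ 2)) (4 * (τ * w ^ 2)) le_rfl hμ hμ ?_).trans ?_
        · intro v _
          rw [norm_smul, hnu', mul_one, Real.norm_eq_abs, sq_abs]
          have : 0 ≤ τ * (12 * v ^ 2 + 2 * ε) := by positivity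
          nlinarith
        · have hs : 0 < √(4 * (τ * w ^ 2)) := Real.sqrt_pos.2 hμ
          have hss := Real.sq_sqrt hμ.le
          have h1 : A * (R / √(4 * (τ * w ^ 2)) + Real.pi / √(4 * (τ * w ^ 2)) +
              (2 * 0 + Real.pi * √(4 * (τ * w ^ 2)) / (4 * (τ * w ^ 2)))) =
              A * (R + 2 * Real.pi) * (1 / √(4 * (τ * w ^ 2))) := by
            have h2 : Real.pi * √(4 * (τ * w ^ 2)) / (4 * (τ * w ^ 2)) =
                Real.pi / √(4 * (τ * w ^ 2)) := by
              rw [div_eq_div_iff hμ.ne' hs.ne', mul_assoc, Real.mul_self_sqrt hμ.le]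
            rw [h2]
            ring
          rw [h1]
          have h3 : 1 / √(4 * (τ * w ^ 2)) ≤ (τ * w ^ 2) ^ (-α) := by
            calc 1 / √(4 * (τ * w ^ 2)) ≤ 1 / √(τ * w ^ 2) := by
                  have : 0 < √(τ * w ^ 2) := Real.sqrt_pos.2 hy
                  exact one_div_le_one_div_of_le this (Real.sqrt_le_sqrt (by linarith))
              _ = (τ * w ^ 2) ^ (-(1 / 2) : ℝ) := by
                  rw [Real.rpow_neg hy.le, ← Real.sqrt_eq_rpow, one_div]
              _ ≤ _ := Real.rpow_le_rpow_of_exponent_le hy1 (by linarith)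
          have h4 : A * (R + 2 * Real.pi) ≤ C₁ := by
            rw [hC₁]
            gcongr
            linarith
          have := Real.pi_pos
          gcongr
    refine hkey.trans ?_
    rw [hyw, ← mul_assoc]
    exact mul_le_mul_of_nonneg_left hSw (by positivity)
  · have hz : ∀ v : ℝ, χ (v • u + w • u' - c) = 0 := by
      intro v
      refine hsupp _ ?_
      have h1 := abs_real_inner_le_norm u' (v • u + w • u' - c)
      have h2 : inner ℝ u' (v • u + w • u' - c) = w - m := by
        rw [inner_sub_right, inner_add_right, inner_smul_right, inner_smul_right,
          real_inner_self_eq_norm_sq, hnu']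
        rw [real_inner_comm, huu'0]
        ring
      rw [hnu', one_mul, h2] at h1
      refine le_trans ?_ h1
      by_contra hcon
      rw [not_le, abs_lt] at hcon
      exact hwm ⟨by linarith, by linarith⟩
    simp only [hz, Complex.ofReal_zero, zero_mul, integral_zero, norm_zero]
    simp only [hS]
    positivity

end LowDimension

/-! ### Nonstationary phase, and the decay of the kernel in space. -/

section Nonstationary

variable {V : Type*} [NormedAddCommGroup V] [InnerProductSpace ℝ V] [FiniteDimensional ℝ V]

/-- Scaling by `N` reduces to a fixed ball and yields `N^{p-i}`, which is at most `N^{p-1}` as `N ≥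
1` and `i ≥ 1`. -/
theorem exists_norm_iteratedFDeriv_le_of_homogeneous {Q : V → ℝ} (hQ : ContDiff ℝ ∞ Q) {p : ℕ}
    (hp : 1 ≤ p) (hhom : ∀ (s : ℝ) v, Q (s • v) = s ^ p * Q v) (ρ : ℝ) (i : ℕ) (hi : 1 ≤ i) :
    ∃ C : ℝ, 0 ≤ C ∧ ∀ N : ℝ, 1 ≤ N → ∀ ξ : V, ‖ξ‖ ≤ ρ * N →
      ‖iteratedFDeriv ℝ i Q ξ‖ ≤ C * N ^ (p - 1) := by
  have hcont : Continuous (iteratedFDeriv ℝ i Q) := hQ.continuous_iteratedFDeriv (by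
    exact_mod_cast le_top)
  obtain ⟨C, hC⟩ := (isCompact_closedBall (0 : V) ρ).exists_bound_of_continuousOn hcont.continuousOn
  refine ⟨max C 0, le_max_right _ _, fun N hN ξ hξ => ?_⟩
  have hN0 : 0 < N := by linarith
  have h1 := iteratedFDeriv_comp_const_smul (𝕜 := ℝ) (i := i) (f := Q) N
    (hQ.of_le (by exact_mod_cast le_top))
  have h2 : (fun z => Q (N • z)) = fun z => N ^ p • Q z := by
    ext z
    rw [hhom, smul_eq_mul]
  rw [h2] at h1
  have h3 := congrFun h1 (N⁻¹ • ξ)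
  rw [iteratedFDeriv_const_smul_apply' (hQ.contDiffAt.of_le (by exact_mod_cast le_top)),
    smul_inv_smul₀ hN0.ne'] at h3
  have h4 := congrArg norm h3
  rw [norm_smul, norm_smul, Real.norm_of_nonneg (by positivity),
    Real.norm_of_nonneg (by positivity)] at h4
  have h5 : ‖iteratedFDeriv ℝ i Q (N⁻¹ • ξ)‖ ≤ max C 0 := by
    refine (hC _ ?_).trans (le_max_left _ _)
    rw [mem_closedBall_zero_iff, norm_smul, norm_inv, Real.norm_of_nonneg hN0.le,
      inv_mul_le_iff₀ hN0]
    linarith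
  have h6 : N * ‖iteratedFDeriv ℝ i Q ξ‖ ≤ N * (max C 0 * N ^ (p - 1)) := by
    calc N * ‖iteratedFDeriv ℝ i Q ξ‖ ≤ N ^ i * ‖iteratedFDeriv ℝ i Q ξ‖ := by
          gcongr
          exact le_self_pow₀ hN (by omega)
      _ = N ^ p * ‖iteratedFDeriv ℝ i Q (N⁻¹ • ξ)‖ := h4.symm
      _ ≤ N ^ p * max C 0 := by gcongr
      _ = N * (max C 0 * N ^ (p - 1)) := by
          obtain ⟨k, rfl⟩ : ∃ k, p = k + 1 := ⟨p - 1, by omega⟩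
          rw [Nat.add_sub_cancel, pow_succ]
          ring
  exact le_of_mul_le_mul_left h6 hN0

theorem norm_iteratedFDeriv_cexp_mul_I_le (i : ℕ) (y : ℝ) :
    ‖iteratedFDeriv ℝ i (fun y : ℝ => Complex.exp ((y : ℂ) * Complex.I)) y‖ ≤ 1 := by
  rw [norm_iteratedFDeriv_eq_norm_iteratedDeriv]
  have h : iteratedDeriv i (fun y : ℝ => Complex.exp ((y : ℂ) * Complex.I)) =
      fun y : ℝ => Complex.I ^ i * Complex.exp ((y : ℂ) * Complex.I) := by
    induction i with
    | zero => simp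
    | succ i ih =>
      rw [iteratedDeriv_succ, ih]
      ext y
      have h1 : HasDerivAt (fun y : ℝ => Complex.exp ((y : ℂ) * Complex.I))
          (Complex.exp ((y : ℂ) * Complex.I) * (1 * Complex.I)) y := by
        simpa using (((hasDerivAt_id y).ofReal_comp).mul_const Complex.I).cexp
      rw [(h1.const_mul (Complex.I ^ i)).deriv, pow_succ]
      ring
  rw [h]
  simp [Complex.norm_exp_ofReal_mul_I]

omit [FiniteDimensional ℝ V] in
theorem contDiff_quarticSymbol (τ ε : ℝ) :
    ContDiff ℝ ∞ fun ξ : V => τ * (‖ξ‖ ^ 4 + ε * ‖ξ‖ ^ 2) := by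
  have h2 : ContDiff ℝ ∞ fun ξ : V => ‖ξ‖ ^ 2 := contDiff_norm_sq ℝ
  have h4 : ContDiff ℝ ∞ fun ξ : V => ‖ξ‖ ^ 4 := by
    have e : (fun ξ : V => ‖ξ‖ ^ 4) = fun ξ => (‖ξ‖ ^ 2) ^ 2 := by
      ext ξ
      rw [← pow_mul]
    rw [e]
    exact h2.pow 2
  exact contDiff_const.mul (h4.add (contDiff_const.mul h2))

/-- All derivatives are `O(|τ|N³)`. The added `1` and the `i`-th power give the geometric form
required by the bound for iterated derivatives of a composition. -/
theorem exists_norm_iteratedFDeriv_quarticSymbol_le (ρ : ℝ) (m : ℕ) :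
    ∃ C : ℝ, 1 ≤ C ∧ ∀ N : ℝ, 1 ≤ N → ∀ ε ∈ Set.Icc (0 : ℝ) 1, ∀ τ : ℝ, ∀ ξ : V,
      ‖ξ‖ ≤ ρ * N → ∀ i, 1 ≤ i → i ≤ m →
        ‖iteratedFDeriv ℝ i (fun ξ : V => τ * (‖ξ‖ ^ 4 + ε * ‖ξ‖ ^ 2)) ξ‖ ≤
          (C * (1 + |τ| * N ^ 3)) ^ i := by
  have h2 : ContDiff ℝ ∞ fun ξ : V => ‖ξ‖ ^ 2 := contDiff_norm_sq ℝ
  have h4 : ContDiff ℝ ∞ fun ξ : V => ‖ξ‖ ^ 4 := by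
    have e : (fun ξ : V => ‖ξ‖ ^ 4) = fun ξ => (‖ξ‖ ^ 2) ^ 2 := by
      ext ξ
      rw [← pow_mul]
    rw [e]
    exact h2.pow 2
  have hex : ∀ i, ∃ C : ℝ, 0 ≤ C ∧ (1 ≤ i → ∀ N : ℝ, 1 ≤ N → ∀ ξ : V, ‖ξ‖ ≤ ρ * N →
      ‖iteratedFDeriv ℝ i (fun ξ : V => ‖ξ‖ ^ 4) ξ‖ ≤ C * N ^ 3 ∧
      ‖iteratedFDeriv ℝ i (fun ξ : V => ‖ξ‖ ^ 2) ξ‖ ≤ C * N ^ 3) := by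
    intro i
    by_cases hi : 1 ≤ i
    · obtain ⟨C₄, hC₄, hb₄⟩ := exists_norm_iteratedFDeriv_le_of_homogeneous h4 (p := 4)
        (by norm_num) (fun s v => by
          rw [norm_smul, mul_pow, Real.norm_eq_abs, (by decide : Even 4).pow_abs]) ρ i hi
      obtain ⟨C₂, hC₂, hb₂⟩ := exists_norm_iteratedFDeriv_le_of_homogeneous h2 (p := 2)
        (by norm_num) (fun s v => by rw [norm_smul, mul_pow, Real.norm_eq_abs, sq_abs]) ρ i hi
      refine ⟨C₄ + C₂, by positivity, fun _ N hN ξ hξ => ⟨?_, ?_⟩⟩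
      · refine (hb₄ N hN ξ hξ).trans ?_
        norm_num
        gcongr
        linarith
      · refine (hb₂ N hN ξ hξ).trans ?_
        have h3 : N ^ (2 - 1) ≤ N ^ 3 := pow_le_pow_right₀ hN (by norm_num)
        have h0 : 0 ≤ N ^ (2 - 1) := by positivity
        calc C₂ * N ^ (2 - 1) ≤ C₂ * N ^ 3 := by gcongr
          _ ≤ (C₄ + C₂) * N ^ 3 := by gcongr; linarith
    · exact ⟨0, le_rfl, fun h => absurd h hi⟩
  choose Ci hCi0 hCi using hex
  set C := 1 + 2 * ∑ i ∈ Finset.range (m + 1), Ci i with hC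
  have hsum0 : 0 ≤ ∑ i ∈ Finset.range (m + 1), Ci i := Finset.sum_nonneg fun i _ => hCi0 i
  refine ⟨C, by linarith, ?_⟩
  intro N hN ε hε τ ξ hξ i hi him
  have hCle : Ci i ≤ ∑ i ∈ Finset.range (m + 1), Ci i :=
    Finset.single_le_sum (f := Ci) (fun j _ => hCi0 j) (Finset.mem_range.2 (by omega))
  obtain ⟨hb4, hb2⟩ := hCi i hi N hN ξ hξ
  have hile : ((i : ℕ) : ℕ∞ω) ≤ (∞ : ℕ∞ω) := by exact_mod_cast le_top
  have heq : iteratedFDeriv ℝ i (fun ξ : V => τ * (‖ξ‖ ^ 4 + ε * ‖ξ‖ ^ 2)) ξ =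
      τ • (iteratedFDeriv ℝ i (fun ξ : V => ‖ξ‖ ^ 4) ξ +
        ε • iteratedFDeriv ℝ i (fun ξ : V => ‖ξ‖ ^ 2) ξ) := by
    have h2ε : ContDiff ℝ ∞ fun ξ : V => ε • ‖ξ‖ ^ 2 := h2.const_smul ε
    have h42 : ContDiff ℝ ∞ fun ξ : V => ‖ξ‖ ^ 4 + ε • ‖ξ‖ ^ 2 := h4.add h2ε
    have e1 : iteratedFDeriv ℝ i (fun ξ : V => τ • (‖ξ‖ ^ 4 + ε • ‖ξ‖ ^ 2)) ξ =
        τ • iteratedFDeriv ℝ i (fun ξ : V => ‖ξ‖ ^ 4 + ε • ‖ξ‖ ^ 2) ξ :=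
      iteratedFDeriv_const_smul_apply' (h42.contDiffAt.of_le hile)
    have e2 : iteratedFDeriv ℝ i (fun ξ : V => ‖ξ‖ ^ 4 + ε • ‖ξ‖ ^ 2) ξ =
        iteratedFDeriv ℝ i (fun ξ : V => ‖ξ‖ ^ 4) ξ +
          iteratedFDeriv ℝ i (fun ξ : V => ε • ‖ξ‖ ^ 2) ξ :=
      iteratedFDeriv_add_apply (h4.contDiffAt.of_le hile)
        (h2ε.contDiffAt.of_le hile)
    have e3 : iteratedFDeriv ℝ i (fun ξ : V => ε • ‖ξ‖ ^ 2) ξ =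
        ε • iteratedFDeriv ℝ i (fun ξ : V => ‖ξ‖ ^ 2) ξ :=
      iteratedFDeriv_const_smul_apply' (h2.contDiffAt.of_le hile)
    rw [← e3, ← e2, ← e1]
    rfl
  rw [heq, norm_smul, Real.norm_eq_abs]
  have hN3 : 0 ≤ N ^ 3 := by positivity
  have h5 : ‖iteratedFDeriv ℝ i (fun ξ : V => ‖ξ‖ ^ 4) ξ +
        ε • iteratedFDeriv ℝ i (fun ξ : V => ‖ξ‖ ^ 2) ξ‖ ≤ 2 * Ci i * N ^ 3 := by
    refine (norm_add_le _ _).trans ?_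
    rw [norm_smul, Real.norm_of_nonneg hε.1]
    have := mul_le_mul hε.2 hb2 (norm_nonneg _) zero_le_one
    linarith
  have h1C : 1 ≤ C * (1 + |τ| * N ^ 3) := by
    have h0 : 0 ≤ |τ| * N ^ 3 := by positivity
    nlinarith
  calc |τ| * ‖iteratedFDeriv ℝ i (fun ξ : V => ‖ξ‖ ^ 4) ξ +
        ε • iteratedFDeriv ℝ i (fun ξ : V => ‖ξ‖ ^ 2) ξ‖ ≤ |τ| * (2 * Ci i * N ^ 3) := by gcongr
    _ = 2 * Ci i * (|τ| * N ^ 3) := by ring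
    _ ≤ C * (1 + |τ| * N ^ 3) := by
        have h0 : 0 ≤ |τ| * N ^ 3 := by positivity
        refine mul_le_mul ?_ ?_ h0 (by linarith) <;> linarith
    _ ≤ _ := le_self_pow₀ h1C (by omega)

/-- `χ (ξ - c) e^{iτ(|ξ|⁴ + ε|ξ|²)}`. -/
noncomputable def evolved (χ : V → ℝ) (c : V) (ε τ : ℝ) (ξ : V) : ℂ :=
  (χ (ξ - c) : ℂ) * Complex.exp (((τ * (‖ξ‖ ^ 4 + ε * ‖ξ‖ ^ 2) : ℝ) : ℂ) * Complex.I)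

omit [FiniteDimensional ℝ V] in
theorem contDiff_evolved {χ : V → ℝ} (hχ : ContDiff ℝ ∞ χ) (c : V) (ε τ : ℝ) :
    ContDiff ℝ ∞ (evolved χ c ε τ) := by
  have h1 := contDiff_quarticSymbol (V := V) τ ε
  unfold evolved
  exact (Complex.ofRealCLM.contDiff.comp (hχ.comp (contDiff_id.sub contDiff_const))).mul
    ((Complex.ofRealCLM.contDiff.comp h1).mul contDiff_const).cexp

/-- Leibniz for the product and the chain rule for the exponential: each derivative costs at most a
factor `O(1 + |τ|N³)`. The indicator makes the bound integrable uniformly in `c`. -/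
theorem exists_norm_iteratedFDeriv_evolved_le {χ : V → ℝ} (hχ : ContDiff ℝ ∞ χ)
    (hχc : HasCompactSupport χ) (m : ℕ) :
    ∃ C : ℝ, 0 ≤ C ∧ ∀ N : ℝ, 1 ≤ N → ∀ ε ∈ Set.Icc (0 : ℝ) 1, ∀ τ : ℝ, ∀ c : V, ‖c‖ ≤ N →
      ∀ j ≤ m, ∀ ξ : V, ‖iteratedFDeriv ℝ j (evolved χ c ε τ) ξ‖ ≤
        (tsupport χ).indicator (fun _ => C * (1 + |τ| * N ^ 3) ^ m) (ξ - c) := by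
  set χ' : V → ℂ := Complex.ofRealCLM ∘ χ with hχ'
  have hχ's : ContDiff ℝ ∞ χ' := Complex.ofRealCLM.contDiff.comp hχ
  have hχ'c : HasCompactSupport χ' := hχc.comp_left rfl
  have hts : tsupport χ' ⊆ tsupport χ := by
    refine closure_mono fun ξ hξ => ?_
    rw [Function.mem_support] at hξ ⊢
    intro h0
    exact hξ (by simp [hχ', h0])
  have hex : ∀ j, ∃ A : ℝ, 0 ≤ A ∧ ∀ ξ, ‖iteratedFDeriv ℝ j χ' ξ‖ ≤ A := by
    intro j
    obtain ⟨A, hA⟩ := (hχ's.continuous_iteratedFDeriv (m := j)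
      (by exact_mod_cast le_top)).bounded_above_of_compact_support (hχ'c.iteratedFDeriv j)
    exact ⟨A, (norm_nonneg _).trans (hA 0), hA⟩
  choose A hA0 hA using hex
  obtain ⟨R, hR⟩ := hχc.isBounded.exists_norm_le
  obtain ⟨B, hB1, hB⟩ := exists_norm_iteratedFDeriv_quarticSymbol_le (V := V) (max R 0 + 1) m
  set F : ℝ := ∑ j ∈ Finset.range (m + 1), ∑ i ∈ Finset.range (j + 1),
    (j.choose i : ℝ) * A i * (Nat.factorial (j - i) * B ^ m) with hF
  have hterm0 : ∀ j i, 0 ≤ (j.choose i : ℝ) * A i * (Nat.factorial (j - i) * B ^ m) := by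
    intro j i
    have := hA0 i
    positivity
  refine ⟨F, Finset.sum_nonneg fun j _ => Finset.sum_nonneg fun i _ => hterm0 j i, ?_⟩
  intro N hN ε hε τ c hc j hj ξ
  have hile : ∀ k : ℕ, ((k : ℕ) : ℕ∞ω) ≤ (∞ : ℕ∞ω) := fun k => by exact_mod_cast le_top
  set φ : V → ℝ := fun ξ => τ * (‖ξ‖ ^ 4 + ε * ‖ξ‖ ^ 2) with hφ
  set g : ℝ → ℂ := fun y => Complex.exp ((y : ℂ) * Complex.I) with hg
  have hgs : ContDiff ℝ ∞ g := (Complex.ofRealCLM.contDiff.mul contDiff_const).cexp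
  have hφs : ContDiff ℝ ∞ φ := contDiff_quarticSymbol τ ε
  have hmul := norm_iteratedFDeriv_mul_le (𝕜 := ℝ) (f := fun ξ => χ' (ξ - c)) (g := g ∘ φ)
    (hχ's.comp (contDiff_id.sub contDiff_const)) (hgs.comp hφs) ξ (n := j) (hile j)
  have hev : evolved χ c ε τ = fun ξ => χ' (ξ - c) * (g ∘ φ) ξ := rfl
  rw [hev]
  refine hmul.trans ?_
  have htr : ∀ i, iteratedFDeriv ℝ i (fun ξ => χ' (ξ - c)) ξ = iteratedFDeriv ℝ i χ' (ξ - c) :=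
    fun i => iteratedFDeriv_comp_sub i c ξ
  by_cases hmem : ξ - c ∈ tsupport χ
  · rw [Set.indicator_of_mem hmem]
    have hξ : ‖ξ‖ ≤ (max R 0 + 1) * N := by
      have h1 := hR _ hmem
      have h2 : ‖ξ‖ ≤ ‖ξ - c‖ + ‖c‖ := by
        calc ‖ξ‖ = ‖(ξ - c) + c‖ := by rw [sub_add_cancel]
          _ ≤ _ := norm_add_le _ _
      have h3 := le_max_left R 0
      have h4 := le_max_right R 0
      nlinarith
    set D := B * (1 + |τ| * N ^ 3) with hD
    have hD1 : 1 ≤ 1 + |τ| * N ^ 3 := by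
      have : 0 ≤ |τ| * N ^ 3 := by positivity
      linarith
    have hDD : 1 ≤ D := by nlinarith
    calc ∑ i ∈ Finset.range (j + 1), (j.choose i : ℝ) *
          ‖iteratedFDeriv ℝ i (fun ξ => χ' (ξ - c)) ξ‖ * ‖iteratedFDeriv ℝ (j - i) (g ∘ φ) ξ‖
        ≤ ∑ i ∈ Finset.range (j + 1), (j.choose i : ℝ) * A i *
          (Nat.factorial (j - i) * B ^ m) * (1 + |τ| * N ^ 3) ^ m := by
          refine Finset.sum_le_sum fun i _ => ?_
          have hcomp : ‖iteratedFDeriv ℝ (j - i) (g ∘ φ) ξ‖ ≤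
              Nat.factorial (j - i) * 1 * D ^ (j - i) := by
            refine norm_iteratedFDeriv_comp_le hgs hφs (hile _) ξ
              (fun k _ => norm_iteratedFDeriv_cexp_mul_I_le k _) fun k hk1 hk2 => ?_
            exact hB N hN ε hε τ ξ hξ k hk1 (by omega)
          have hDm : D ^ (j - i) ≤ B ^ m * (1 + |τ| * N ^ 3) ^ m := by
            rw [← mul_pow]
            exact pow_le_pow_right₀ hDD (by omega)
          rw [htr]
          have h5 : ‖iteratedFDeriv ℝ (j - i) (g ∘ φ) ξ‖ ≤
              Nat.factorial (j - i) * B ^ m * (1 + |τ| * N ^ 3) ^ m := by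
            refine hcomp.trans ?_
            rw [mul_one, mul_assoc]
            gcongr
          calc _ ≤ (j.choose i : ℝ) * A i *
                (Nat.factorial (j - i) * B ^ m * (1 + |τ| * N ^ 3) ^ m) := by
                have := hA0 i
                gcongr
                exact hA i _
            _ = _ := by ring
      _ = (∑ i ∈ Finset.range (j + 1), (j.choose i : ℝ) * A i *
          (Nat.factorial (j - i) * B ^ m)) * (1 + |τ| * N ^ 3) ^ m := by rw [Finset.sum_mul]
      _ ≤ F * (1 + |τ| * N ^ 3) ^ m := by
          gcongr
          exact Finset.single_le_sum (f := fun j => ∑ i ∈ Finset.range (j + 1),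
            (j.choose i : ℝ) * A i * (Nat.factorial (j - i) * B ^ m))
            (fun k _ => Finset.sum_nonneg fun i _ => hterm0 k i)
            (Finset.mem_range.2 (by omega))
  · rw [Set.indicator_of_notMem hmem]
    refine le_of_eq (Finset.sum_eq_zero fun i _ => ?_)
    have h0 : iteratedFDeriv ℝ i χ' (ξ - c) = 0 := by
      by_contra hne
      exact hmem (hts (support_iteratedFDeriv_subset i hne))
    rw [htr, h0, norm_zero]
    ring

variable [MeasurableSpace V] [BorelSpace V]

/-- The oscillatory integral is the Fourier transform at `-x` of the evolved amplitude, so powers of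
`‖x‖` are paid for by its derivatives. -/
theorem exists_norm_pow_mul_norm_oscInt_le {χ : V → ℝ} (hχ : ContDiff ℝ ∞ χ)
    (hχc : HasCompactSupport χ) (m : ℕ) :
    ∃ C : ℝ, 0 ≤ C ∧ ∀ N : ℝ, 1 ≤ N → ∀ ε ∈ Set.Icc (0 : ℝ) 1, ∀ τ : ℝ, ∀ c x : V, ‖c‖ ≤ N →
      ‖x‖ ^ m * ‖oscInt χ c x ε τ‖ ≤ C * (1 + |τ| * N ^ 3) ^ m := by
  obtain ⟨C, hC0, hC⟩ := exists_norm_iteratedFDeriv_evolved_le hχ hχc m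
  set v := (volume : Measure V).real (tsupport χ) with hv
  refine ⟨2 ^ m * ((m + 1) * (v * C)), by positivity, ?_⟩
  intro N hN ε hε τ c x hc
  have hosc : oscInt χ c x ε τ = 𝓕 (evolved χ c ε τ) (-x) := by
    rw [oscInt, Real.fourier_eq']
    refine integral_congr_ae (Filter.Eventually.of_forall fun ξ => ?_)
    simp only [evolved, smul_eq_mul]
    rw [mul_left_comm, ← Complex.exp_add, inner_neg_right]
    congr 2
    push_cast
    ring
  have hsm := contDiff_evolved hχ c ε τ
  have hcs : HasCompactSupport (evolved χ c ε τ) := by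
    have h1 : HasCompactSupport fun ξ => χ (ξ - c) :=
      hχc.comp_homeomorph (Homeomorph.subRight c)
    refine h1.mono fun ξ hξ => ?_
    rw [Function.mem_support] at hξ ⊢
    intro h0
    exact hξ (by simp [evolved, h0])
  have hint : ∀ (k n : ℕ), (k : ℕ∞) ≤ 0 → (n : ℕ∞) ≤ (⊤ : ℕ∞) →
      Integrable (fun v => ‖v‖ ^ k * ‖iteratedFDeriv ℝ n (evolved χ c ε τ) v‖) := by
    intro k n _ _
    have hc1 : Continuous (iteratedFDeriv ℝ n (evolved χ c ε τ)) :=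
      hsm.continuous_iteratedFDeriv (by exact_mod_cast le_top)
    refine Continuous.integrable_of_hasCompactSupport (by fun_prop) ?_
    exact ((hcs.iteratedFDeriv n).norm).mul_left
  have hmain := Real.pow_mul_norm_iteratedFDeriv_fourier_le (K := 0) (N := ⊤) hsm hint
    (k := 0) (n := m) le_rfl le_top (-x)
  rw [norm_iteratedFDeriv_zero, norm_neg, ← hosc] at hmain
  refine hmain.trans ?_
  have hj : ∀ j ≤ m, ∫ ξ, ‖iteratedFDeriv ℝ j (evolved χ c ε τ) ξ‖ ≤
      v * C * (1 + |τ| * N ^ 3) ^ m := by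
    intro j hjm
    have hms : MeasurableSet (tsupport χ) := (isClosed_tsupport χ).measurableSet
    have hvfin : volume (tsupport χ) ≠ ⊤ := hχc.measure_lt_top.ne
    have hi : Integrable ((tsupport χ).indicator fun _ : V => C * (1 + |τ| * N ^ 3) ^ m) :=
      (integrable_indicator_iff hms).2 (integrableOn_const hvfin)
    have h1 : ∫ ξ, ‖iteratedFDeriv ℝ j (evolved χ c ε τ) ξ‖ ≤
        ∫ ξ, (tsupport χ).indicator (fun _ => C * (1 + |τ| * N ^ 3) ^ m) (ξ - c) :=
      integral_mono_of_nonneg (Filter.Eventually.of_forall fun _ => norm_nonneg _)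
        (hi.comp_sub_right c) (Filter.Eventually.of_forall fun ξ => hC N hN ε hε τ c hc j hjm ξ)
    refine h1.trans (le_of_eq ?_)
    rw [integral_sub_right_eq_self (fun ξ => (tsupport χ).indicator
      (fun _ => C * (1 + |τ| * N ^ 3) ^ m) ξ) c, integral_indicator hms, setIntegral_const,
      smul_eq_mul, ← hv]
    ring
  simp only [pow_zero, one_mul, Nat.cast_zero, mul_zero, zero_add, Finset.range_one]
  rw [Finset.sum_product, Finset.sum_singleton]
  calc (2 : ℝ) ^ m * ∑ j ∈ Finset.range (m + 1),
        ∫ ξ, ‖ξ‖ ^ 0 * ‖iteratedFDeriv ℝ j (evolved χ c ε τ) ξ‖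
      ≤ (2 : ℝ) ^ m * ∑ _j ∈ Finset.range (m + 1), v * C * (1 + |τ| * N ^ 3) ^ m := by
        gcongr with j hjm
        simp only [pow_zero, one_mul]
        exact hj j (by have := Finset.mem_range.1 hjm; omega)
    _ = _ := by
        rw [Finset.sum_const, Finset.card_range, nsmul_eq_mul]
        push_cast
        ring

/-- For `Y = ‖x‖/N³ > 1` the two regimes are split at `|τ| = Y^γ` with `γ = β/α`. Above it
dispersion gives `Y^{-γα} = Y^{-β}`; below it nonstationary phase gives `O(Y^{-(1-γ)m})`, which
suffices for large `m` because `β < α` makes `γ < 1`. -/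
theorem exists_norm_oscInt_le_one_add_norm_rpow {χ : V → ℝ} (hχ : ContDiff ℝ ∞ χ)
    (hχc : HasCompactSupport χ) {α β C₁ : ℝ} (hβ : 0 ≤ β) (hβα : β < α)
    (hdisp : ∀ (c x : V), ∀ ε ∈ Set.Ici (0 : ℝ), ∀ τ, τ ≠ 0 →
      ‖oscInt χ c x ε τ‖ ≤ C₁ * |τ| ^ (-α)) :
    ∃ C : ℝ, 0 ≤ C ∧ ∀ N : ℝ, 1 ≤ N → ∀ ε ∈ Set.Icc (0 : ℝ) 1, ∀ τ : ℝ, ∀ c x : V, ‖c‖ ≤ N →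
      ‖oscInt χ c x ε τ‖ ≤ C * (1 + ‖x‖ / N ^ 3) ^ (-β) := by
  have hα : 0 < α := by linarith
  have hC₁ : 0 ≤ C₁ := by
    have := (norm_nonneg _).trans (hdisp 0 0 0 (by simp) 1 one_ne_zero)
    simpa using this
  set γ := β / α with hγ
  have hγ0 : 0 ≤ γ := by positivity
  have hγ1 : γ < 1 := (div_lt_one hα).2 hβα
  have hγα : γ * α = β := by rw [hγ]; field_simp
  obtain ⟨m, hm⟩ := exists_nat_ge (β / (1 - γ))
  have hm' : β ≤ (1 - γ) * m := by
    rw [div_le_iff₀ (by linarith)] at hm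
    linarith
  obtain ⟨C₂, hC₂, hosc⟩ := exists_norm_pow_mul_norm_oscInt_le hχ hχc m
  set C₀ := ∫ ξ, |χ ξ| with hC₀
  have hC₀0 : 0 ≤ C₀ := integral_nonneg fun _ => abs_nonneg _
  have hχi : Integrable χ := hχ.continuous.integrable_of_hasCompactSupport hχc
  refine ⟨(C₀ + C₁ + 2 ^ m * C₂) * 2 ^ β, by positivity, ?_⟩
  intro N hN ε hε τ c x hc
  have hN3 : 1 ≤ N ^ 3 := one_le_pow₀ hN
  set Y := ‖x‖ / N ^ 3 with hY
  have hY0 : 0 ≤ Y := by positivity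
  have hsuff : ∀ Z : ℝ, 1 ≤ Z → 1 + Y ≤ 2 * Z →
      Z ^ (-β) ≤ 2 ^ β * (1 + Y) ^ (-β) := by
    intro Z hZ hYZ
    have h1 : (2 * Z) ^ (-β) ≤ (1 + Y) ^ (-β) :=
      Real.rpow_le_rpow_of_nonpos (by linarith) hYZ (by linarith)
    have h2 : Z ^ (-β) = 2 ^ β * (2 * Z) ^ (-β) := by
      rw [Real.mul_rpow (by norm_num) (by linarith), ← mul_assoc, ← Real.rpow_add (by norm_num)]
      simp
    rw [h2]
    gcongr
  rcases le_or_gt Y 1 with hY1 | hY1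
  · have h1 := hsuff 1 le_rfl (by linarith)
    rw [Real.one_rpow] at h1
    calc ‖oscInt χ c x ε τ‖ ≤ C₀ := norm_oscInt_le χ hχi c x ε τ
      _ ≤ C₀ + C₁ + 2 ^ m * C₂ := by
          have : 0 ≤ 2 ^ m * C₂ := by positivity
          linarith
      _ ≤ (C₀ + C₁ + 2 ^ m * C₂) * (2 ^ β * (1 + Y) ^ (-β)) :=
          le_mul_of_one_le_right (by positivity) h1
      _ = _ := by ring
  · have h1 := hsuff Y hY1.le (by linarith)
    have hYpos : 0 < Y := by linarith
    suffices hs : ‖oscInt χ c x ε τ‖ ≤ (C₀ + C₁ + 2 ^ m * C₂) * Y ^ (-β) by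
      calc _ ≤ (C₀ + C₁ + 2 ^ m * C₂) * Y ^ (-β) := hs
        _ ≤ (C₀ + C₁ + 2 ^ m * C₂) * (2 ^ β * (1 + Y) ^ (-β)) := by gcongr
        _ = _ := by ring
    have hYg : 1 ≤ Y ^ γ := Real.one_le_rpow hY1.le hγ0
    rcases le_or_gt (Y ^ γ) |τ| with hτ | hτ
    · have hτ0 : τ ≠ 0 := fun h => by rw [h, abs_zero] at hτ; linarith
      calc ‖oscInt χ c x ε τ‖ ≤ C₁ * |τ| ^ (-α) := hdisp c x ε hε.1 τ hτ0
        _ ≤ C₁ * (Y ^ γ) ^ (-α) := by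
            gcongr ?_ * ?_
            exact Real.rpow_le_rpow_of_nonpos (by linarith) hτ (by linarith)
        _ = C₁ * Y ^ (-β) := by
            rw [← Real.rpow_mul hYpos.le, mul_neg, hγα]
        _ ≤ _ := by
            gcongr
            have : 0 ≤ 2 ^ m * C₂ := by positivity
            linarith
    · have h2 := hosc N hN ε hε τ c x hc
      have hx : ‖x‖ = Y * N ^ 3 := by rw [hY]; field_simp
      have h3 : (1 + |τ| * N ^ 3) ^ m ≤ (2 * Y ^ γ * N ^ 3) ^ m := by
        gcongr
        nlinarith
      have h4 : (Y * N ^ 3) ^ m * ‖oscInt χ c x ε τ‖ ≤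
          (Y * N ^ 3) ^ m * (2 ^ m * C₂ * (Y ^ γ / Y) ^ m) := by
        rw [← hx]
        refine h2.trans ?_
        calc C₂ * (1 + |τ| * N ^ 3) ^ m ≤ C₂ * (2 * Y ^ γ * N ^ 3) ^ m := by gcongr
          _ = _ := by
              have e : 2 * Y ^ γ * N ^ 3 = ‖x‖ * (2 * (Y ^ γ / Y)) := by
                rw [hx]
                have hYi : Y * Y⁻¹ = 1 := mul_inv_cancel₀ hYpos.ne'
                linear_combination (-2 * Y ^ γ * N ^ 3) * hYi
              rw [e, mul_pow, mul_pow]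
              ring
      have h5 := le_of_mul_le_mul_left h4 (by positivity)
      have h6 : (Y ^ γ / Y) ^ m ≤ Y ^ (-β) := by
        have : Y ^ γ / Y = Y ^ (γ - 1) := by rw [Real.rpow_sub hYpos, Real.rpow_one]
        rw [this, ← Real.rpow_natCast, ← Real.rpow_mul hYpos.le]
        refine Real.rpow_le_rpow_of_exponent_le hY1.le ?_
        linarith
      calc ‖oscInt χ c x ε τ‖ ≤ 2 ^ m * C₂ * (Y ^ γ / Y) ^ m := h5
        _ ≤ 2 ^ m * C₂ * Y ^ (-β) := by gcongr
        _ ≤ _ := by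
            gcongr
            linarith

end Nonstationary

/-! ### Dispersion in all dimensions, and integrals of the decay function. -/

theorem exists_norm_oscInt_le_rpow_of_lt {n : ℕ} (hn : 1 ≤ n) {χ : Eucl n → ℝ}
    (hχ : ContDiff ℝ ∞ χ) (hχc : HasCompactSupport χ) {b : ℝ} (hb0 : 0 ≤ b) (hb1 : b ≤ 1)
    (hbn : b < n / 4) :
    ∃ α C : ℝ, b < α ∧ ∀ (c x : Eucl n), ∀ ε ∈ Set.Ici (0 : ℝ), ∀ τ, τ ≠ 0 →
      ‖oscInt χ c x ε τ‖ ≤ C * |τ| ^ (-α) := by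
  obtain rfl | rfl | h3 : n = 1 ∨ n = 2 ∨ 3 ≤ n := by omega
  · obtain ⟨C, hC⟩ := exists_norm_oscInt_le_one hχ hχc
    exact ⟨1 / 4, C, by push_cast at hbn; linarith, hC⟩
  · push_cast at hbn
    obtain ⟨C, hC⟩ := exists_norm_oscInt_le_two hχ hχc (α := (b + 1 / 2) / 2)
      (by linarith) (by linarith)
    exact ⟨_, C, by linarith, hC⟩
  · have h3' : (3 : ℝ) ≤ n := by exact_mod_cast h3
    set m := min ((n : ℝ) / 4) (3 / 2) with hm
    -- Subordination requires `1/2 ≤ α ≤ 3/2` and `α < n/4`; the midpoint of `b'` and `m` satisfies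
    -- these and exceeds `b`.
    set b' := max b (1 / 2) with hb'
    have hbm : b' < m := by
      refine max_lt (lt_min hbn (by linarith)) (lt_min ?_ ?_) <;> linarith
    have h1 : b ≤ b' := le_max_left _ _
    have h2 : 1 / 2 ≤ b' := le_max_right _ _
    have h4 : m ≤ n / 4 := min_le_left _ _
    have h5 : m ≤ 3 / 2 := min_le_right _ _
    obtain ⟨C, hC⟩ := exists_norm_oscInt_le_of_two_lt_finrank hχ hχc
      (by rw [finrank_euclideanSpace_fin]; omega) (α := (b' + m) / 2) (by linarith) (by linarith)
      (by rw [finrank_euclideanSpace_fin]; linarith)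
    exact ⟨_, C, by linarith, hC⟩

theorem lintegral_comp_div (f : ℝ → ℝ≥0∞) (hf : Measurable f) {L : ℝ} (hL : 0 < L) :
    ∫⁻ s, f (s / L) = ENNReal.ofReal L * ∫⁻ s, f s := by
  have h := Real.map_volume_mul_left (a := L⁻¹) (inv_ne_zero hL.ne')
  rw [inv_inv, abs_of_pos hL] at h
  calc ∫⁻ s, f (s / L) = ∫⁻ s, f s ∂(Measure.map (fun x => L⁻¹ * x) volume) := by
        rw [lintegral_map hf (measurable_const_mul _)]
        simp_rw [div_eq_inv_mul]
    _ = _ := by rw [h, lintegral_smul_measure, smul_eq_mul]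

theorem lintegral_decay_rpow_lt_top (C : ℝ) {β r : ℝ} (hr : 0 ≤ r) (h : 1 < β * r) :
    ∫⁻ s : ℝ, ENNReal.ofReal (C * (1 + |s|) ^ (-β)) ^ r < ⊤ := by
  have h1 : ∀ s : ℝ, ENNReal.ofReal (C * (1 + |s|) ^ (-β)) ^ r =
      ENNReal.ofReal C ^ r * ENNReal.ofReal ((1 + ‖s‖) ^ (-(β * r))) := by
    intro s
    have h0 : 0 < 1 + |s| := by positivity
    rw [ENNReal.ofReal_mul' (by positivity), ENNReal.mul_rpow_of_nonneg _ _ hr,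
      ENNReal.ofReal_rpow_of_nonneg (x := (1 + |s|) ^ (-β)) (by positivity) hr, ← Real.rpow_mul h0.le, neg_mul,
      Real.norm_eq_abs]
  simp_rw [h1]
  rw [lintegral_const_mul _ (by fun_prop)]
  refine ENNReal.mul_lt_top (ENNReal.rpow_lt_top_of_nonneg hr ENNReal.ofReal_ne_top) ?_
  exact finite_integral_one_add_norm (by simpa using h)

/-! ### Frequency cutoffs, plane waves and coordinates. -/

section Cutoff

variable {n : ℕ}

theorem hasCompactSupport_comp_smul {m : Eucl n → ℝ} (hm : HasCompactSupport m) :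
    HasCompactSupport fun ξ : Eucl n => m ((2 * Real.pi) • ξ) :=
  hm.comp_homeomorph (Homeomorph.smulOfNeZero (2 * Real.pi) (by positivity))

theorem memLp_cutoff_mul {m : Eucl n → ℝ} (hm : Continuous m) (hmc : HasCompactSupport m)
    {f : Eucl n → ℂ} (hf : MemLp f 2) :
    MemLp (fun ξ : Eucl n => (m ((2 * Real.pi) • ξ) : ℂ) * f ξ) 2 volume := by
  have h1 : HasCompactSupport fun ξ : Eucl n => (m ((2 * Real.pi) • ξ) : ℂ) :=
    (hasCompactSupport_comp_smul hmc).comp_left (g := Complex.ofReal) Complex.ofReal_zero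
  have h2 : Continuous fun ξ : Eucl n => (m ((2 * Real.pi) • ξ) : ℂ) := by fun_prop
  exact hf.mul (h2.memLp_of_hasCompactSupport (p := ⊤) h1)

theorem integrable_cutoff_mul {m : Eucl n → ℝ} (hm : Continuous m) (hmc : HasCompactSupport m)
    {f : Eucl n → ℂ} (hf : MemLp f 2) :
    Integrable (fun ξ : Eucl n => (m ((2 * Real.pi) • ξ) : ℂ) * f ξ) := by
  have h1 : HasCompactSupport fun ξ : Eucl n => (m ((2 * Real.pi) • ξ) : ℂ) :=
    (hasCompactSupport_comp_smul hmc).comp_left (g := Complex.ofReal) Complex.ofReal_zero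
  have h2 : Continuous fun ξ : Eucl n => (m ((2 * Real.pi) • ξ) : ℂ) := by fun_prop
  exact (h2.memLp_of_hasCompactSupport (p := 2) h1).integrable_mul hf

/-- The plane wave `e^{i(2πξ·x + τ(|ξ|⁴ + ε|ξ|²))}`. -/
noncomputable def planeWave (ε τ : ℝ) (x ξ : Eucl n) : ℂ :=
  Complex.exp (((2 * Real.pi * inner ℝ ξ x + τ * (‖ξ‖ ^ 4 + ε * ‖ξ‖ ^ 2) : ℝ) : ℂ) * Complex.I)

theorem norm_planeWave (ε τ : ℝ) (x ξ : Eucl n) : ‖planeWave ε τ x ξ‖ = 1 :=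
  Complex.norm_exp_ofReal_mul_I _

theorem planeWave_mul_conj (ε τ τ' : ℝ) (x x' ξ : Eucl n) :
    planeWave ε τ x ξ * (starRingEnd ℂ) (planeWave ε τ' x' ξ) =
      planeWave ε (τ - τ') (x - x') ξ := by
  simp only [planeWave, ← Complex.exp_conj, map_mul, Complex.conj_ofReal, Complex.conj_I,
    ← Complex.exp_add, inner_sub_right]
  congr 1
  push_cast
  ring

theorem integral_cutoff_mul_planeWave (χ : Eucl n → ℝ) (c : Eucl n) (ε τ τ' : ℝ)
    (x x' : Eucl n) :
    ∫ ξ, (χ (ξ - c) : ℂ) * (planeWave ε τ x ξ * (starRingEnd ℂ) (planeWave ε τ' x' ξ)) =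
      oscInt χ c (x - x') ε (τ - τ') := by
  simp_rw [planeWave_mul_conj]
  rfl

/-- Evaluating the symbol at `2πξ` rescales time to `(2π)⁴t` and the lower-order coefficient to
`ε/(2π)²`. -/
theorem box_propagator_apply (m : Eucl n → ℝ) (ε t : ℝ) (f : Lp (α := Eucl n) ℂ 2 volume)
    (x : Eucl n) :
    box m (propagator ε t f) x =
      ∫ ξ, planeWave (ε / (2 * Real.pi) ^ 2) ((2 * Real.pi) ^ 4 * t) x ξ *
        ((m ((2 * Real.pi) • ξ) : ℂ) * (𝓕 f : Lp (α := Eucl n) ℂ 2 volume) ξ) := by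
  have h1 : (𝓕 (propagator ε t f) : Lp (α := Eucl n) ℂ 2 volume) =
      (memLp_phase_mul ε t (𝓕 f)).toLp _ := by
    rw [propagator, FourierTransform.fourier_fourierInv_eq]
  rw [box, h1, Real.fourierInv_eq']
  refine integral_congr_ae ?_
  filter_upwards [(memLp_phase_mul ε t (𝓕 f)).coeFn_toLp] with ξ hξ
  rw [hξ, smul_eq_mul]
  have h2 : planeWave (ε / (2 * Real.pi) ^ 2) ((2 * Real.pi) ^ 4 * t) x ξ =
      Complex.exp (((2 * Real.pi * inner ℝ ξ x : ℝ) : ℂ) * Complex.I) *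
        phase ε t ((2 * Real.pi) • ξ) := by
    rw [planeWave, phase, ← Complex.exp_add, ← add_mul, ← Complex.ofReal_add, symbol, norm_smul,
      Real.norm_of_nonneg (by positivity)]
    congr 4
    have : Real.pi ≠ 0 := Real.pi_ne_zero
    field_simp
  rw [h2]
  ring

theorem continuous_integral_planeWave_mul {Z : Type*} [TopologicalSpace Z]
    [FirstCountableTopology Z] (ε : ℝ) {τ : Z → ℝ} (hτ : Continuous τ) {x : Z → Eucl n}
    (hx : Continuous x) {g : Eucl n → ℂ} (hg : Integrable g) :
    Continuous fun z => ∫ ξ, planeWave ε (τ z) (x z) ξ * g ξ := by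
  refine continuous_of_dominated (bound := fun ξ => ‖g ξ‖) (fun z => ?_)
    (fun z => Filter.Eventually.of_forall fun ξ => ?_) hg.norm
    (Filter.Eventually.of_forall fun ξ => ?_)
  · refine AEStronglyMeasurable.mul (Continuous.aestronglyMeasurable ?_) hg.aestronglyMeasurable
    unfold planeWave
    fun_prop
  · rw [norm_mul, norm_planeWave, one_mul]
  · unfold planeWave
    fun_prop

theorem continuous_insertCoord (i : Fin n) :
    Continuous fun p : ℝ × ({j : Fin n // j ≠ i} → ℝ) => insertCoord i p.1 p.2 := by
  unfold insertCoord
  refine (PiLp.continuous_toLp 2 _).comp (continuous_pi fun j => ?_)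
  by_cases h : j = i
  · simp only [h, dite_true]
    exact continuous_fst
  · simp only [h, dite_false]
    fun_prop

theorem abs_sub_le_norm_insertCoord_sub (i : Fin n) (s s' : ℝ) (y y' : {j : Fin n // j ≠ i} → ℝ) :
    |s - s'| ≤ ‖insertCoord i s y - insertCoord i s' y'‖ := by
  have h := PiLp.norm_apply_le (insertCoord i s y - insertCoord i s' y') i
  simpa [insertCoord] using h

/-- Continuity reduces the essential supremum to a countable one, as linearisation requires. -/
theorem eLpNorm_top_le_iSup_denseSeq {Z E : Type*} [TopologicalSpace Z] [MeasurableSpace Z]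
    [TopologicalSpace.SeparableSpace Z] [Nonempty Z] [NormedAddCommGroup E] {F : Z → E}
    (hF : Continuous F) (μ : Measure Z) :
    eLpNorm F ⊤ μ ≤ ⨆ j, ‖F (TopologicalSpace.denseSeq Z j)‖ₑ := by
  rw [eLpNorm_exponent_top]
  refine eLpNormEssSup_le_of_ae_enorm_bound (Filter.Eventually.of_forall ?_)
  set M := ⨆ j, ‖F (TopologicalSpace.denseSeq Z j)‖ₑ
  have hcl : IsClosed {z | ‖F z‖ₑ ≤ M} := isClosed_le hF.enorm continuous_const
  have huniv := ((TopologicalSpace.denseRange_denseSeq Z).mono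
    (Set.range_subset_iff.2 fun j => show TopologicalSpace.denseSeq Z j ∈ {z | ‖F z‖ₑ ≤ M} from
      le_iSup (fun j => ‖F (TopologicalSpace.denseSeq Z j)‖ₑ) j)).closure_eq
  rw [hcl.closure_eq] at huniv
  exact fun z => huniv.ge (Set.mem_univ z)

theorem norm_latticePt_le (k : Fin n → ℤ) : ‖latticePt k‖ ≤ n * kMax k := by
  rw [EuclideanSpace.norm_eq]
  refine Real.sqrt_le_iff.2 ⟨by positivity, ?_⟩
  have h1 : ∀ l, ‖(latticePt k) l‖ ^ 2 ≤ (kMax k : ℝ) ^ 2 := by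
    intro l
    have h2 : (k l).natAbs ≤ kMax k := Finset.le_sup (f := fun l => (k l).natAbs) (Finset.mem_univ l)
    have h3 : ‖(latticePt k) l‖ = ((k l).natAbs : ℝ) := by
      simp [latticePt, Nat.cast_natAbs]
    rw [h3]
    gcongr
  calc ∑ l, ‖(latticePt k) l‖ ^ 2 ≤ ∑ _l : Fin n, (kMax k : ℝ) ^ 2 :=
        Finset.sum_le_sum fun l _ => h1 l
    _ = n * (kMax k : ℝ) ^ 2 := by simp
    _ ≤ n ^ 2 * (kMax k : ℝ) ^ 2 := by
        gcongr
        exact_mod_cast Nat.le_self_pow two_ne_zero n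
    _ = _ := by ring

/-- Cauchy–Schwarz against a translated cutoff; translation invariance makes the constant
independent of `c`. -/
theorem lintegral_enorm_le_of_support {χ : Eucl n → ℝ} (hχ : Continuous χ) {g : Eucl n → ℂ}
    (hg : AEStronglyMeasurable g volume) {c : Eucl n} (hgχ : ∀ ξ, g ξ ≠ 0 → 1 ≤ χ (ξ - c)) :
    ∫⁻ ξ, ‖g ξ‖ₑ ≤ (∫⁻ ξ, ‖χ ξ‖ₑ ^ (2 : ℝ)) ^ (1 / 2 : ℝ) * eLpNorm g 2 volume := by
  have h1 : ∀ ξ, ‖g ξ‖ₑ ≤ ‖χ (ξ - c)‖ₑ * ‖g ξ‖ₑ := by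
    intro ξ
    by_cases h0 : g ξ = 0
    · simp [h0]
    · refine le_mul_of_one_le_left zero_le ?_
      have h2 := hgχ ξ h0
      rw [← ofReal_norm, Real.norm_of_nonneg (by linarith)]
      exact ENNReal.one_le_ofReal.2 h2
  calc ∫⁻ ξ, ‖g ξ‖ₑ ≤ ∫⁻ ξ, ‖χ (ξ - c)‖ₑ * ‖g ξ‖ₑ := lintegral_mono h1
    _ ≤ (∫⁻ ξ, ‖χ (ξ - c)‖ₑ ^ (2 : ℝ)) ^ (1 / 2 : ℝ) * (∫⁻ ξ, ‖g ξ‖ₑ ^ (2 : ℝ)) ^ (1 / 2 : ℝ) :=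
        ENNReal.lintegral_mul_le_Lp_mul_Lq volume Real.HolderConjugate.two_two
          (by fun_prop) hg.enorm
    _ = _ := by
        rw [lintegral_sub_right_eq_self (fun ξ => ‖χ ξ‖ₑ ^ (2 : ℝ)) c,
          eLpNorm_eq_lintegral_rpow_enorm_toReal two_ne_zero ENNReal.ofNat_ne_top]
        simp

end Cutoff

/-! ### The amplitude of `□_k` and the maximal estimates. -/

variable {n : ℕ}

/-- The amplitude `σ(2πξ) f̂(ξ)` of `box σ f`. -/
noncomputable def amplitude (m : Eucl n → ℝ) (f : Lp (α := Eucl n) ℂ 2 volume) (ξ : Eucl n) : ℂ :=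
  (m ((2 * Real.pi) • ξ) : ℂ) * (𝓕 f : Lp (α := Eucl n) ℂ 2 volume) ξ

section

variable {σ : (Fin n → ℤ) → Eucl n → ℝ} (hσ : IsUniformPartition σ) (k : Fin n → ℤ)
  (f : Lp (α := Eucl n) ℂ 2 volume)
include hσ

theorem IsUniformPartition.hasCompactSupport : HasCompactSupport (σ k) := by
  refine HasCompactSupport.of_support_subset_isCompact
    (isCompact_closedBall (latticePt k) (√(n : ℝ))) ((subset_tsupport _).trans ?_)
  refine (hσ.support k).trans fun ξ hξ => ?_
  rwa [Metric.mem_closedBall, dist_eq_norm]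

theorem memLp_amplitude : MemLp (amplitude (σ k) f) 2 volume :=
  memLp_cutoff_mul (hσ.smooth k).continuous (hσ.hasCompactSupport k) (Lp.memLp _)

theorem integrable_amplitude : Integrable (amplitude (σ k) f) :=
  integrable_cutoff_mul (hσ.smooth k).continuous (hσ.hasCompactSupport k) (Lp.memLp _)

theorem eLpNorm_box : eLpNorm (box (σ k) f) 2 volume = eLpNorm (amplitude (σ k) f) 2 volume :=
  eLpNorm_fourierInv_eq (integrable_amplitude hσ k f) (memLp_amplitude hσ k f)

/-- The true radius is `√n/(2π)`; the cruder `n + 1` is positive and so serves as the inner radius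
of one bump shared by all `k`. -/
theorem norm_sub_le_of_amplitude_ne_zero {ξ : Eucl n} (h : amplitude (σ k) f ξ ≠ 0) :
    ‖ξ - (2 * Real.pi)⁻¹ • latticePt k‖ ≤ n + 1 := by
  have h1 : σ k ((2 * Real.pi) • ξ) ≠ 0 := by
    intro h0
    exact h (by simp [amplitude, h0])
  have h2 : ‖(2 * Real.pi) • ξ - latticePt k‖ ≤ √(n : ℝ) := hσ.support k (subset_tsupport _ h1)
  have hpi : (1 : ℝ) ≤ 2 * Real.pi := by linarith [Real.pi_gt_three]
  have h3 : (2 * Real.pi) • ξ - latticePt k =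
      (2 * Real.pi) • (ξ - (2 * Real.pi)⁻¹ • latticePt k) := by
    rw [smul_sub, smul_inv_smul₀ (by positivity)]
  rw [h3, norm_smul, Real.norm_of_nonneg (by positivity)] at h2
  have h4 : √(n : ℝ) ≤ n + 1 := by
    refine Real.sqrt_le_iff.2 ⟨by positivity, ?_⟩
    have : (0 : ℝ) ≤ n := by positivity
    nlinarith
  refine le_trans ?_ (h2.trans h4)
  exact le_mul_of_one_le_left (norm_nonneg _) hpi

end

theorem norm_frequencyCenter_le (hn : 1 ≤ n) (k : Fin n → ℤ) :
    ‖(2 * Real.pi)⁻¹ • latticePt k‖ ≤ n * bracket (kMax k : ℝ) := by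
  have hpi : (2 * Real.pi)⁻¹ ≤ 1 := inv_le_one_of_one_le₀ (by linarith [Real.pi_gt_three])
  rw [norm_smul, Real.norm_of_nonneg (by positivity), bracket, abs_of_nonneg (by positivity)]
  have h1 := norm_latticePt_le k
  have h2 : (0 : ℝ) ≤ n := by positivity
  calc _ ≤ 1 * ‖latticePt k‖ := by gcongr
    _ ≤ _ := by rw [mul_add]; linarith

theorem exists_anisoNorm_top_le {σ : (Fin n → ℤ) → Eucl n → ℝ} (hσ : IsUniformPartition σ) :
    ∃ C : ℝ≥0∞, C ≠ ⊤ ∧ ∀ (ε : ℝ) (i : Fin n) (k : Fin n → ℤ)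
      (f : Lp (α := Eucl n) ℂ 2 volume),
      anisoNorm i ⊤ ⊤ (fun t => box (σ k) (propagator ε t f)) ≤
        C * eLpNorm (box (σ k) f) 2 volume := by
  let χ : ContDiffBump (0 : Eucl n) := ⟨n + 1, n + 2, by positivity, by linarith⟩
  refine ⟨(∫⁻ ξ, ‖χ ξ‖ₑ ^ (2 : ℝ)) ^ (1 / 2 : ℝ), ?_, ?_⟩
  · refine ENNReal.rpow_ne_top_of_nonneg (by norm_num) ?_
    have h1 : MemLp χ 2 (volume : Measure (Eucl n)) :=
      χ.continuous.memLp_of_hasCompactSupport χ.hasCompactSupport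
    have h2 := lintegral_rpow_enorm_lt_top_of_eLpNorm_lt_top two_ne_zero ENNReal.ofNat_ne_top h1.2
    simpa using h2.ne
  · intro ε i k f
    rw [eLpNorm_box hσ]
    have h1 := lintegral_enorm_le_of_support χ.continuous
      (integrable_amplitude hσ k f).aestronglyMeasurable (c := (2 * Real.pi)⁻¹ • latticePt k)
      (fun ξ hξ => (χ.one_of_mem_closedBall (mem_closedBall_zero_iff.2
        (norm_sub_le_of_amplitude_ne_zero hσ k f hξ))).ge)
    refine le_trans ?_ h1
    have h2 : ∀ t x, ‖box (σ k) (propagator ε t f) x‖ₑ ≤ ∫⁻ ξ, ‖amplitude (σ k) f ξ‖ₑ := by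
      intro t x
      rw [box_propagator_apply]
      refine (enorm_integral_le_lintegral_enorm _).trans (lintegral_mono fun ξ => ?_)
      rw [enorm_mul, ← ofReal_norm, norm_planeWave, ENNReal.ofReal_one, one_mul]
      rfl
    rw [anisoNorm, eLpNorm_exponent_top]
    refine eLpNormEssSup_le_of_ae_enorm_bound (Filter.Eventually.of_forall fun s => ?_)
    rw [enorm_eq_self, eLpNorm_exponent_top]
    exact eLpNormEssSup_le_of_ae_enorm_bound (Filter.Eventually.of_forall fun z => h2 _ _)

/-- The maximal `TT*` bound is fed with the spatial decay of the kernel, for one fixed bump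
translated to the centre `c = k/2π`; this is what makes the constant independent of `k`. -/
theorem exists_anisoNorm_ofReal_le {σ : (Fin n → ℤ) → Eucl n → ℝ} (hσ : IsUniformPartition σ)
    (hn : 1 ≤ n) {q : ℝ} (hq : 2 ≤ q) (hqn : 8 / (n : ℝ) < q) :
    ∃ C : ℝ≥0∞, C ≠ ⊤ ∧ ∀ ε ∈ Set.Icc (0 : ℝ) 1, ∀ (i : Fin n) (k : Fin n → ℤ)
      (f : Lp (α := Eucl n) ℂ 2 volume),
      anisoNorm i (ENNReal.ofReal q) ⊤ (fun t => box (σ k) (propagator ε t f)) ≤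
        C * ENNReal.ofReal (bracket (kMax k : ℝ) ^ (3 / q)) * eLpNorm (box (σ k) f) 2 volume := by
  have hq0 : 0 < q := by linarith
  have hn0 : (0 : ℝ) < n := by exact_mod_cast hn
  have hn1 : (1 : ℝ) ≤ n := by exact_mod_cast hn
  let χ : ContDiffBump (0 : Eucl n) := ⟨n + 1, n + 2, by positivity, by linarith⟩
  have hχs : ContDiff ℝ ∞ χ := χ.contDiff
  have hχi : Integrable χ (volume : Measure (Eucl n)) := χ.integrable
  -- Here `2/q ≤ 1` is `q ≥ 2` and `2/q < n/4` is `q > 8/n`. A `β` strictly between `2/q` and `α`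
  -- then makes `(1 + |s|)^{-β}` lie in `L^{q/2}`.
  obtain ⟨α, C₁, hα, hC₁⟩ := exists_norm_oscInt_le_rpow_of_lt hn hχs χ.hasCompactSupport
    (b := 2 / q) (by positivity) ((div_le_one hq0).2 hq) (by
      rw [div_lt_iff₀ hn0] at hqn
      rw [div_lt_iff₀ hq0]
      linarith)
  obtain ⟨β, hβ, hβα⟩ := exists_between hα
  have hβ0 : 0 ≤ β := le_trans (by positivity) hβ.le
  obtain ⟨B, hB0, hB⟩ := exists_norm_oscInt_le_one_add_norm_rpow hχs χ.hasCompactSupport hβ0 hβα hC₁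
  set K := ∫⁻ s : ℝ, ENNReal.ofReal (B * (1 + |s|) ^ (-β)) ^ (q / 2) with hK
  have hKtop : K ≠ ⊤ := (lintegral_decay_rpow_lt_top B (by positivity) (by
    rw [div_lt_iff₀ hq0] at hβ
    linarith)).ne
  refine ⟨ENNReal.ofReal ((n : ℝ) ^ (3 / q)) * K ^ (1 / q), ENNReal.mul_ne_top ENNReal.ofReal_ne_top
    (ENNReal.rpow_ne_top_of_nonneg (by positivity) hKtop), ?_⟩
  intro ε hε i k f
  rw [eLpNorm_box hσ]
  set g := amplitude (σ k) f with hg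
  set c := (2 * Real.pi)⁻¹ • latticePt k with hc
  -- The factor `n` ensures `‖c‖ ≤ N`; it reappears as `n^{3/q}` in the constant.
  set N : ℝ := n * bracket (kMax k : ℝ) with hN
  have hbr : 1 ≤ bracket (kMax k : ℝ) := by
    rw [bracket]
    linarith [abs_nonneg (kMax k : ℝ)]
  have hN1 : 1 ≤ N := one_le_mul_of_one_le_of_one_le hn1 hbr
  have hcN : ‖c‖ ≤ N := norm_frequencyCenter_le hn k
  set ε' := ε / (2 * Real.pi) ^ 2 with hε'
  have hε'1 : ε' ∈ Set.Icc (0 : ℝ) 1 := by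
    have hpi : (1 : ℝ) ≤ (2 * Real.pi) ^ 2 := one_le_pow₀ (by linarith [Real.pi_gt_three])
    exact ⟨div_nonneg hε.1 (by positivity), (div_le_one (by positivity)).2 (hε.2.trans hpi)⟩
  set Z := ℝ × ({j : Fin n // j ≠ i} → ℝ)
  let τ : ℕ → ℝ := fun j => (2 * Real.pi) ^ 4 * (TopologicalSpace.denseSeq Z j).1
  let X : ℕ → ℝ → Eucl n := fun j s => insertCoord i s (TopologicalSpace.denseSeq Z j).2
  have hXc : ∀ j, Continuous (X j) := fun j =>
    (continuous_insertCoord i).comp (continuous_id.prodMk continuous_const)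
  -- Dominates the kernel for every choice of times and transverse coordinates, since `|s - s'|` is
  -- at most the full displacement. Rescaling makes `∫ κ^{q/2}` proportional to `N³`, whose `1/q`-th
  -- power is the claimed growth.
  set κ : ℝ → ℝ≥0∞ := fun s => ENNReal.ofReal (B * (1 + |s / N ^ 3|) ^ (-β)) with hκ
  have hgi : Integrable g := integrable_amplitude hσ k f
  have hsup : ∀ s : ℝ, eLpNorm (fun z : Z =>
      box (σ k) (propagator ε z.1 f) (insertCoord i s z.2)) ⊤ volume ≤
        ⨆ j, ‖∫ ξ, planeWave ε' (τ j) (X j s) ξ * g ξ‖ₑ := by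
    intro s
    have h1 : (fun z : Z => box (σ k) (propagator ε z.1 f) (insertCoord i s z.2)) =
        fun z : Z => ∫ ξ, planeWave ε' ((2 * Real.pi) ^ 4 * z.1) (insertCoord i s z.2) ξ * g ξ := by
      ext z
      rw [box_propagator_apply]
      rfl
    rw [h1]
    exact eLpNorm_top_le_iSup_denseSeq (continuous_integral_planeWave_mul ε' (by fun_prop)
      ((continuous_insertCoord i).comp (continuous_const.prodMk continuous_snd)) hgi) volume
  have hmain := lintegral_iSup_enorm_integral_rpow_le (μ := (volume : Measure (Eucl n)))
    (e := fun j s ξ => planeWave ε' (τ j) (X j s) ξ) (χ := fun ξ => χ (ξ - c)) (g := g) (κ := κ)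
    (q := q) (fun j => by
      refine Continuous.measurable ?_
      have := hXc j
      unfold planeWave
      fun_prop)
    (fun j s ξ => (norm_planeWave _ _ _ _).le) (hχi.comp_sub_right c) (fun ξ => χ.nonneg) hgi
    (fun ξ hξ => (χ.one_of_mem_closedBall (mem_closedBall_zero_iff.2
        (norm_sub_le_of_amplitude_ne_zero hσ k f hξ))).ge)
    (by fun_prop)
    (fun j j' s s' => by
      rw [integral_cutoff_mul_planeWave, ← ofReal_norm]
      refine ENNReal.ofReal_le_ofReal ((hB N hN1 ε' hε'1 _ c _ hcN).trans ?_)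
      have hd : |s - s'| ≤ ‖X j s - X j' s'‖ := abs_sub_le_norm_insertCoord_sub i s s' _ _
      rw [abs_div, abs_of_pos (show 0 < N ^ 3 by positivity)]
      refine mul_le_mul_of_nonneg_left (Real.rpow_le_rpow_of_nonpos (by positivity) ?_
        (by linarith)) hB0
      gcongr) hq
  have hκK : ∫⁻ s, κ s ^ (q / 2) = ENNReal.ofReal (N ^ 3) * K :=
    lintegral_comp_div (fun s => ENNReal.ofReal (B * (1 + |s|) ^ (-β)) ^ (q / 2)) (by fun_prop)
      (by positivity)
  rw [hκK] at hmain
  have hgn : eLpNorm g 2 volume = (∫⁻ ξ, ‖g ξ‖ₑ ^ 2) ^ (1 / 2 : ℝ) := by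
    rw [eLpNorm_eq_lintegral_rpow_enorm_toReal two_ne_zero ENNReal.ofNat_ne_top]
    simp
  have hNq : ENNReal.ofReal (N ^ 3) ^ (1 / q) =
      ENNReal.ofReal ((n : ℝ) ^ (3 / q)) * ENNReal.ofReal (bracket (kMax k : ℝ) ^ (3 / q)) := by
    rw [ENNReal.ofReal_rpow_of_nonneg (by positivity) (by positivity),
      ← ENNReal.ofReal_mul (by positivity), ← Real.mul_rpow (by positivity) (by linarith), ← hN,
      ← Real.rpow_natCast, ← Real.rpow_mul (by positivity)]
    congr 2
    push_cast
    ring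
  rw [anisoNorm, eLpNorm_eq_lintegral_rpow_enorm_toReal (by simpa using hq0) ENNReal.ofReal_ne_top,
    ENNReal.toReal_ofReal hq0.le]
  calc _ ≤ ((∫⁻ ξ, ‖g ξ‖ₑ ^ 2) ^ (q / 2) * (ENNReal.ofReal (N ^ 3) * K)) ^ (1 / q) := by
        refine ENNReal.rpow_le_rpow (le_trans (lintegral_mono fun s => ?_) hmain) (by positivity)
        rw [enorm_eq_self]
        exact ENNReal.rpow_le_rpow (hsup s) hq0.le
    _ = _ := by
        rw [ENNReal.mul_rpow_of_nonneg _ _ (by positivity),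
          ENNReal.mul_rpow_of_nonneg _ _ (by positivity), ← ENNReal.rpow_mul, hNq, hgn]
        have : q / 2 * (1 / q) = 1 / 2 := by field_simp
        rw [this]
        ring

end FourthOrderNLS

/-! ### Conclusion: infinite and finite `q`. -/

theorem proposition3p5 (n : ℕ) (q : ℝ≥0∞) (hq : 2 ≤ q) (hqn : 8 / (n : ℝ≥0∞) < q)
    (σ : (Fin n → ℤ) → FourthOrderNLS.Eucl n → ℝ) (hσ : FourthOrderNLS.IsUniformPartition σ) :
    ∃ C : ℝ≥0, ∀ ε : ℝ, (ε = 0 ∨ ε = 1) → ∀ (i : Fin n) (k : Fin n → ℤ)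
      (u₀ : Lp (α := FourthOrderNLS.Eucl n) ℂ 2 volume),
      FourthOrderNLS.anisoNorm i q ∞
          (fun t => FourthOrderNLS.box (σ k) (FourthOrderNLS.propagator ε t u₀)) ≤
        (C : ℝ≥0∞) *
          ENNReal.ofReal
            (FourthOrderNLS.bracket (FourthOrderNLS.kMax k : ℝ) ^ ((3 / q).toReal)) *
          eLpNorm (FourthOrderNLS.box (σ k) u₀) 2 volume := by
  rcases eq_or_ne q ⊤ with rfl | hqt
  · obtain ⟨C, hC, h⟩ := FourthOrderNLS.exists_anisoNorm_top_le hσ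
    refine ⟨C.toNNReal, fun ε _ i k u₀ => ?_⟩
    rw [ENNReal.coe_toNNReal hC]
    simpa using h ε i k u₀
  · have hn : 1 ≤ n := by
      -- For `n = 0` the quotient `8 / 0` is `⊤` in `ℝ≥0∞`, contradicting `hqn`.
      rcases Nat.eq_zero_or_pos n with rfl | h
      · simp [ENNReal.div_zero] at hqn
      · exact h
    have hq' : ENNReal.ofReal q.toReal = q := ENNReal.ofReal_toReal hqt
    have hq2 : 2 ≤ q.toReal := by
      simpa using ENNReal.toReal_mono hqt hq
    have hqn' : 8 / (n : ℝ) < q.toReal := by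
      simpa using ENNReal.toReal_strict_mono hqt hqn
    obtain ⟨C, hC, h⟩ := FourthOrderNLS.exists_anisoNorm_ofReal_le hσ hn hq2 hqn'
    refine ⟨C.toNNReal, fun ε hε i k u₀ => ?_⟩
    rw [ENNReal.coe_toNNReal hC, ENNReal.toReal_div, ENNReal.toReal_ofNat]
    have h1 := h ε (by rcases hε with rfl | rfl <;> simp) i k u₀
    rwa [hq'] at h1
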